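/- Let $Z_1,\dots,Z_n$ be i.i.d. standard normal and consider the heterogeneous mixture model $X_i=\mu\mathbf 1_{\{\ell_1,\dots,\ell_m\}}(i)+Z_i$, $i=1,\dots,n$, where the $m$ signal locations $\ell_1,\dots,\ell_m$ are drawn at random from $\{1,\dots,n\}$ without replacement, independently of the $Z_i$. We test $H_0:\mu=0$ against $H_1:\mu=\mu(n)=\sqrt{2r\log n}$ with $r>0$, where $m=m_n\sim n^{1-\beta}$ (that is, $m_n/n^{1-\beta}\to1$) and $\frac12<\beta\le1$. Let $$\rho^*(\beta)=\begin{cases}\beta-\frac12,&\frac12<\beta\le\frac34,\\(1-\sqrt{1-\beta})^2,&\frac34<\beta\le1.\end{cases}$$ For $\ell=0,\dots,\ell_{\max}=\lceil\log_2\frac n8\rceil$ let $$\mathcal I_{app}(\ell)=\{(j,k]\subset(0,n]: j,k\in d_\ell\{0,1,2,\dots\},\ 2^{\ell-1}<k-j\le2^\ell\},\qquad d_\ell=\lceil\epsilon_\ell2^{\ell-1}\rceil,\quad \epsilon_\ell=\frac1{6\sqrt{\log_2(n/2^{\ell-1})}},$$ and $n_\ell=\#\mathcal I_{app}(\ell)$.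 Let $p_{(1)}\le\dots\le p_{(n_\ell)}$ be the ordered p-values $P(N(0,1)\ge t)$ evaluated at the values $t=\sum_{i\in I}X_i/\sqrt{|I|}$ with $I\in\mathcal I_{app}(\ell)$, and put $$HC(\ell)=\max_{1\le i\le n_\ell/2}\sqrt{n_\ell}\,\frac{i/n_\ell-p_{(i)}}{\sqrt{p_{(i)}(1-p_{(i)})}},\qquad BJ(\ell)=\max_{1\le i\le n_\ell/2}\Big(i\log\frac{i}{n_\ell p_{(i)}}+(n_\ell-i)\log\frac{1-i/n_\ell}{1-p_{(i)}}\Big)\mathbf 1\Big(p_{(i)}<\frac i{n_\ell}\Big).$$ The structured higher criticism and structured Berk–Jones statistics are $$sHC_n=\max_{0\le\ell\le\ell_{\max}}\sqrt{\frac n{2^\ell n_\ell}}\,HC(\ell),\qquad sBJ_n=\max_{0\le\ell\le\ell_{\max}}\frac n{2^\ell n_\ell}\,BJ(\ell).$$ Then $sHC_n$ and $sBJ_n$ achieve the optimal detection boundary $\rho^*(\beta)$ adaptively: there are critical values $c_n$ for $sHC_n$ and $c_n'$ for $sBJ_n$, depending only on $n$, with $P_{H_0}(sHC_n>c_n)\to0$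 and $P_{H_0}(sBJ_n>c_n')\to0$ as $n\to\infty$, such that for all $\frac12<\beta\le1$, $r>0$ and $m_n\sim n^{1-\beta}$: - if $r>\rho^*(\beta)$, then $P_{H_1}(sHC_n>c_n)\to1$ and $P_{H_1}(sBJ_n>c_n')\to1$; - if $r<\rho^*(\beta)$, then for every sequence of (possibly randomized) tests based on $X_1,\dots,X_n$ the sum of the Type I and Type II errors tends to $1$. -/

import Mathlib

open Filter Topology MeasureTheory ProbabilityTheory

noncomputable section

namespace BlockDetection

/-- The law of `X = Z` (no signal): `n` i.i.d. standard normal observations. -/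
def nullLaw (n : ℕ) : Measure (Fin n → ℝ) :=
  Measure.pi fun _ => gaussianReal 0 1

/-- The law of `X i = μ * 1_S(i) + Z i` where `Z` is i.i.d. standard normal and, independently
of `Z`, the set `S` of signal locations is uniformly distributed over the `m`-element subsets
of the `n` locations (a draw of `m` locations without replacement). -/
def mixtureLaw (n m : ℕ) (μ : ℝ) : Measure (Fin n → ℝ) :=
  (n.choose m : ENNReal)⁻¹ • ∑ S ∈ (Finset.univ : Finset (Fin n)).powersetCard m,
    (nullLaw n).map fun z i => (if i ∈ S then μ else 0) + z i

/-- The sparse detection boundary, as a function of the sparsity `β ∈ (1/2, 1]`. -/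
def detectionBoundary (β : ℝ) : ℝ :=
  if β ≤ 3 / 4 then β - 1 / 2 else (1 - √(1 - β)) ^ 2

/-- The largest level, `⌈log₂ (n / 8)⌉`. -/
def maxLevel (n : ℕ) : ℕ := ⌈Real.logb 2 ((n : ℝ) / 8)⌉₊

/-- The precision `1 / (6 √(log₂ (n / 2 ^ (ℓ - 1))))` at level `ℓ`. -/
def precision (n ℓ : ℕ) : ℝ := 1 / (6 * √(Real.logb 2 ((n : ℝ) / ((2 : ℝ) ^ ℓ / 2))))

/-- The grid spacing `⌈precision * 2 ^ (ℓ - 1)⌉` at level `ℓ`. -/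
def gridStep (n ℓ : ℕ) : ℕ := ⌈precision n ℓ * ((2 : ℝ) ^ ℓ / 2)⌉₊

/-- The approximating set at level `ℓ`: the pair `(j, k)` stands for the interval
`(j, k] ⊆ (0, n]`; both end points are multiples of the grid spacing and
`2 ^ (ℓ - 1) < k - j ≤ 2 ^ ℓ`. -/
def approxIntervals (n ℓ : ℕ) : Finset (ℕ × ℕ) :=
  (Finset.range (n + 1) ×ˢ Finset.range (n + 1)).filter fun I =>
    gridStep n ℓ ∣ I.1 ∧ gridStep n ℓ ∣ I.2 ∧ I.1 < I.2 ∧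
      2 ^ ℓ < 2 * (I.2 - I.1) ∧ I.2 - I.1 ≤ 2 ^ ℓ

/-- The standardized sum of the observations over the interval `(j, k]`. The location with
index `i : Fin n` is the integer `i + 1`. -/
def intervalStat {n : ℕ} (x : Fin n → ℝ) (I : ℕ × ℕ) : ℝ :=
  (∑ i ∈ Finset.univ.filter (fun i : Fin n => I.1 < i.val + 1 ∧ i.val + 1 ≤ I.2), x i) / √((I.2 : ℝ) - (I.1 : ℝ))

/-- The one-sided normal p-value `P(Z ≥ t)`. -/
def pValue (t : ℝ) : ℝ := (gaussianReal 0 1).real (Set.Ici t)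

/-- The p-values pertaining to the approximating set at level `ℓ`, with multiplicity. -/
def levelPValues {n : ℕ} (x : Fin n → ℝ) (ℓ : ℕ) : Multiset ℝ :=
  (approxIntervals n ℓ).val.map fun I => pValue (intervalStat x I)

/-- The `i`-th smallest element of `P`, for `1 ≤ i ≤ card P`. -/
def orderStat (P : Multiset ℝ) (i : ℕ) : ℝ := (P.sort (· ≤ ·)).getD (i - 1) 0

/-- Higher criticism of a collection `P` of `N` p-values: a maximum over `1 ≤ i ≤ N / 2`. -/
def higherCriticism (P : Multiset ℝ) : ℝ :=
  sSup ((fun i : ℕ => √(P.card : ℝ) * (((i : ℝ) / P.card - orderStat P i) /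
    √(orderStat P i * (1 - orderStat P i)))) '' Set.Icc 1 (P.card / 2))

/-- The Berk-Jones statistic of a collection `P` of `N` p-values. -/
def berkJones (P : Multiset ℝ) : ℝ :=
  sSup ((fun i : ℕ => if orderStat P i < (i : ℝ) / P.card then
      (i : ℝ) * Real.log ((i : ℝ) / (P.card * orderStat P i)) +
        ((P.card : ℝ) - i) * Real.log ((1 - (i : ℝ) / P.card) / (1 - orderStat P i))
    else 0) '' Set.Icc 1 (P.card / 2))

/-- The structured higher criticism statistic of the observations `x`. -/
def structuredHC {n : ℕ} (x : Fin n → ℝ) : ℝ :=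
  sSup ((fun ℓ : ℕ => √((n : ℝ) / (2 ^ ℓ * (approxIntervals n ℓ).card)) *
    higherCriticism (levelPValues x ℓ)) '' Set.Icc 0 (maxLevel n))

/-- The structured Berk-Jones statistic of the observations `x`. -/
def structuredBJ {n : ℕ} (x : Fin n → ℝ) : ℝ :=
  sSup ((fun ℓ : ℕ => (n : ℝ) / (2 ^ ℓ * (approxIntervals n ℓ).card) *
    berkJones (levelPValues x ℓ)) '' Set.Icc 0 (maxLevel n))

end BlockDetection

end

noncomputable section

namespace BlockDetection

/-! ### The normal survival function -/

/-! The critical values `log n ^ 3` for higher criticism and `√(log n)` for Berk-Jones work for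
every sparsity: the null statistics stay below them, while the statistics exceed them above the
boundary.

Null hypothesis. The intervals of one level overlap, but sorting them by length and by the residue
of the left end point modulo the length gives O(log n) classes of disjoint intervals of equal length
(`filter_classLabel`, `card_classLabels_le_log`). Within a class the standardized sums are i.i.d.
standard normal (`nullLaw_map_classStat`). If the `i`-th of `N` p-values is `p`, some class has at
least the fraction `i / N` of its p-values at or below `p`. Hence a large statistic at a level
forces a large relative entropy excess of the empirical survival function of one i.i.d. sample. A
Doob-type maximal inequality (`nullLaw_exists_mem_le`), applied on dyadic blocks of p-values, makes
such an excess unlikely (`nullLaw_excessEvent`). Extremely small p-values are excluded by a union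
bound. The scaling `n / (2 ^ ℓ * N)` turns `N` times the relative entropy into about the class size
times it, so the bounds are polylogarithmic at all levels (`structuredBJ_le_of_not_nullBad`,
`structuredHC_le_of_not_nullBad`).

Power. Level 0 consists of the single observations and has scaling factor 1, so it suffices by
itself. At the threshold `√(2 q log n)` the noise count is at most `n ^ (1 - q)` and the signal
count is about `n ^ f` with `f = 1 - β - (√q - √r) ^ 2`. If `f > 0` and `2 f > 1 - q`, Chebyshev's
inequality yields an excess whose square over its variance is a power of `n`; a suitable `q` exists
above the boundary (`exists_threshold`, `eventually_excess_of_sparse`). For `β = 1` there is a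
single signal, which itself exceeds a level that the noise does not reach
(`eventually_excess_of_single`).

Lower bound. The likelihood ratio of the mixture is truncated by requiring each signal observation
to lie below `√(2 log n)`. The result is a subdensity with mean near 1 and second moment near 1
(`integral_truncMixtureRatio_sub_one_sq_le`), so every test has error sum close to 1
(`abs_errors_sub_one_le`). The truncation is what reaches the boundary for large `β`, where the
plain second moment is too large. -/

lemma gaussianPDF_le_one (x : ℝ) : gaussianPDF 0 1 x ≤ 1 := by
  rw [gaussianPDF_def, ← ENNReal.ofReal_one]
  apply ENNReal.ofReal_le_ofReal
  rw [gaussianPDFReal_def]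
  have h1 : (1 : ℝ) ≤ √(2 * Real.pi * (1 : NNReal)) := by
    rw [Real.one_le_sqrt]
    have := Real.pi_gt_three
    simp only [NNReal.coe_one]; linarith
  have h2 : (√(2 * Real.pi * (1 : NNReal)))⁻¹ ≤ 1 := inv_le_one_of_one_le₀ h1
  have h3 : Real.exp (-(x - 0) ^ 2 / (2 * (1 : NNReal))) ≤ 1 := by
    rw [Real.exp_le_one_iff]
    apply div_nonpos_of_nonpos_of_nonneg
    · nlinarith [sq_nonneg (x - 0)]
    · simp
  exact mul_le_one₀ h2 (Real.exp_nonneg _) h3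

lemma gaussianReal_le_volume (s : Set ℝ) : gaussianReal 0 1 s ≤ volume s := by
  rw [gaussianReal_apply 0 one_ne_zero]
  calc _ ≤ ∫⁻ _ in s, 1 := lintegral_mono fun x => gaussianPDF_le_one x
    _ = _ := by simp

instance : NullSingletonClass (gaussianReal 0 1) := nullSingletonClass_gaussianReal one_ne_zero

lemma pValue_sub_eq {a b : ℝ} (h : a ≤ b) :
    pValue a - pValue b = (gaussianReal 0 1).real (Set.Ico a b) := by
  have h1 : Set.Ici a = Set.Ico a b ∪ Set.Ici b := (Set.Ico_union_Ici_eq_Ici h).symm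
  unfold pValue
  rw [h1, measureReal_union _ measurableSet_Ici]
  · ring
  · rw [Set.disjoint_left]; intro x hx hx'; exact absurd hx.2 (not_lt.2 hx')

lemma pValue_strictAnti : StrictAnti pValue := by
  intro a b h
  have h1 := pValue_sub_eq h.le
  have : 0 < (gaussianReal 0 1).real (Set.Ico a b) := by
    rw [measureReal_def, ENNReal.toReal_pos_iff]
    refine ⟨?_, measure_lt_top _ _⟩
    rw [pos_iff_ne_zero]
    intro h0
    have := gaussianReal_absolutelyContinuous' 0 (one_ne_zero (α := NNReal)) h0
    rw [Real.volume_Ico] at this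
    simp at this; linarith
  linarith

lemma pValue_sub_le {a b : ℝ} (h : a ≤ b) : pValue a - pValue b ≤ b - a := by
  rw [pValue_sub_eq h, measureReal_def]
  have := gaussianReal_le_volume (Set.Ico a b)
  rw [Real.volume_Ico] at this
  calc _ ≤ (ENNReal.ofReal (b - a)).toReal := ENNReal.toReal_mono (by simp) this
    _ = _ := ENNReal.toReal_ofReal (by linarith)

lemma continuous_pValue : Continuous pValue := by
  have : LipschitzWith 1 pValue := by
    apply LipschitzWith.of_dist_le_mul
    intro a b
    simp only [NNReal.coe_one, one_mul, Real.dist_eq]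
    rcases le_total a b with h | h
    · rw [abs_of_nonneg (sub_nonneg.2 (pValue_strictAnti.antitone h)), abs_sub_comm,
        abs_of_nonneg (sub_nonneg.2 h)]
      exact pValue_sub_le h
    · rw [abs_sub_comm, abs_of_nonneg (sub_nonneg.2 (pValue_strictAnti.antitone h)),
        abs_of_nonneg (sub_nonneg.2 h)]
      exact pValue_sub_le h
  exact this.continuous

lemma pValue_nonneg (z : ℝ) : 0 ≤ pValue z := measureReal_nonneg

lemma pValue_pos (z : ℝ) : 0 < pValue z :=
  (pValue_nonneg (z + 1)).trans_lt (pValue_strictAnti (by linarith))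

lemma pValue_lt_one (z : ℝ) : pValue z < 1 :=
  (pValue_strictAnti (show z - 1 < z by linarith)).trans_le measureReal_le_one

/-- Chernoff's bound with the optimal tilt `z`. -/
lemma pValue_le_exp {z : ℝ} (hz : 0 ≤ z) : pValue z ≤ Real.exp (-z ^ 2 / 2) := by
  have h := measure_ge_le_exp_mul_mgf (μ := gaussianReal 0 1) (X := id) z hz
    (integrable_exp_mul_gaussianReal z)
  have h2 : mgf id (gaussianReal 0 1) z = Real.exp (z ^ 2 / 2) := by
    rw [mgf_id_gaussianReal]; simp
  rw [h2, ← Real.exp_add] at h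
  calc pValue z ≤ _ := h
    _ = _ := by congr 1; ring

/-- On `[z, z + 1)` the density is at least its value at the right end. Having `z + 1` in place of
`z` is harmless on the exponential scale. -/
lemma exp_le_pValue {z : ℝ} (hz : 0 ≤ z) :
    (√(2 * Real.pi))⁻¹ * Real.exp (-(z + 1) ^ 2 / 2) ≤ pValue z := by
  have h1 : (gaussianReal 0 1).real (Set.Ico z (z + 1)) ≤ pValue z := by
    rw [← pValue_sub_eq (by linarith)]; linarith [pValue_nonneg (z + 1)]
  refine le_trans ?_ h1
  rw [measureReal_def, gaussianReal_apply 0 one_ne_zero]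
  have h2 : ENNReal.ofReal ((√(2 * Real.pi))⁻¹ * Real.exp (-(z + 1) ^ 2 / 2)) ≤
      ∫⁻ x in Set.Ico z (z + 1), gaussianPDF 0 1 x := by
    calc _ = ∫⁻ _ in Set.Ico z (z + 1),
        ENNReal.ofReal ((√(2 * Real.pi))⁻¹ * Real.exp (-(z + 1) ^ 2 / 2)) := by
          simp
      _ ≤ _ := by
        apply setLIntegral_mono (measurable_gaussianPDF 0 1)
        intro x hx
        rw [gaussianPDF_def]
        apply ENNReal.ofReal_le_ofReal
        rw [gaussianPDFReal_def]
        simp only [NNReal.coe_one, mul_one, sub_zero]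
        gcongr
        · linarith [hx.1]
        · exact hx.2.le
  have h3 : ∫⁻ x in Set.Ico z (z + 1), gaussianPDF 0 1 x ≠ ⊤ := by
    rw [← gaussianReal_apply 0 one_ne_zero]; exact measure_ne_top _ _
  rw [← ENNReal.ofReal_le_iff_le_toReal h3]
  exact h2

lemma tendsto_pValue_atBot : Tendsto pValue atBot (𝓝 1) := by
  have := tendsto_measure_Ici_atBot (gaussianReal 0 1)
  rw [measure_univ] at this
  have h2 := (ENNReal.tendsto_toReal (by simp)).comp this
  exact h2

lemma exists_pValue_eq {s : ℝ} (h0 : 0 < s) (h1 : s < 1) : ∃ z, pValue z = s := by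
  obtain ⟨a, ha⟩ := (tendsto_pValue_atBot.eventually (lt_mem_nhds h1)).exists
  have h2 : Tendsto (fun z : ℝ => Real.exp (-z ^ 2 / 2)) atTop (𝓝 0) := by
    apply Real.tendsto_exp_atBot.comp
    have : Tendsto (fun z : ℝ => z ^ 2 / 2) atTop atTop :=
      (tendsto_pow_atTop two_ne_zero).atTop_div_const (by norm_num)
    simp only [neg_div]
    exact tendsto_neg_atTop_atBot.comp this
  obtain ⟨b, hb, hb0⟩ := ((h2.eventually (gt_mem_nhds h0)).and (eventually_ge_atTop 0)).exists
  have hb' : pValue b < s := (pValue_le_exp hb0).trans_lt hb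
  have hab : a ≤ b := by
    by_contra hh
    have := pValue_strictAnti (not_le.1 hh)
    linarith
  obtain ⟨z, -, hz⟩ := intermediate_value_Icc' hab continuous_pValue.continuousOn ⟨hb'.le, ha.le⟩
  exact ⟨z, hz⟩

lemma gaussianReal_Ici (z : ℝ) : gaussianReal 0 1 (Set.Ici z) = ENNReal.ofReal (pValue z) := by
  rw [pValue, ofReal_measureReal]

/-! ### The binary relative entropy -/

/-- The Kullback-Leibler divergence between two Bernoulli laws. -/
def binaryKL (x p : ℝ) : ℝ :=
  x * Real.log (x / p) + (1 - x) * Real.log ((1 - x) / (1 - p))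

/-- The Kullback-Leibler divergence between two Poisson laws. -/
def poissonKL (x p : ℝ) : ℝ := x * Real.log (x / p) - (x - p)

/-- The second term of `binaryKL` is at least `-(x - p)`, by `log y ≤ y - 1` applied to the
reciprocal ratio. -/
lemma poissonKL_le_binaryKL {x p : ℝ} (hpx : p < x) (hx : x < 1) :
    poissonKL x p ≤ binaryKL x p := by
  unfold poissonKL binaryKL
  have h1 : Real.log ((1 - p) / (1 - x)) ≤ (1 - p) / (1 - x) - 1 :=
    Real.log_le_sub_one_of_pos (by apply div_pos <;> linarith)
  have h2 : Real.log ((1 - x) / (1 - p)) = - Real.log ((1 - p) / (1 - x)) := by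
    rw [← Real.log_inv, inv_div]
  rw [h2]
  have h3 : (1 - x) * Real.log ((1 - p) / (1 - x)) ≤ (1 - x) * ((1 - p) / (1 - x) - 1) :=
    mul_le_mul_of_nonneg_left h1 (by linarith)
  have h4 : (1 - x) * ((1 - p) / (1 - x) - 1) = x - p := by
    have : (1 - x) ≠ 0 := by linarith
    field_simp; ring
  linarith

/-- With `w = 1 - p / x` the right side is `x * (-log (1 - w) - w)`, and the power series of `-log
(1 - w)` starts with `w + w ^ 2 / 2`. -/
lemma sq_div_le_poissonKL {x p : ℝ} (hp : 0 < p) (hpx : p ≤ x) :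
    (x - p) ^ 2 / (2 * x) ≤ poissonKL x p := by
  have hx : 0 < x := hp.trans_le hpx
  set w := 1 - p / x with hw
  have hw0 : 0 ≤ w := by rw [hw, sub_nonneg, div_le_one hx]; exact hpx
  have hw1 : w < 1 := by have : 0 < p / x := by positivity
                         linarith
  have hs := Real.hasSum_pow_div_log_of_abs_lt_one (x := w) (by rw [abs_of_nonneg hw0]; exact hw1)
  have h := sum_le_hasSum (Finset.range 2) (fun i _ => by positivity) hs
  simp [Finset.sum_range_succ] at h
  have h1 : Real.log (x / p) = - Real.log (1 - w) := by
    rw [hw, ← Real.log_inv]; congr 1; simp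
  unfold poissonKL
  rw [h1]
  have h2 : p = x * (1 - w) := by rw [hw]; field_simp; ring
  have h3 : (x - p) ^ 2 / (2 * x) = x * (w ^ 2 / 2) := by rw [h2]; field_simp; ring
  rw [h3, h2]
  norm_num at h
  nlinarith

lemma binaryKL_le_sq_div {x p : ℝ} (hp : 0 < p) (hpx : p < x) (hx : x < 1) :
    binaryKL x p ≤ (x - p) ^ 2 / (p * (1 - p)) := by
  unfold binaryKL
  have h1 : Real.log (x / p) ≤ x / p - 1 := Real.log_le_sub_one_of_pos (by apply div_pos <;> linarith)
  have h2 : Real.log ((1 - x) / (1 - p)) ≤ (1 - x) / (1 - p) - 1 :=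
    Real.log_le_sub_one_of_pos (by apply div_pos <;> linarith)
  have h3 := mul_le_mul_of_nonneg_left h1 (show 0 ≤ x by linarith)
  have h4 := mul_le_mul_of_nonneg_left h2 (show 0 ≤ 1 - x by linarith)
  have h5 : x * (x / p - 1) + (1 - x) * ((1 - x) / (1 - p) - 1) = (x - p) ^ 2 / (p * (1 - p)) := by
    have : 1 - p ≠ 0 := by linarith
    field_simp; ring
  linarith

/-- The two divergences differ by at most `(x - p) ^ 2 / (1 - p)`. Since `x ≤ 1 / 2` gives `x ≤ 1 -
p`, this is at most twice the quadratic lower bound for `poissonKL`. The restriction `i ≤ N / 2` in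
the statistics serves this purpose. -/
lemma binaryKL_le_poissonKL {x p : ℝ} (hp : 0 < p) (hpx : p < x) (hx : x ≤ 1 / 2) :
    binaryKL x p ≤ 3 * poissonKL x p := by
  have h0 := sq_div_le_poissonKL hp hpx.le
  have h2 : Real.log ((1 - x) / (1 - p)) ≤ (1 - x) / (1 - p) - 1 :=
    Real.log_le_sub_one_of_pos (by apply div_pos <;> linarith)
  have h4 := mul_le_mul_of_nonneg_left h2 (show 0 ≤ 1 - x by linarith)
  have h5 : (1 - x) * ((1 - x) / (1 - p) - 1) = (x - p) ^ 2 / (1 - p) - (x - p) := by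
    have : 1 - p ≠ 0 := by linarith
    field_simp; ring
  have h6 : (x - p) ^ 2 / (1 - p) ≤ 2 * ((x - p) ^ 2 / (2 * x)) := by
    rw [mul_div_assoc']
    rw [div_le_div_iff₀ (by linarith) (by linarith)]
    nlinarith [sq_nonneg (x - p)]
  unfold binaryKL
  unfold poissonKL at h0 ⊢
  linarith

lemma poissonKL_strictMono {p x y : ℝ} (hp : 0 < p) (hpx : p ≤ x) (hxy : x < y) :
    poissonKL x p < poissonKL y p := by
  have hx : 0 < x := hp.trans_le hpx
  have hy : 0 < y := hx.trans hxy
  unfold poissonKL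
  have h1 : Real.log (x / y) < x / y - 1 :=
    Real.log_lt_sub_one_of_pos (by positivity) (by rw [ne_eq, div_eq_one_iff_eq hy.ne']; exact hxy.ne)
  have h2 : Real.log (x / y) = Real.log (x / p) - Real.log (y / p) := by
    rw [← Real.log_div (by positivity) (by positivity)]; congr 1; field_simp
  have h3 : 0 ≤ Real.log (x / p) := Real.log_nonneg (by rwa [one_le_div hp])
  rw [h2] at h1
  have h4 := mul_lt_mul_of_pos_left h1 hy
  have h5 : y * (x / y - 1) = x - y := by field_simp
  nlinarith

/-! ### A maximal inequality for empirical survival functions -/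

lemma lintegral_mul_eq_of_const_on {μ : Measure ℝ} {A : Set ℝ} (hA : MeasurableSet A)
    {f g G : ℝ → ENNReal} (hG : ∀ y ∈ A, ∀ y' ∈ A, G y = G y') (hfg : ∀ y ∉ A, f y = g y)
    (hf : Measurable f) (hg : Measurable g)
    (h : ∫⁻ y in A, f y ∂μ = ∫⁻ y in A, g y ∂μ) :
    ∫⁻ y, f y * G y ∂μ = ∫⁻ y, g y * G y ∂μ := by
  rw [← lintegral_add_compl _ hA, ← lintegral_add_compl (fun y => g y * G y) hA]
  congr 1
  · rcases A.eq_empty_or_nonempty with rfl | ⟨a, ha⟩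
    · simp
    · have h1 : ∀ k : ℝ → ENNReal, Measurable k →
          ∫⁻ y in A, k y * G y ∂μ = (∫⁻ y in A, k y ∂μ) * G a := by
        intro k hk
        rw [← lintegral_mul_const _ hk]
        exact setLIntegral_congr_fun hA fun y hy => by rw [hG y hy a ha]
      rw [h1 f hf, h1 g hg, h]
  · exact setLIntegral_congr_fun hA.compl fun y hy => by rw [hfg y hy]

/-- This replaces a conditional expectation. The weight `G` does not see where in `A` a coordinate
lies, so on `A` the factor `f` may be exchanged for any `g` with the same integral; this is done one
coordinate at a time. -/
lemma lintegral_prod_mul_eq_of_const_on {n : ℕ} {μ : Measure ℝ} [IsProbabilityMeasure μ]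
    {A : Set ℝ} (hA : MeasurableSet A) {f g : ℝ → ENNReal} {G : (Fin n → ℝ) → ENNReal}
    (hf : Measurable f) (hg : Measurable g) (hGm : Measurable G)
    (hG : ∀ x i, ∀ y ∈ A, ∀ y' ∈ A, G (Function.update x i y) = G (Function.update x i y'))
    (hfg : ∀ y ∉ A, f y = g y) (h : ∫⁻ y in A, f y ∂μ = ∫⁻ y in A, g y ∂μ) :
    ∫⁻ x, (∏ i, f (x i)) * G x ∂(Measure.pi fun _ : Fin n => μ) =
      ∫⁻ x, (∏ i, g (x i)) * G x ∂(Measure.pi fun _ : Fin n => μ) := by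
  have key : ∀ S : Finset (Fin n),
      ∫⁻ x, (∏ i, if i ∈ S then f (x i) else g (x i)) * G x ∂(Measure.pi fun _ : Fin n => μ) =
      ∫⁻ x, (∏ i, g (x i)) * G x ∂(Measure.pi fun _ : Fin n => μ) := by
    intro S
    induction S using Finset.induction_on with
    | empty => simp
    | insert j S hj ih =>
      rw [← ih]
      have hm : ∀ S : Finset (Fin n), Measurable fun x : Fin n → ℝ =>
          (∏ i, if i ∈ S then f (x i) else g (x i)) * G x := by
        intro S
        refine Measurable.mul (Finset.measurable_prod _ fun i _ => ?_) hGm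
        split_ifs
        · exact hf.comp (measurable_pi_apply i)
        · exact hg.comp (measurable_pi_apply i)
      refine lintegral_eq_of_lmarginal_eq {j} (hm _) (hm _) ?_
      rw [lmarginal_singleton, lmarginal_singleton]
      funext x
      have e : ∀ (S : Finset (Fin n)) (y : ℝ),
          (∏ i, if i ∈ S then f (Function.update x j y i) else g (Function.update x j y i)) =
          (if j ∈ S then f y else g y) *
            ∏ i ∈ Finset.univ.erase j, if i ∈ S then f (x i) else g (x i) := by
        intro S y
        rw [← Finset.mul_prod_erase _ _ (Finset.mem_univ j)]
        congr 1
        · simp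
        · refine Finset.prod_congr rfl fun i hi => ?_
          rw [Function.update_of_ne (Finset.ne_of_mem_erase hi)]
      have e2 : ∏ i ∈ Finset.univ.erase j, (if i ∈ insert j S then f (x i) else g (x i)) =
          ∏ i ∈ Finset.univ.erase j, (if i ∈ S then f (x i) else g (x i)) := by
        refine Finset.prod_congr rfl fun i hi => ?_
        simp [Finset.mem_insert, Finset.ne_of_mem_erase hi]
      simp only [e, e2, hj, if_false, Finset.mem_insert_self, if_true]
      simp only [mul_assoc]
      refine lintegral_mul_eq_of_const_on hA (fun y hy y' hy' => ?_) hfg hf hg h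
      rw [hG x j y hy y' hy']
  simpa using key Finset.univ

lemma lintegral_pi_prod {n : ℕ} {μ : Measure ℝ} [IsProbabilityMeasure μ]
    {f : Fin n → ℝ → ENNReal} (hf : ∀ i, Measurable (f i)) :
    ∫⁻ x, ∏ i, f i (x i) ∂(Measure.pi fun _ : Fin n => μ) = ∏ i, ∫⁻ y, f i y ∂μ := by
  have h := lintegral_prod_eq_prod_lintegral_of_indepFun Finset.univ
    (fun (i : Fin n) (x : Fin n → ℝ) => f i (x i))
    (iIndepFun_pi (μ := fun _ : Fin n => μ) fun i => (hf i).aemeasurable)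
    (fun i => (hf i).comp (measurable_pi_apply i))
  rw [h]
  refine Finset.prod_congr rfl fun i _ => ?_
  exact (measurePreserving_eval (fun _ : Fin n => μ) i).lintegral_comp (hf i)

/-- The number of observations that are at least `z`. -/
def survivalCount {n : ℕ} (x : Fin n → ℝ) (z : ℝ) : ℕ :=
  (Finset.univ.filter fun i => z ≤ x i).card

lemma measurable_survivalCount {n : ℕ} (z : ℝ) :
    Measurable fun x : Fin n → ℝ => (survivalCount x z : ℝ) := by
  have : (fun x : Fin n → ℝ => (survivalCount x z : ℝ)) =
      fun x => ∑ i, (Set.Ici z).indicator (fun _ => (1 : ℝ)) (x i) := by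
    funext x
    rw [survivalCount, Finset.card_filter]
    push_cast
    simp only [Set.indicator_apply, Set.mem_Ici]
  rw [this]
  refine Finset.measurable_sum _ fun i _ => ?_
  exact (measurable_const.indicator measurableSet_Ici).comp (measurable_pi_apply i)

lemma survivalCount_antitone {n : ℕ} (x : Fin n → ℝ) : Antitone (survivalCount x) := by
  intro z z' h
  refine Finset.card_le_card fun i hi => ?_
  simp only [Finset.mem_filter, Finset.mem_univ, true_and] at hi ⊢
  exact h.trans hi

lemma survivalCount_update {n : ℕ} (x : Fin n → ℝ) (i : Fin n) {z y y' : ℝ} (hy : z ≤ y)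
    (hy' : z ≤ y') :
    survivalCount (Function.update x i y) z = survivalCount (Function.update x i y') z := by
  unfold survivalCount
  congr 1
  ext j
  by_cases h : j = i
  · subst h; simp [hy, hy']
  · simp [Function.update_of_ne h]

lemma prod_step {n : ℕ} (x : Fin n → ℝ) (z : ℝ) (c : ENNReal) :
    ∏ i, (Set.Ici z).piecewise (fun _ => c) (fun _ => 1) (x i) = c ^ survivalCount x z := by
  simp [Set.piecewise, Finset.prod_ite, survivalCount]

lemma exp_mul_le_one_add {u θ : ℝ} (h0 : 0 ≤ u) (h1 : u ≤ 1) :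
    Real.exp (θ * u) ≤ 1 + u * (Real.exp θ - 1) := by
  have := convexOn_exp.2 (Set.mem_univ θ) (Set.mem_univ 0) h0 (sub_nonneg.2 h1) (by ring)
  simp only [smul_eq_mul, mul_zero, add_zero, Real.exp_zero, mul_one] at this
  rw [mul_comm θ u]; linarith

lemma lintegral_step {z₀ c : ℝ} (hc : 0 ≤ c) :
    ∫⁻ y, (Set.Ici z₀).piecewise (fun _ => ENNReal.ofReal c) (fun _ => 1) y ∂(gaussianReal 0 1) =
      ENNReal.ofReal (1 + pValue z₀ * (c - 1)) := by
  rw [← lintegral_add_compl _ (measurableSet_Ici (a := z₀))]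
  have h1 : ∫⁻ y in Set.Ici z₀, (Set.Ici z₀).piecewise (fun _ => ENNReal.ofReal c) (fun _ => 1) y
      ∂(gaussianReal 0 1) = ENNReal.ofReal (c * pValue z₀) := by
    rw [setLIntegral_congr_fun measurableSet_Ici (g := fun _ => ENNReal.ofReal c)
      (fun y hy => Set.piecewise_eq_of_mem _ _ _ hy)]
    rw [setLIntegral_const, gaussianReal_Ici, ENNReal.ofReal_mul hc]
  have h2 : ∫⁻ y in (Set.Ici z₀)ᶜ, (Set.Ici z₀).piecewise (fun _ => ENNReal.ofReal c) (fun _ => 1) y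
      ∂(gaussianReal 0 1) = ENNReal.ofReal (1 - pValue z₀) := by
    rw [setLIntegral_congr_fun measurableSet_Ici.compl (g := fun _ => 1)
      (fun y hy => Set.piecewise_eq_of_notMem _ _ _ hy)]
    rw [setLIntegral_const, one_mul, prob_compl_eq_one_sub measurableSet_Ici, gaussianReal_Ici,
      ENNReal.ofReal_sub _ (pValue_nonneg _), ENNReal.ofReal_one]
  rw [h1, h2, ← ENNReal.ofReal_add (mul_nonneg hc (pValue_nonneg _))
    (by linarith [pValue_lt_one z₀])]
  congr 1; ring

lemma setLIntegral_step {z z₀ c : ℝ} (hz : z ≤ z₀) (hc : 0 ≤ c) :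
    ∫⁻ y in Set.Ici z, (Set.Ici z₀).piecewise (fun _ => ENNReal.ofReal c) (fun _ => 1) y
      ∂(gaussianReal 0 1) = ENNReal.ofReal (pValue z + pValue z₀ * (c - 1)) := by
  have h := lintegral_step (z₀ := z₀) hc
  rw [← lintegral_add_compl _ (measurableSet_Ici (a := z))] at h
  have h2 : ∫⁻ y in (Set.Ici z)ᶜ, (Set.Ici z₀).piecewise (fun _ => ENNReal.ofReal c) (fun _ => 1) y
      ∂(gaussianReal 0 1) = ENNReal.ofReal (1 - pValue z) := by
    rw [setLIntegral_congr_fun measurableSet_Ici.compl (g := fun _ => 1)]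
    · rw [setLIntegral_const, one_mul, prob_compl_eq_one_sub measurableSet_Ici, gaussianReal_Ici,
        ENNReal.ofReal_sub _ (pValue_nonneg _), ENNReal.ofReal_one]
    · intro y hy
      refine Set.piecewise_eq_of_notMem _ _ _ fun hy' => hy ?_
      exact hz.trans hy'
  rw [h2] at h
  have hp : pValue z₀ ≤ pValue z := pValue_strictAnti.antitone hz
  have h3 : ENNReal.ofReal (1 + pValue z₀ * (c - 1)) =
      ENNReal.ofReal (pValue z + pValue z₀ * (c - 1)) + ENNReal.ofReal (1 - pValue z) := by
    rw [← ENNReal.ofReal_add]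
    · congr 1; ring
    · nlinarith [pValue_nonneg z₀, mul_nonneg hc (pValue_nonneg z₀)]
    · linarith [pValue_lt_one z]
  rw [h3] at h
  exact (ENNReal.add_left_inj ENNReal.ofReal_ne_top).1 h

/-- Doob's maximal inequality for the martingale `survivalCount x z / pValue z`, with `z` increasing
to `z₀`, after exponentiation at the final time. The paths are split at the first `z` in `T` where
the bound is crossed. The event of a first crossing at `z` is insensitive to the exact values of the
observations above `z`, so there the exponential weight at `z₀` can be averaged over `[z, ∞)`. -/
lemma nullLaw_exists_mem_le {n : ℕ} {z₀ θ lam : ℝ} (hθ : 0 ≤ θ) (T : Finset ℝ)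
    (hT : ∀ z ∈ T, z ≤ z₀) :
    nullLaw n {x | ∃ z ∈ T, lam * (n * pValue z) ≤ survivalCount x z} ≤
      ENNReal.ofReal (Real.exp (-(θ * (lam * (n * pValue z₀)))) *
        (1 + pValue z₀ * (Real.exp θ - 1)) ^ n) := by
  set H : ℝ → Set (Fin n → ℝ) := fun z => {x | lam * (n * pValue z) ≤ survivalCount x z} with hH
  have hHm : ∀ z, MeasurableSet (H z) := fun z =>
    measurableSet_le measurable_const (measurable_survivalCount z)
  -- First crossing at `z`; these events are disjoint and cover the event in question.
  set E : ℝ → Set (Fin n → ℝ) := fun z => H z \ ⋃ z' ∈ T.filter (· < z), H z' with hE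
  have hEm : ∀ z, MeasurableSet (E z) := fun z =>
    (hHm z).diff (Finset.measurableSet_biUnion _ fun z' _ => hHm z')
  have hdisj : ∀ x, ∑ z ∈ T, (E z).indicator (fun _ => (1 : ENNReal)) x ≤ 1 := by
    intro x
    by_cases h : ∃ z ∈ T, x ∈ E z
    · obtain ⟨z, hz, hx⟩ := h
      rw [Finset.sum_eq_single z]
      · exact Set.indicator_le (fun _ _ => le_rfl) x
      · intro z' hz' hne
        refine Set.indicator_of_notMem (fun hx' => ?_) _
        rcases lt_or_gt_of_ne hne with hlt | hlt
        · refine hx.2 (Set.mem_biUnion (x := z') ?_ hx'.1)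
          simp [hz', hlt]
        · refine hx'.2 (Set.mem_biUnion (x := z) ?_ hx.1)
          simp [hz, hlt]
      · intro h; exact absurd hz h
    · push Not at h
      rw [Finset.sum_eq_zero]
      · exact bot_le
      · intro z hz; exact Set.indicator_of_notMem (h z hz) _
  have hcover : {x | ∃ z ∈ T, lam * (n * pValue z) ≤ survivalCount x z} ⊆ ⋃ z ∈ T, E z := by
    rintro x ⟨z, hz, hx⟩
    have hne : (T.filter fun z => x ∈ H z).Nonempty := ⟨z, by simp [hz]; exact hx⟩
    obtain ⟨w, hw, hmin⟩ := (T.filter fun z => x ∈ H z).exists_min_image id hne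
    simp only [Finset.mem_filter] at hw hmin
    refine Set.mem_biUnion (x := w) hw.1 ⟨hw.2, ?_⟩
    simp only [Set.mem_iUnion, not_exists]
    intro z' hz' hx'
    simp only [Finset.mem_filter] at hz'
    exact absurd (hmin z' ⟨hz'.1, hx'⟩) (not_le.2 hz'.2)
  set f : ℝ → ENNReal :=
    (Set.Ici z₀).piecewise (fun _ => ENNReal.ofReal (Real.exp θ)) (fun _ => 1) with hf
  have hfm : Measurable f := Measurable.piecewise measurableSet_Ici measurable_const measurable_const
  have hEz : ∀ z ∈ T, ENNReal.ofReal (Real.exp (θ * (lam * (n * pValue z₀)))) * nullLaw n (E z) ≤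
      ∫⁻ x, (∏ i, f (x i)) * (E z).indicator (fun _ => 1) x ∂(nullLaw n) := by
    intro z hz
    have hu0 : 0 ≤ pValue z₀ / pValue z := div_nonneg (pValue_nonneg _) (pValue_nonneg _)
    have hu1 : pValue z₀ / pValue z ≤ 1 :=
      (div_le_one (pValue_pos z)).2 (pValue_strictAnti.antitone (hT z hz))
    -- The conditional mean of the step weight `f` given an observation at least `z`; by convexity
    -- it is at least `exp (θ * (pValue z₀ / pValue z))`.
    set c := 1 + pValue z₀ / pValue z * (Real.exp θ - 1) with hc
    have hcexp : Real.exp (θ * (pValue z₀ / pValue z)) ≤ c := exp_mul_le_one_add hu0 hu1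
    have hc0 : 0 ≤ c := (Real.exp_nonneg _).trans hcexp
    set g : ℝ → ENNReal :=
      (Set.Ici z).piecewise (fun _ => ENNReal.ofReal c) (fun _ => 1) with hg
    have hgm : Measurable g :=
      Measurable.piecewise measurableSet_Ici measurable_const measurable_const
    have heq := lintegral_prod_mul_eq_of_const_on (n := n) (μ := gaussianReal 0 1)
      (measurableSet_Ici (a := z)) (f := f) (g := g)
      (G := (E z).indicator (fun _ => 1)) hfm hgm (measurable_const.indicator (hEm z))
      (by
        intro x i y hy y' hy'
        have : ∀ y'' ∈ Set.Ici z, ∀ y ∈ Set.Ici z, Function.update x i y ∈ E z →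
            Function.update x i y'' ∈ E z := by
          intro y'' hy'' y hy hx
          refine ⟨?_, ?_⟩
          · have := hx.1
            simp only [hH, Set.mem_ofPred_eq] at this ⊢
            rwa [survivalCount_update x i hy'' hy]
          · intro hh
            refine hx.2 ?_
            simp only [Set.mem_iUnion, Finset.mem_filter] at hh ⊢
            obtain ⟨z', hz', hh⟩ := hh
            refine ⟨z', hz', ?_⟩
            simp only [hH, Set.mem_ofPred_eq] at hh ⊢
            rwa [survivalCount_update x i (hz'.2.le.trans hy) (hz'.2.le.trans hy'')]
        have hiff : Function.update x i y ∈ E z ↔ Function.update x i y' ∈ E z :=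
          ⟨this y' hy' y hy, this y hy y' hy'⟩
        by_cases hx : Function.update x i y ∈ E z
        · rw [Set.indicator_of_mem hx, Set.indicator_of_mem (hiff.1 hx)]
        · rw [Set.indicator_of_notMem hx, Set.indicator_of_notMem (fun h => hx (hiff.2 h))])
      (by
        intro y hy
        rw [hf, hg, Set.piecewise_eq_of_notMem _ _ _ hy, Set.piecewise_eq_of_notMem]
        exact fun h => hy ((hT z hz).trans h))
      (by
        rw [hf, hg, setLIntegral_step (hT z hz) (Real.exp_nonneg _), setLIntegral_step le_rfl hc0]
        congr 1
        have := (pValue_pos z).ne'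
        rw [hc]; field_simp; ring)
    rw [nullLaw, heq, ← setLIntegral_const, ← lintegral_indicator (hEm z)]
    refine lintegral_mono fun x => ?_
    by_cases hx : x ∈ E z
    · simp only [Set.indicator_of_mem hx, mul_one]
      rw [hg, prod_step, ← ENNReal.ofReal_pow hc0]
      apply ENNReal.ofReal_le_ofReal
      calc Real.exp (θ * (lam * (n * pValue z₀)))
          = Real.exp (θ * (pValue z₀ / pValue z) * (lam * (n * pValue z))) := by
            congr 1; have := (pValue_pos z).ne'; field_simp
        _ ≤ Real.exp (θ * (pValue z₀ / pValue z) * survivalCount x z) := by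
            rw [Real.exp_le_exp]
            exact mul_le_mul_of_nonneg_left hx.1 (mul_nonneg hθ hu0)
        _ = Real.exp (θ * (pValue z₀ / pValue z)) ^ survivalCount x z := by
            rw [mul_comm, ← Real.exp_nat_mul]
        _ ≤ c ^ survivalCount x z := pow_le_pow_left₀ (Real.exp_nonneg _) hcexp _
    · simp [Set.indicator_of_notMem hx]
  have htotal : ENNReal.ofReal (Real.exp (θ * (lam * (n * pValue z₀)))) *
      nullLaw n {x | ∃ z ∈ T, lam * (n * pValue z) ≤ survivalCount x z} ≤
      ENNReal.ofReal ((1 + pValue z₀ * (Real.exp θ - 1)) ^ n) := by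
    have hexp1 : 0 ≤ Real.exp θ - 1 := by linarith [Real.add_one_le_exp θ]
    calc _ ≤ ENNReal.ofReal (Real.exp (θ * (lam * (n * pValue z₀)))) *
          ∑ z ∈ T, nullLaw n (E z) := by
          gcongr
          exact (measure_mono hcover).trans (measure_biUnion_finset_le T E)
      _ ≤ ∑ z ∈ T, ∫⁻ x, (∏ i, f (x i)) * (E z).indicator (fun _ => 1) x ∂(nullLaw n) := by
          rw [Finset.mul_sum]
          exact Finset.sum_le_sum hEz
      _ = ∫⁻ x, ∑ z ∈ T, (∏ i, f (x i)) * (E z).indicator (fun _ => 1) x ∂(nullLaw n) := by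
          rw [lintegral_finsetSum]
          intro z _
          refine Measurable.mul (Finset.measurable_prod _ fun i _ => ?_)
            (measurable_const.indicator (hEm z))
          exact hfm.comp (measurable_pi_apply i)
      _ ≤ ∫⁻ x, ∏ i, f (x i) ∂(nullLaw n) := by
          refine lintegral_mono fun x => ?_
          rw [← Finset.mul_sum]
          exact mul_le_of_le_one_right' (hdisj x)
      _ = ENNReal.ofReal ((1 + pValue z₀ * (Real.exp θ - 1)) ^ n) := by
          rw [nullLaw, lintegral_pi_prod fun _ => hfm]
          simp only [hf, lintegral_step (Real.exp_nonneg θ), Finset.prod_const, Finset.card_univ,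
            Fintype.card_fin]
          rw [ENNReal.ofReal_pow]
          have := pValue_nonneg z₀
          positivity
  rw [Real.exp_neg, ENNReal.ofReal_mul (by positivity), ENNReal.ofReal_inv_of_pos (Real.exp_pos _)]
  rw [← ENNReal.div_eq_inv_mul, ENNReal.le_div_iff_mul_le]
  · rwa [mul_comm]
  · left; simp [Real.exp_pos]
  · left; exact ENNReal.ofReal_ne_top

instance (n : ℕ) : IsProbabilityMeasure (nullLaw n) := by
  unfold nullLaw; infer_instance

/-- The finite case extends to all thresholds through finite sets of rationals and continuity of
measure along a directed union. The binomial moment generating function is then bounded by the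
Poisson one. -/
lemma nullLaw_exists_lt {n : ℕ} {z₀ lam : ℝ} (hlam : 1 ≤ lam) :
    nullLaw n {x | ∃ z ≤ z₀, lam * (n * pValue z) < survivalCount x z} ≤
      ENNReal.ofReal (Real.exp (-(n * (pValue z₀ * poissonKL lam 1)))) := by
  set V : Finset ℚ → Set (Fin n → ℝ) := fun T =>
    {x | ∃ z ∈ (T.image (fun q : ℚ => (q : ℝ))).filter (· ≤ z₀),
      lam * (n * pValue z) ≤ survivalCount x z} with hV
  have hsub : {x : Fin n → ℝ | ∃ z ≤ z₀, lam * (n * pValue z) < survivalCount x z} ⊆ ⋃ T, V T := by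
    rintro x ⟨z, hz, hx⟩
    have hcont : Continuous fun z : ℝ => lam * (n * pValue z) :=
      continuous_const.mul (continuous_const.mul continuous_pValue)
    -- The rational is taken to the left of `z`: the strict inequality survives by continuity of
    -- `pValue`, and the count only grows.
    have hev : ∀ᶠ w in 𝓝[<] z, lam * (n * pValue w) < survivalCount x z :=
      (hcont.continuousAt.eventually (gt_mem_nhds hx)).filter_mono nhdsWithin_le_nhds
    obtain ⟨l, hl, hlz⟩ := (mem_nhdsLT_iff_exists_Ioo_subset).1 hev
    obtain ⟨q, hq1, hq2⟩ := exists_rat_btwn (Set.mem_Iio.1 hl)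
    refine Set.mem_iUnion.2 ⟨{q}, (q : ℝ), ?_, ?_⟩
    · simp only [Finset.image_singleton, Finset.mem_filter, Finset.mem_singleton, true_and]
      linarith
    · refine (hlz ⟨hq1, hq2⟩).le.trans ?_
      exact_mod_cast survivalCount_antitone x hq2.le
  refine (measure_mono hsub).trans ?_
  have hdir : Directed (· ⊆ ·) V := by
    refine Monotone.directed_le fun T T' h x => ?_
    rintro ⟨z, hz, hx⟩
    refine ⟨z, ?_, hx⟩
    rw [Finset.mem_filter] at hz ⊢
    exact ⟨Finset.image_subset_image h hz.1, hz.2⟩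
  rw [hdir.measure_iUnion]
  refine iSup_le fun T => ?_
  -- The Chernoff parameter `θ = log lam` is the optimal one for a Poisson variable.
  have hθ := Real.log_nonneg hlam
  refine (nullLaw_exists_mem_le hθ _ fun z hz => (Finset.mem_filter.1 hz).2).trans ?_
  apply ENNReal.ofReal_le_ofReal
  rw [Real.exp_log (by linarith)]
  have h1 : (1 + pValue z₀ * (lam - 1)) ^ n ≤ Real.exp (n * (pValue z₀ * (lam - 1))) := by
    rw [Real.exp_nat_mul]
    refine pow_le_pow_left₀ ?_ ?_ _
    · nlinarith [pValue_nonneg z₀]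
    · rw [add_comm]; exact Real.add_one_le_exp _
  calc _ ≤ Real.exp (-(Real.log lam * (lam * (n * pValue z₀)))) *
        Real.exp (n * (pValue z₀ * (lam - 1))) := by gcongr
    _ = _ := by
      rw [← Real.exp_add]; congr 1; unfold poissonKL; rw [div_one]; ring

lemma continuousOn_poissonKL_one : ContinuousOn (fun y => poissonKL y 1) (Set.Ici 1) := by
  unfold poissonKL
  intro y hy
  have : y / 1 ≠ 0 := by rw [div_one]; have : (1 : ℝ) ≤ y := hy
                         positivity
  apply ContinuousAt.continuousWithinAt
  fun_prop (disch := assumption)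

lemma poissonKL_mul {y p : ℝ} (hp : 0 < p) : poissonKL (y * p) p = p * poissonKL y 1 := by
  unfold poissonKL
  have : y * p / p = y := by field_simp
  rw [this, div_one]; ring

/-- The event that some threshold with p-value in `J` has a relative entropy excess over `C`. -/
def excessEvent (n : ℕ) (J : Set ℝ) (C : ℝ) : Set (Fin n → ℝ) :=
  {x | ∃ z, pValue z ∈ J ∧ ∃ u, pValue z < u ∧ u ≤ 1 / 2 ∧ u * n ≤ survivalCount x z ∧
    C < n * binaryKL u (pValue z)}

/-- On a dyadic block the entropy excess becomes the crossing of one fixed multiple of the mean. The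
constant 6 is the 3 of `binaryKL_le_poissonKL` times the ratio 2 of the end points. -/
lemma nullLaw_excessEvent_block {n : ℕ} {a C : ℝ} (ha : 0 < a) (ha1 : a < 1) (hC : 0 ≤ C) :
    nullLaw n (excessEvent n (Set.Icc a (2 * a)) C) ≤ ENNReal.ofReal (Real.exp (-(C / 6))) := by
  have hkey : ∀ z u, pValue z ∈ Set.Icc a (2 * a) → pValue z < u → u ≤ 1 / 2 →
      C < n * binaryKL u (pValue z) → 1 ≤ u / pValue z ∧
        C / 6 < n * (a * poissonKL (u / pValue z) 1) ∧ 0 < (n : ℝ) := by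
    intro z u hz hu hu2 hCu
    have hp := pValue_pos z
    have h1 : 1 ≤ u / pValue z := by rw [one_le_div hp]; exact hu.le
    have hn : 0 < (n : ℝ) := by
      rcases Nat.eq_zero_or_pos n with h | h
      · subst h; simp at hCu; linarith
      · exact_mod_cast h
    refine ⟨h1, ?_, hn⟩
    have h2 := binaryKL_le_poissonKL hp hu hu2
    have h3 : poissonKL u (pValue z) = pValue z * poissonKL (u / pValue z) 1 := by
      rw [← poissonKL_mul hp]; congr 1; field_simp
    have h4 : 0 ≤ poissonKL (u / pValue z) 1 :=
      le_trans (by positivity) (sq_div_le_poissonKL one_pos h1)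
    have h5 : pValue z * poissonKL (u / pValue z) 1 ≤ 2 * a * poissonKL (u / pValue z) 1 :=
      mul_le_mul_of_nonneg_right hz.2 h4
    have h6 : n * binaryKL u (pValue z) ≤ n * (3 * (2 * a * poissonKL (u / pValue z) 1)) := by
      gcongr; linarith
    linarith
  by_cases hne : (excessEvent n (Set.Icc a (2 * a)) C).Nonempty
  swap
  · rw [Set.not_nonempty_iff_eq_empty.1 hne]; simp
  obtain ⟨x, z, hz, u, hu, hu2, -, hCu⟩ := hne
  obtain ⟨h1, h2, hn⟩ := hkey z u hz hu hu2 hCu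
  -- A point of the event supplies the upper end for the intermediate value theorem; if the event is
  -- empty there is nothing to prove.
  obtain ⟨lam, hlam, hlameq⟩ : ∃ lam ∈ Set.Icc 1 (u / pValue z),
      n * (a * poissonKL lam 1) = C / 6 := by
    have hc : ContinuousOn (fun y => n * (a * poissonKL y 1)) (Set.Icc 1 (u / pValue z)) :=
      (continuousOn_const.mul (continuousOn_const.mul continuousOn_poissonKL_one)).mono
        Set.Icc_subset_Ici_self
    have := intermediate_value_Icc h1 hc
    obtain ⟨lam, h, h'⟩ := this ⟨by simp [poissonKL]; linarith, h2.le⟩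
    exact ⟨lam, h, h'⟩
  obtain ⟨z₀, hz₀⟩ := exists_pValue_eq ha ha1
  have hsub : excessEvent n (Set.Icc a (2 * a)) C ⊆
      {x | ∃ z ≤ z₀, lam * (n * pValue z) < survivalCount x z} := by
    rintro x ⟨z, hz, u, hu, hu2, hx, hCu⟩
    obtain ⟨h1, h2, -⟩ := hkey z u hz hu hu2 hCu
    have hlt : lam < u / pValue z := by
      by_contra hcon
      have hle : poissonKL (u / pValue z) 1 ≤ poissonKL lam 1 := by
        rcases (not_lt.1 hcon).eq_or_lt with h | h
        · rw [h]
        · exact (poissonKL_strictMono one_pos h1 h).le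
      have : n * (a * poissonKL (u / pValue z) 1) ≤ n * (a * poissonKL lam 1) := by gcongr
      linarith
    refine ⟨z, ?_, lt_of_lt_of_le ?_ hx⟩
    · rw [← pValue_strictAnti.le_iff_ge, hz₀]; exact hz.1
    · rw [lt_div_iff₀ (pValue_pos z)] at hlt
      nlinarith
  refine (measure_mono hsub).trans ((nullLaw_exists_lt hlam.1).trans ?_)
  rw [hz₀, hlameq]

/-- Peeling: the p-values from `2 ^ (-B)` to 1 are covered by `B` dyadic blocks, each of them
costing the same probability. -/
lemma nullLaw_excessEvent {n : ℕ} (B : ℕ) {C : ℝ} (hC : 0 ≤ C) :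
    nullLaw n (excessEvent n (Set.Ici ((2 : ℝ)⁻¹ ^ B)) C) ≤
      B * ENNReal.ofReal (Real.exp (-(C / 6))) := by
  induction B with
  | zero =>
    have : excessEvent n (Set.Ici ((2 : ℝ)⁻¹ ^ 0)) C = ∅ := by
      rw [Set.eq_empty_iff_forall_notMem]
      rintro x ⟨z, hz, -⟩
      have := pValue_lt_one z
      simp at hz; linarith
    rw [this]; simp
  | succ B ih =>
    have hsub : excessEvent n (Set.Ici ((2 : ℝ)⁻¹ ^ (B + 1))) C ⊆
        excessEvent n (Set.Ici ((2 : ℝ)⁻¹ ^ B)) C ∪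
          excessEvent n (Set.Icc ((2 : ℝ)⁻¹ ^ (B + 1)) (2 * (2 : ℝ)⁻¹ ^ (B + 1))) C := by
      rintro x ⟨z, hz, h⟩
      have h2 : 2 * (2 : ℝ)⁻¹ ^ (B + 1) = (2 : ℝ)⁻¹ ^ B := by rw [pow_succ]; ring
      rcases le_total ((2 : ℝ)⁻¹ ^ B) (pValue z) with hl | hl
      · exact Or.inl ⟨z, hl, h⟩
      · exact Or.inr ⟨z, ⟨hz, by rwa [h2]⟩, h⟩
    refine (measure_mono hsub).trans ((measure_union_le _ _).trans ?_)
    push_cast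
    rw [add_mul, one_mul]
    refine add_le_add ih (nullLaw_excessEvent_block (by positivity) ?_ hC)
    exact pow_lt_one₀ (by norm_num) (by norm_num) (by omega)

/-! ### Standardized sums over disjoint blocks -/

lemma iIndepFun_nullLaw (n : ℕ) : iIndepFun (fun (i : Fin n) (x : Fin n → ℝ) => x i) (nullLaw n) :=
  iIndepFun_pi (X := fun _ : Fin n => (id : ℝ → ℝ)) (μ := fun _ : Fin n => gaussianReal 0 1)
    fun _ => aemeasurable_id

lemma nullLaw_map_eval {n : ℕ} (i : Fin n) : (nullLaw n).map (fun x => x i) = gaussianReal 0 1 :=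
  (measurePreserving_eval (fun _ : Fin n => gaussianReal 0 1) i).map_eq

lemma hasGaussianLaw_eval {n : ℕ} (i : Fin n) :
    HasGaussianLaw (fun x : Fin n → ℝ => x i) (nullLaw n) where
  isGaussian_map := by rw [nullLaw_map_eval]; infer_instance

lemma hasGaussianLaw_nullLaw (n : ℕ) :
    HasGaussianLaw (fun x : Fin n → ℝ => x) (nullLaw n) :=
  (iIndepFun_nullLaw n).hasGaussianLaw fun i => hasGaussianLaw_eval i

lemma covariance_nullLaw {n : ℕ} (i j : Fin n) :
    cov[fun x : Fin n → ℝ => x i, fun x => x j; nullLaw n] = if i = j then 1 else 0 := by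
  split_ifs with h
  · subst h
    rw [covariance_self (measurable_pi_apply i).aemeasurable]
    have := variance_map (μ := nullLaw n) (X := fun x : ℝ => x) (Y := fun x : Fin n → ℝ => x i)
      aemeasurable_id (measurable_pi_apply i).aemeasurable
    rw [nullLaw_map_eval, variance_fun_id_gaussianReal] at this
    simpa [Function.comp_def] using this.symm
  · exact ((iIndepFun_nullLaw n).indepFun h).covariance_eq_zero
      (hasGaussianLaw_eval i).memLp_two (hasGaussianLaw_eval j).memLp_two

/-- The standardized sum of the observations over `A`. -/
def blockSum {n : ℕ} (A : Finset (Fin n)) (x : Fin n → ℝ) : ℝ := (∑ i ∈ A, x i) / √(A.card : ℝ)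

lemma measurable_blockSum {n : ℕ} (A : Finset (Fin n)) : Measurable (blockSum A) :=
  (Finset.measurable_sum _ fun i _ => measurable_pi_apply i).div_const _

lemma covariance_blockSum {n : ℕ} (A B : Finset (Fin n)) :
    cov[blockSum A, blockSum B; nullLaw n] = (A ∩ B).card / (√(A.card : ℝ) * √(B.card : ℝ)) := by
  have h1 : blockSum A = fun x => (∑ i ∈ A, x i) / √(A.card : ℝ) := rfl
  have h2 : blockSum B = fun x => (∑ i ∈ B, x i) / √(B.card : ℝ) := rfl
  rw [h1, h2, covariance_fun_div_left, covariance_fun_div_right,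
    covariance_fun_sum_fun_sum' (X := fun i (x : Fin n → ℝ) => x i)
      (Y := fun i (x : Fin n → ℝ) => x i)
      (fun i _ => (hasGaussianLaw_eval i).memLp_two) (fun i _ => (hasGaussianLaw_eval i).memLp_two)]
  simp only [covariance_nullLaw, Finset.sum_ite_eq]
  rw [← Finset.sum_filter, Finset.filter_mem_eq_inter]
  simp
  rw [div_div, mul_comm]

lemma integral_blockSum {n : ℕ} (A : Finset (Fin n)) : ∫ x, blockSum A x ∂(nullLaw n) = 0 := by
  unfold blockSum
  rw [integral_div, integral_finsetSum _ fun i _ => (hasGaussianLaw_eval i).integrable]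
  have : ∀ i : Fin n, ∫ x, x i ∂(nullLaw n) = 0 := by
    intro i
    have := integral_map (μ := nullLaw n) (φ := fun x : Fin n → ℝ => x i)
      (measurable_pi_apply i).aemeasurable (f := fun y : ℝ => y) aestronglyMeasurable_id
    rw [nullLaw_map_eval] at this
    rw [← this]; exact integral_id_gaussianReal
  simp [this]

lemma hasGaussianLaw_blockSum {n N : ℕ} (A : Fin N → Finset (Fin n)) :
    HasGaussianLaw (fun (x : Fin n → ℝ) a => blockSum (A a) x) (nullLaw n) := by
  have := (hasGaussianLaw_nullLaw n).map_fun (ContinuousLinearMap.pi fun a : Fin N =>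
    (√((A a).card : ℝ))⁻¹ • ∑ i ∈ A a, ContinuousLinearMap.proj (R := ℝ) (φ := fun _ => ℝ) i)
  refine this.congr (Eventually.of_forall fun x => ?_)
  funext a
  simp [blockSum, div_eq_inv_mul]

/-- The sums are jointly Gaussian, and disjoint blocks have zero covariance, so they are
independent; the normalization makes each variance 1. -/
lemma nullLaw_map_blockSum {n N : ℕ} (A : Fin N → Finset (Fin n)) (hA : ∀ a, (A a).Nonempty)
    (hdisj : ∀ a b, a ≠ b → Disjoint (A a) (A b)) :
    (nullLaw n).map (fun x a => blockSum (A a) x) = nullLaw N := by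
  have hG := hasGaussianLaw_blockSum A
  have hind : iIndepFun (fun a => blockSum (A a)) (nullLaw n) := by
    refine HasGaussianLaw.iIndepFun_of_covariance_eq_zero hG fun a b hab => ?_
    rw [covariance_blockSum, Finset.disjoint_iff_inter_eq_empty.1 (hdisj a b hab)]
    simp
  rw [hind.map_fun_eq_pi_map fun a => (measurable_blockSum _).aemeasurable]
  unfold nullLaw
  congr
  funext a
  have h := (HasGaussianLaw.eval (X := fun a => blockSum (A a)) hG a).map_eq_gaussianReal
  have h2 : Var[blockSum (A a); nullLaw n] = 1 := by
    rw [← covariance_self (measurable_blockSum _).aemeasurable, covariance_blockSum,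
      Finset.inter_self, Real.mul_self_sqrt (by positivity), div_self]
    exact_mod_cast (hA a).card_pos.ne'
  rw [integral_blockSum, h2, Real.toNNReal_one] at h
  exact h

/-! ### Order statistics -/

lemma orderStat_eq_getElem {P : Multiset ℝ} {i : ℕ} (hi : 1 ≤ i) (hiP : i ≤ P.card) :
    ∃ h : i - 1 < (P.sort (· ≤ ·)).length, orderStat P i = (P.sort (· ≤ ·))[i - 1] := by
  have h : i - 1 < (P.sort (· ≤ ·)).length := by rw [Multiset.length_sort]; omega
  exact ⟨h, List.getD_eq_getElem _ _ h⟩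

lemma orderStat_mem {P : Multiset ℝ} {i : ℕ} (hi : 1 ≤ i) (hiP : i ≤ P.card) :
    orderStat P i ∈ P := by
  obtain ⟨h, he⟩ := orderStat_eq_getElem hi hiP
  rw [he, ← Multiset.mem_sort (r := (· ≤ ·))]
  exact List.getElem_mem h

lemma le_countP_orderStat {P : Multiset ℝ} {i : ℕ} (hi : 1 ≤ i) (hiP : i ≤ P.card) :
    i ≤ P.countP (· ≤ orderStat P i) := by
  obtain ⟨h, he⟩ := orderStat_eq_getElem hi hiP
  set l := P.sort (· ≤ ·) with hl
  have hsort : l.Pairwise (· ≤ ·) := Multiset.pairwise_sort _ _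
  rw [List.pairwise_iff_getElem] at hsort
  have hP : P = (l : Multiset ℝ) := (Multiset.sort_eq _ _).symm
  have hc : P.countP (· ≤ orderStat P i) = l.countP (fun b => decide (b ≤ orderStat P i)) := by
    conv_lhs => rw [hP]
    rw [Multiset.coe_countP, ← hP]
  rw [hc, ← List.take_append_drop i l, List.countP_append]
  have : (l.take i).countP (fun b => decide (b ≤ orderStat P i)) = (l.take i).length := by
    rw [List.countP_eq_length]
    intro a ha
    obtain ⟨k, hk, rfl⟩ := List.mem_iff_getElem.1 ha
    simp only [List.length_take] at hk
    rw [List.getElem_take, he, decide_eq_true_eq]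
    rcases (show k < i - 1 ∨ k = i - 1 by omega) with hlt | heq
    · exact hsort k (i - 1) (by omega) h hlt
    · subst heq; exact le_rfl
  rw [this, List.length_take]
  omega

lemma orderStat_le_of_le_countP {P : Multiset ℝ} {i : ℕ} {t : ℝ} (hi : 1 ≤ i)
    (h : i ≤ P.countP (· ≤ t)) : orderStat P i ≤ t := by
  have hiP : i ≤ P.card := h.trans (Multiset.countP_le_card _ _)
  obtain ⟨hlt, he⟩ := orderStat_eq_getElem hi hiP
  set l := P.sort (· ≤ ·) with hl
  have hsort : l.Pairwise (· ≤ ·) := Multiset.pairwise_sort _ _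
  rw [List.pairwise_iff_getElem] at hsort
  have hP : P = (l : Multiset ℝ) := (Multiset.sort_eq _ _).symm
  by_contra hcon
  rw [not_le] at hcon
  have hc : P.countP (· ≤ t) = l.countP (fun b => decide (b ≤ t)) := by
    conv_lhs => rw [hP]
    rw [Multiset.coe_countP]
  rw [hc, ← List.take_append_drop (i - 1) l, List.countP_append] at h
  have h1 : (l.drop (i - 1)).countP (fun b => decide (b ≤ t)) = 0 := by
    rw [List.countP_eq_zero]
    intro a ha
    obtain ⟨k, hk, rfl⟩ := List.mem_iff_getElem.1 ha
    simp only [List.length_drop] at hk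
    rw [List.getElem_drop, decide_eq_true_eq, not_le]
    refine hcon.trans_le ?_
    rw [he]
    rcases Nat.eq_zero_or_pos k with rfl | hk0
    · simp only [add_zero]; exact le_rfl
    · exact hsort _ _ hlt (by omega) (by omega)
  have h2 : (l.take (i - 1)).countP (fun b => decide (b ≤ t)) ≤ i - 1 :=
    List.countP_le_length.trans (by rw [List.length_take]; omega)
  omega

lemma countP_levelPValues {n : ℕ} (x : Fin n → ℝ) (ℓ : ℕ) (z : ℝ) :
    (levelPValues x ℓ).countP (· ≤ pValue z) =
      ((approxIntervals n ℓ).filter fun I => z ≤ intervalStat x I).card := by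
  unfold levelPValues
  rw [Multiset.countP_map, Finset.card_def, Finset.filter_val]
  congr 1
  refine Multiset.filter_congr fun I _ => ?_
  exact pValue_strictAnti.le_iff_ge

lemma card_levelPValues {n : ℕ} (x : Fin n → ℝ) (ℓ : ℕ) :
    (levelPValues x ℓ).card = (approxIntervals n ℓ).card := by
  simp [levelPValues]

/-! ### Classes of disjoint intervals -/

/-- The length of an interval and the residue of its left end point modulo the length. -/
def classLabel (I : ℕ × ℕ) : ℕ × ℕ := (I.2 - I.1, I.1 % (I.2 - I.1))

/-- The number of disjoint intervals in a class. -/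
def classSize (n : ℕ) (c : ℕ × ℕ) : ℕ := (n - c.2) / c.1

/-- The `a`-th interval in a class. -/
def classInterval (c : ℕ × ℕ) (a : ℕ) : ℕ × ℕ := (c.2 + a * c.1, c.2 + (a + 1) * c.1)

/-- The labels of the classes that occur at level `ℓ`. -/
def classLabels (n ℓ : ℕ) : Finset (ℕ × ℕ) := (approxIntervals n ℓ).image classLabel

lemma mem_approxIntervals {n ℓ : ℕ} {I : ℕ × ℕ} : I ∈ approxIntervals n ℓ ↔
    I.2 ≤ n ∧ gridStep n ℓ ∣ I.1 ∧ gridStep n ℓ ∣ I.2 ∧ I.1 < I.2 ∧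
      2 ^ ℓ < 2 * (I.2 - I.1) ∧ I.2 - I.1 ≤ 2 ^ ℓ := by
  simp only [approxIntervals, Finset.mem_filter, Finset.mem_product, Finset.mem_range]
  constructor
  · rintro ⟨⟨h1, h2⟩, h⟩; exact ⟨by omega, h⟩
  · rintro ⟨h1, h⟩; exact ⟨⟨by omega, by omega⟩, h⟩

lemma classLabels_spec {n ℓ : ℕ} {c : ℕ × ℕ} (hc : c ∈ classLabels n ℓ) :
    0 < c.1 ∧ c.2 < c.1 ∧ c.1 ≤ 2 ^ ℓ ∧ 2 ^ ℓ < 2 * c.1 ∧ gridStep n ℓ ∣ c.1 ∧ gridStep n ℓ ∣ c.2 ∧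
      c.2 ≤ n := by
  obtain ⟨I, hI, rfl⟩ := Finset.mem_image.1 hc
  obtain ⟨h1, h2, h3, h4, h5, h6⟩ := mem_approxIntervals.1 hI
  have h7 : gridStep n ℓ ∣ I.2 - I.1 := Nat.dvd_sub h3 h2
  refine ⟨by simp [classLabel]; omega, Nat.mod_lt _ (by omega), h6, h5, h7,
    (Nat.dvd_mod_iff h7).2 h2, ?_⟩
  exact (Nat.mod_le _ _).trans (by omega)

/-- A class is a full run of adjacent intervals of one length. No interval of the run is missing,
because the grid spacing divides both the length and the residue. -/
lemma filter_classLabel {n ℓ : ℕ} {c : ℕ × ℕ} (hc : c ∈ classLabels n ℓ) :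
    (approxIntervals n ℓ).filter (fun I => classLabel I = c) =
      (Finset.range (classSize n c)).image (classInterval c) := by
  obtain ⟨h1, h2, h3, h4, h5, h6, h7⟩ := classLabels_spec hc
  ext I
  simp only [Finset.mem_filter, Finset.mem_image, Finset.mem_range]
  constructor
  · rintro ⟨hI, rfl⟩
    obtain ⟨g1, g2, g3, g4, g5, g6⟩ := mem_approxIntervals.1 hI
    have e : I.1 % (I.2 - I.1) + I.1 / (I.2 - I.1) * (I.2 - I.1) = I.1 := by
      rw [mul_comm]; exact Nat.mod_add_div _ _
    refine ⟨I.1 / (I.2 - I.1), ?_, ?_⟩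
    · unfold classSize classLabel
      rw [Nat.lt_iff_add_one_le, Nat.le_div_iff_mul_le (by omega), add_mul]
      simp only
      omega
    · unfold classInterval classLabel
      ext
      · exact e
      · simp only [add_mul]; omega
  · rintro ⟨a, ha, rfl⟩
    have ha' : (a + 1) * c.1 ≤ n - c.2 := by
      rw [← Nat.le_div_iff_mul_le h1]; exact ha
    have hlen : c.2 + (a + 1) * c.1 - (c.2 + a * c.1) = c.1 := by rw [add_mul]; omega
    refine ⟨mem_approxIntervals.2 ⟨?_, ?_, ?_, ?_, ?_, ?_⟩, ?_⟩
    · simp only [classInterval]; omega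
    · exact Nat.dvd_add h6 (h5.mul_left a)
    · exact Nat.dvd_add h6 (h5.mul_left (a + 1))
    · simp only [classInterval, add_mul]; omega
    · simp only [classInterval, hlen]; exact h4
    · simp only [classInterval, hlen]; exact h3
    · unfold classLabel classInterval
      simp only [hlen]
      rw [Nat.add_mul_mod_self_right, Nat.mod_eq_of_lt h2]

lemma classInterval_injective {c : ℕ × ℕ} (hc : 0 < c.1) : Function.Injective (classInterval c) := by
  intro a b h
  have := congrArg Prod.fst h
  simp only [classInterval, add_right_inj] at this
  exact Nat.eq_of_mul_eq_mul_right hc this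

lemma card_filter_class {n ℓ : ℕ} {c : ℕ × ℕ} (hc : c ∈ classLabels n ℓ) (q : ℕ × ℕ → Prop)
    [DecidablePred q] :
    ((approxIntervals n ℓ).filter fun I => q I ∧ classLabel I = c).card =
      (Finset.univ.filter fun a : Fin (classSize n c) => q (classInterval c a)).card := by
  have h1 : (approxIntervals n ℓ).filter (fun I => q I ∧ classLabel I = c) =
      ((Finset.range (classSize n c)).image (classInterval c)).filter q := by
    rw [← filter_classLabel hc, Finset.filter_filter]
    simp only [and_comm]
  rw [h1, Finset.filter_image, Finset.card_image_of_injective _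
    (classInterval_injective (classLabels_spec hc).1)]
  rw [Finset.card_filter, Finset.card_filter, Finset.sum_range]

lemma card_class {n ℓ : ℕ} {c : ℕ × ℕ} (hc : c ∈ classLabels n ℓ) :
    ((approxIntervals n ℓ).filter fun I => classLabel I = c).card = classSize n c := by
  simpa using card_filter_class hc (fun _ => True)

/-- At most two interval lengths of the line are lost at the ends, and `4 * 2 ^ ℓ ≤ n` guarantees at
least two intervals, so the loss is at most a factor 2. -/
lemma classSize_lower {n ℓ : ℕ} {c : ℕ × ℕ} (hc : c ∈ classLabels n ℓ) (hℓ : 4 * 2 ^ ℓ ≤ n) :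
    n ≤ 2 * (2 ^ ℓ * classSize n c) := by
  obtain ⟨h1, h2, h3, h4, -, -, -⟩ := classLabels_spec hc
  have h5 : n - c.2 < (classSize n c + 1) * c.1 := by
    unfold classSize
    rw [← Nat.div_lt_iff_lt_mul h1]
    omega
  have h6 : n < (classSize n c + 2) * 2 ^ ℓ := by
    calc n < (classSize n c + 2) * c.1 := by
          have : (classSize n c + 2) * c.1 = (classSize n c + 1) * c.1 + c.1 := by ring
          omega
      _ ≤ _ := Nat.mul_le_mul_left _ h3
  have h7 : 2 ≤ classSize n c := by
    by_contra hcon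
    have : (classSize n c + 2) * 2 ^ ℓ ≤ 4 * 2 ^ ℓ := Nat.mul_le_mul_right _ (by omega)
    omega
  calc n ≤ (classSize n c + 2) * 2 ^ ℓ := h6.le
    _ ≤ (2 * classSize n c) * 2 ^ ℓ := Nat.mul_le_mul_right _ (by omega)
    _ = _ := by ring

lemma classSize_upper {n ℓ : ℕ} {c : ℕ × ℕ} (hc : c ∈ classLabels n ℓ) :
    2 ^ ℓ * classSize n c ≤ 2 * n := by
  obtain ⟨h1, h2, h3, h4, -, -, -⟩ := classLabels_spec hc
  have h5 : classSize n c * c.1 ≤ n - c.2 := Nat.div_mul_le_self _ _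
  calc 2 ^ ℓ * classSize n c ≤ 2 * c.1 * classSize n c := Nat.mul_le_mul_right _ h4.le
    _ = 2 * (classSize n c * c.1) := by ring
    _ ≤ _ := by omega

/-- Length and residue are both multiples of the grid spacing and at most `2 ^ ℓ`. -/
lemma card_classLabels_le (n ℓ : ℕ) :
    (classLabels n ℓ).card ≤ (2 ^ ℓ / gridStep n ℓ + 1) ^ 2 := by
  set d := gridStep n ℓ with hd'
  have hsub : classLabels n ℓ ⊆ (Finset.range (2 ^ ℓ / d + 1) ×ˢ Finset.range (2 ^ ℓ / d + 1)).image
      fun p => (d * p.1, d * p.2) := by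
    intro c hc
    obtain ⟨h1, h2, h3, h4, h5, h6, -⟩ := classLabels_spec hc
    refine Finset.mem_image.2 ⟨(c.1 / d, c.2 / d), ?_, ?_⟩
    · simp only [Finset.mem_product, Finset.mem_range]
      exact ⟨Nat.lt_succ_of_le (Nat.div_le_div_right h3),
        Nat.lt_succ_of_le (Nat.div_le_div_right (h2.le.trans h3))⟩
    · ext
      · exact Nat.mul_div_cancel' h5
      · exact Nat.mul_div_cancel' h6
  refine (Finset.card_le_card hsub).trans (Finset.card_image_le.trans ?_)
  rw [Finset.card_product, Finset.card_range, sq]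

lemma card_approxIntervals_eq_sum (n ℓ : ℕ) :
    (approxIntervals n ℓ).card = ∑ c ∈ classLabels n ℓ, classSize n c := by
  rw [Finset.card_eq_sum_card_fiberwise (f := classLabel) (t := classLabels n ℓ)
    fun I hI => Finset.mem_image_of_mem _ hI]
  exact Finset.sum_congr rfl fun c hc => card_class hc

lemma card_approxIntervals_le (n ℓ : ℕ) :
    2 ^ ℓ * (approxIntervals n ℓ).card ≤ (classLabels n ℓ).card * (2 * n) := by
  rw [card_approxIntervals_eq_sum, Finset.mul_sum, ← smul_eq_mul (a := (classLabels n ℓ).card)]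
  exact Finset.sum_le_card_nsmul _ _ _ fun c hc => classSize_upper hc

/-- The locations in the interval `I`. -/
def intervalLocations (n : ℕ) (I : ℕ × ℕ) : Finset (Fin n) :=
  Finset.univ.filter (fun i : Fin n => I.1 < i.val + 1 ∧ i.val + 1 ≤ I.2)

lemma card_intervalLocations {n : ℕ} {I : ℕ × ℕ} (h : I.2 ≤ n) :
    (intervalLocations n I).card = I.2 - I.1 := by
  rw [intervalLocations, Finset.card_filter, Fin.sum_univ_eq_sum_range
    (fun i => if I.1 < i + 1 ∧ i + 1 ≤ I.2 then 1 else 0), ← Finset.card_filter]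
  have : (Finset.range n).filter (fun i => I.1 < i + 1 ∧ i + 1 ≤ I.2) = Finset.Ico I.1 I.2 := by
    ext i; simp only [Finset.mem_filter, Finset.mem_range, Finset.mem_Ico]; omega
  rw [this, Nat.card_Ico]

lemma intervalStat_eq_blockSum {n : ℕ} {I : ℕ × ℕ} (h : I.2 ≤ n) (hI : I.1 ≤ I.2)
    (x : Fin n → ℝ) : intervalStat x I = blockSum (intervalLocations n I) x := by
  unfold intervalStat blockSum
  rw [card_intervalLocations h, Nat.cast_sub hI]
  rfl

lemma nullLaw_map_classStat {n ℓ : ℕ} {c : ℕ × ℕ} (hc : c ∈ classLabels n ℓ) :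
    (nullLaw n).map (fun x (a : Fin (classSize n c)) => intervalStat x (classInterval c a)) =
      nullLaw (classSize n c) := by
  obtain ⟨h1, h2, h3, h4, -, -, h7⟩ := classLabels_spec hc
  have hle : ∀ a : Fin (classSize n c), (classInterval c a).2 ≤ n := by
    intro a
    have : (a.1 + 1) * c.1 ≤ n - c.2 := by
      rw [← Nat.le_div_iff_mul_le h1]; exact a.2
    simp only [classInterval]; omega
  have hlt : ∀ a : ℕ, (classInterval c a).1 < (classInterval c a).2 := by
    intro a; simp only [classInterval, add_mul]; omega
  have he : (fun (x : Fin n → ℝ) (a : Fin (classSize n c)) => intervalStat x (classInterval c a)) =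
      fun x (a : Fin (classSize n c)) => blockSum (intervalLocations n (classInterval c a)) x := by
    funext x a; exact intervalStat_eq_blockSum (hle a) (hlt a).le x
  rw [he]
  refine nullLaw_map_blockSum _ (fun a => ?_) fun a b hab => ?_
  · rw [← Finset.card_pos, card_intervalLocations (hle a)]
    have := hlt a; omega
  · rw [Finset.disjoint_left]
    intro i hi hi'
    replace hi := (Finset.mem_filter.1 hi).2
    replace hi' := (Finset.mem_filter.1 hi').2
    apply hab
    have key : ∀ a b : ℕ, c.2 + a * c.1 < i + 1 → i + 1 ≤ c.2 + (b + 1) * c.1 → a ≤ b := by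
      intro a b h h'
      by_contra hcon
      have : (b + 1) * c.1 ≤ a * c.1 := Nat.mul_le_mul_right _ (by omega)
      omega
    exact Fin.ext (le_antisymm (key _ _ hi.1 hi'.2) (key _ _ hi'.1 hi.2))

/-! ### One level under the null hypothesis -/

/-- The standardized sums over the intervals of a class. -/
def classStat (n : ℕ) (c : ℕ × ℕ) (x : Fin n → ℝ) (a : Fin (classSize n c)) : ℝ :=
  intervalStat x (classInterval c a)

/-- The event that level `ℓ` has a p-value below `τ` or a class with a large relative entropy. -/
def levelBad (n ℓ : ℕ) (τ C : ℝ) : Set (Fin n → ℝ) :=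
  {x | ∃ I ∈ approxIntervals n ℓ, pValue (intervalStat x I) < τ} ∪
    ⋃ c ∈ classLabels n ℓ, classStat n c ⁻¹' excessEvent (classSize n c) (Set.Ici τ) C

lemma measurable_intervalStat {n : ℕ} (I : ℕ × ℕ) :
    Measurable fun x : Fin n → ℝ => intervalStat x I :=
  (Finset.measurable_sum _ fun i _ => measurable_pi_apply i).div_const _

lemma measurable_classStat (n : ℕ) (c : ℕ × ℕ) : Measurable (classStat n c) :=
  measurable_pi_lambda _ fun _ => measurable_intervalStat _

lemma gaussianReal_pValue_lt {τ : ℝ} (hτ : 0 ≤ τ) :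
    gaussianReal 0 1 {y | pValue y < τ} ≤ ENNReal.ofReal τ := by
  rcases hτ.eq_or_lt with rfl | h0
  · have : {y | pValue y < 0} = ∅ := by
      ext y; simp [pValue_nonneg y]
    rw [this]; simp
  rcases lt_or_ge τ 1 with h1 | h1
  · obtain ⟨z, rfl⟩ := exists_pValue_eq h0 h1
    rw [← gaussianReal_Ici]
    refine measure_mono fun y hy => ?_
    exact (pValue_strictAnti.lt_iff_gt.1 hy).le
  · exact prob_le_one.trans (by rw [← ENNReal.ofReal_one]; exact ENNReal.ofReal_le_ofReal h1)

lemma nullLaw_map_intervalStat {n ℓ : ℕ} {I : ℕ × ℕ} (hI : I ∈ approxIntervals n ℓ) :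
    (nullLaw n).map (fun x => intervalStat x I) = gaussianReal 0 1 := by
  have hc : classLabel I ∈ classLabels n ℓ := Finset.mem_image_of_mem _ hI
  have hmem : I ∈ (approxIntervals n ℓ).filter (fun J => classLabel J = classLabel I) := by
    simp [hI]
  rw [filter_classLabel hc] at hmem
  obtain ⟨a, ha, haI⟩ := Finset.mem_image.1 hmem
  rw [Finset.mem_range] at ha
  have h1 := nullLaw_map_eval (⟨a, ha⟩ : Fin (classSize n (classLabel I)))
  rw [← nullLaw_map_classStat hc, Measure.map_map (measurable_pi_apply _)
    (measurable_pi_lambda _ fun _ => measurable_intervalStat _)] at h1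
  rw [← h1]
  congr
  funext x
  simp [haI]

/-- The first term is a union bound over all p-values of the level. The second is a union bound over
the classes, with `B` dyadic blocks in each of them. -/
lemma nullLaw_levelBad_le {n ℓ : ℕ} {τ C : ℝ} (hτ : 0 ≤ τ) (hC : 0 ≤ C) (B : ℕ)
    (hB : (2 : ℝ)⁻¹ ^ B ≤ τ) :
    nullLaw n (levelBad n ℓ τ C) ≤ ENNReal.ofReal ((approxIntervals n ℓ).card * τ +
      (classLabels n ℓ).card * (B * Real.exp (-(C / 6)))) := by
  refine (measure_union_le _ _).trans ?_
  rw [ENNReal.ofReal_add (by positivity) (by positivity)]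
  refine add_le_add ?_ ?_
  · have : {x : Fin n → ℝ | ∃ I ∈ approxIntervals n ℓ, pValue (intervalStat x I) < τ} =
        ⋃ I ∈ approxIntervals n ℓ, (fun x => intervalStat x I) ⁻¹' {y | pValue y < τ} := by
      ext x; simp
    rw [this]
    refine (measure_biUnion_finset_le _ _).trans ?_
    refine (Finset.sum_le_card_nsmul _ _ (ENNReal.ofReal τ) fun I hI => ?_).trans ?_
    · refine (Measure.le_map_apply (measurable_intervalStat I).aemeasurable _).trans ?_
      rw [nullLaw_map_intervalStat hI]
      exact gaussianReal_pValue_lt hτ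
    · rw [nsmul_eq_mul, ENNReal.ofReal_mul (by positivity), ENNReal.ofReal_natCast]
  · refine (measure_biUnion_finset_le _ _).trans ?_
    refine (Finset.sum_le_card_nsmul _ _ (B * ENNReal.ofReal (Real.exp (-(C / 6))))
      fun c hc => ?_).trans ?_
    · refine (Measure.le_map_apply (measurable_classStat n c).aemeasurable _).trans ?_
      have := nullLaw_map_classStat hc
      unfold classStat
      rw [this]
      refine le_trans (measure_mono ?_) (nullLaw_excessEvent B hC)
      rintro x ⟨z, hz, h⟩
      exact ⟨z, hB.trans hz, h⟩
    · rw [nsmul_eq_mul, ENNReal.ofReal_mul (by positivity), ENNReal.ofReal_mul (by positivity),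
        ENNReal.ofReal_natCast, ENNReal.ofReal_natCast]

lemma binaryKL_nonneg {u p : ℝ} (hp : 0 < p) (hpu : p < u) (hu : u < 1) : 0 ≤ binaryKL u p :=
  (le_trans (by have := hp.trans hpu; positivity) (sq_div_le_poissonKL hp hpu.le)).trans
    (poissonKL_le_binaryKL hpu hu)

/-- This transfers control of the i.i.d. classes to the dependent p-values of the whole level. The
factor 2 comes from `classSize_lower`. -/
lemma orderStat_of_not_levelBad {n ℓ : ℕ} {τ C : ℝ} {x : Fin n → ℝ}
    (hx : x ∉ levelBad n ℓ τ C) (hℓ : 4 * 2 ^ ℓ ≤ n) {i : ℕ} (hi : 1 ≤ i)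
    (hi2 : i ≤ (approxIntervals n ℓ).card / 2) :
    0 < orderStat (levelPValues x ℓ) i ∧ τ ≤ orderStat (levelPValues x ℓ) i ∧
    (orderStat (levelPValues x ℓ) i < (i : ℝ) / (approxIntervals n ℓ).card →
      n / 2 ^ ℓ * binaryKL ((i : ℝ) / (approxIntervals n ℓ).card)
        (orderStat (levelPValues x ℓ) i) ≤ 2 * C) := by
  set N := (approxIntervals n ℓ).card with hN
  have hiN : i ≤ (levelPValues x ℓ).card := by rw [card_levelPValues]; omega
  have hmem := orderStat_mem hi hiN
  obtain ⟨I, hI, hIp⟩ := Multiset.mem_map.1 hmem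
  rw [← hIp]
  simp only [levelBad, Set.mem_union, Set.mem_iUnion, not_or, not_exists] at hx
  have hτ : τ ≤ pValue (intervalStat x I) := by
    by_contra hcon
    exact hx.1 ⟨I, hI, not_le.1 hcon⟩
  refine ⟨pValue_pos _, hτ, fun hlt => ?_⟩
  have hcount := le_countP_orderStat hi hiN
  rw [← hIp, countP_levelPValues] at hcount
  set z := intervalStat x I with hz
  set u := (i : ℝ) / N with hu
  have hNpos : 0 < (N : ℝ) := by
    have : 0 < N := by omega
    exact_mod_cast this
  have huhalf : u ≤ 1 / 2 := by
    rw [hu, div_le_div_iff₀ hNpos two_pos]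
    have : i * 2 ≤ 1 * N := by omega
    exact_mod_cast this
  -- Pigeonhole: if every class had fewer than the fraction `u` of its statistics at or above `z`,
  -- summing over the classes would give fewer than `i` in total.
  obtain ⟨c, hc, hcu⟩ : ∃ c ∈ classLabels n ℓ, u * classSize n c ≤
      ((approxIntervals n ℓ).filter fun I => z ≤ intervalStat x I ∧ classLabel I = c).card := by
    by_contra hcon
    push Not at hcon
    have hne : (classLabels n ℓ).Nonempty := ⟨_, Finset.mem_image_of_mem _ hI⟩
    have h1 := Finset.sum_lt_sum_of_nonempty hne hcon
    rw [← Finset.mul_sum, ← Nat.cast_sum, ← Nat.cast_sum, ← card_approxIntervals_eq_sum, ← hN,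
      hu, div_mul_cancel₀ _ hNpos.ne'] at h1
    have h2 : ((approxIntervals n ℓ).filter fun I => z ≤ intervalStat x I).card =
        ∑ c ∈ classLabels n ℓ,
        ((approxIntervals n ℓ).filter fun I => z ≤ intervalStat x I ∧ classLabel I = c).card := by
      rw [Finset.card_eq_sum_card_fiberwise (f := classLabel) (t := classLabels n ℓ)
        fun I hI => Finset.mem_image_of_mem _ (Finset.mem_of_mem_filter I hI)]
      simp only [Finset.filter_filter]
    rw [← h2] at h1
    have : ((approxIntervals n ℓ).filter fun I => z ≤ intervalStat x I).card < i := by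
      exact_mod_cast h1
    omega
  have hnot := hx.2 c hc
  have hKL : classSize n c * binaryKL u (pValue z) ≤ C := by
    by_contra hcon
    refine hnot ⟨z, hτ, u, hlt, huhalf, ?_, not_le.1 hcon⟩
    rw [card_filter_class hc] at hcu
    exact hcu
  have hKL0 := binaryKL_nonneg (pValue_pos z) hlt (by linarith)
  have hsize : (n : ℝ) ≤ 2 * (2 ^ ℓ * classSize n c) := by exact_mod_cast classSize_lower hc hℓ
  have h3 : (n : ℝ) / 2 ^ ℓ ≤ 2 * classSize n c := by
    rw [div_le_iff₀ (by positivity)]; linarith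
  calc _ ≤ 2 * classSize n c * binaryKL u (pValue z) := by gcongr
    _ ≤ 2 * C := by linarith

lemma berkJones_term {N i : ℕ} (hN : 0 < N) (p : ℝ) :
    (i : ℝ) * Real.log ((i : ℝ) / (N * p)) +
        ((N : ℝ) - i) * Real.log ((1 - (i : ℝ) / N) / (1 - p)) = N * binaryKL (i / N) p := by
  have h : (N : ℝ) ≠ 0 := by exact_mod_cast hN.ne'
  unfold binaryKL
  rw [div_div]
  field_simp

lemma scaled_berkJones_le {n ℓ : ℕ} {τ C : ℝ} {x : Fin n → ℝ} (hC : 0 ≤ C)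
    (hx : x ∉ levelBad n ℓ τ C) (hℓ : 4 * 2 ^ ℓ ≤ n) :
    (n : ℝ) / (2 ^ ℓ * (approxIntervals n ℓ).card) * berkJones (levelPValues x ℓ) ≤ 2 * C := by
  rcases Nat.eq_zero_or_pos (approxIntervals n ℓ).card with h0 | h0
  · rw [h0]; simp; exact hC
  have hN : (0 : ℝ) < (approxIntervals n ℓ).card := by exact_mod_cast h0
  have hn : (0 : ℝ) < n := by
    have : 0 < 4 * 2 ^ ℓ := by positivity
    exact_mod_cast this.trans_le hℓ
  rw [← le_div_iff₀' (by positivity)]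
  unfold berkJones
  -- The bound must be nonnegative because a level with one interval has an empty index range, for
  -- which `sSup` is 0.
  refine Real.sSup_le ?_ (by positivity)
  rintro _ ⟨i, ⟨hi1, hi2⟩, rfl⟩
  rw [card_levelPValues] at hi2
  simp only
  split_ifs with h
  · rw [card_levelPValues] at h ⊢
    rw [berkJones_term h0, le_div_iff₀' (by positivity)]
    refine le_trans (le_of_eq ?_) ((orderStat_of_not_levelBad hx hℓ hi1 hi2).2.2 h)
    field_simp
  · positivity

/-- With `M = n / 2 ^ ℓ`, the entropy bound gives `M * (u - p) ^ 2 / (2 * u) ≤ 2 * C`. If `p ≥ u /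
2`, then `u` and `p` are comparable and the square of the statistic is at most `16 * C`. Otherwise
the bound forces `M * u ≤ 16 * C`, and the possibly small denominator `p` is controlled only by `τ ≤
p`; this case produces the second summand. -/
lemma scaled_higherCriticism_le {n ℓ : ℕ} {τ C W : ℝ} {x : Fin n → ℝ} (hτ : 0 < τ)
    (hx : x ∉ levelBad n ℓ τ C) (hℓ : 4 * 2 ^ ℓ ≤ n) (hW : 0 ≤ W)
    (hWC : 16 * C + 512 * C ^ 2 * (2 ^ ℓ / (n * τ)) ≤ W ^ 2) (hC : 0 ≤ C) :
    √((n : ℝ) / (2 ^ ℓ * (approxIntervals n ℓ).card)) * higherCriticism (levelPValues x ℓ) ≤ W := by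
  rcases Nat.eq_zero_or_pos (approxIntervals n ℓ).card with h0 | h0
  · rw [h0]; simp; exact hW
  have hN : (0 : ℝ) < (approxIntervals n ℓ).card := by exact_mod_cast h0
  have hn : (0 : ℝ) < n := by
    have : 0 < 4 * 2 ^ ℓ := by positivity
    exact_mod_cast this.trans_le hℓ
  have hscale : 0 < √((n : ℝ) / (2 ^ ℓ * (approxIntervals n ℓ).card)) := by positivity
  rw [← le_div_iff₀' hscale]
  unfold higherCriticism
  refine Real.sSup_le ?_ (by positivity)
  rintro _ ⟨i, ⟨hi1, hi2⟩, rfl⟩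
  simp only
  rw [card_levelPValues] at hi2 ⊢
  obtain ⟨hp, hτp, hKL⟩ := orderStat_of_not_levelBad hx hℓ hi1 hi2
  set p := orderStat (levelPValues x ℓ) i
  set u := (i : ℝ) / (approxIntervals n ℓ).card with hu
  have huhalf : u ≤ 1 / 2 := by
    rw [hu, div_le_div_iff₀ hN two_pos]
    have : i * 2 ≤ 1 * (approxIntervals n ℓ).card := by omega
    exact_mod_cast this
  rcases le_or_gt u p with hle | hlt
  · refine le_trans ?_ (by positivity : 0 ≤ W / _)
    refine mul_nonpos_of_nonneg_of_nonpos (by positivity) ?_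
    exact div_nonpos_of_nonpos_of_nonneg (by linarith) (by positivity)
  · specialize hKL hlt
    have hu0 : 0 < u := hp.trans hlt
    rw [le_div_iff₀' hscale, ← mul_assoc, ← Real.sqrt_mul (by positivity)]
    set M := (n : ℝ) / 2 ^ ℓ with hM
    have hM0 : 0 < M := by positivity
    have e1 : (n : ℝ) / (2 ^ ℓ * (approxIntervals n ℓ).card) * (approxIntervals n ℓ).card = M := by
      rw [hM]; field_simp
    rw [e1]
    have hq : 0 < p * (1 - p) := mul_pos hp (by linarith)
    refine abs_le_of_sq_le_sq' ?_ hW |>.2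
    rw [mul_pow, div_pow, Real.sq_sqrt hM0.le, Real.sq_sqrt hq.le]
    refine le_trans ?_ hWC
    have hlow : (u - p) ^ 2 / (2 * u) ≤ binaryKL u p :=
      (sq_div_le_poissonKL hp hlt.le).trans (poissonKL_le_binaryKL hlt (by linarith))
    have h1 : M * ((u - p) ^ 2 / (2 * u)) ≤ 2 * C :=
      (mul_le_mul_of_nonneg_left hlow hM0.le).trans hKL
    have h2 : (u - p) ^ 2 / (p * (1 - p)) ≤ 2 * ((u - p) ^ 2 / p) := by
      rw [← mul_div_assoc, div_le_div_iff₀ hq hp]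
      have : 0 ≤ (u - p) ^ 2 * p := by positivity
      nlinarith
    have h3 : 2 ^ ℓ / (n * τ) = 1 / (M * τ) := by rw [hM]; field_simp
    have hlast : 0 ≤ 512 * C ^ 2 * (2 ^ ℓ / (n * τ)) := by positivity
    rcases le_or_gt (u / 2) p with hpu | hpu
    · have h4 : (u - p) ^ 2 / p ≤ 4 * ((u - p) ^ 2 / (2 * u)) := by
        rw [← mul_div_assoc, div_le_div_iff₀ hp (by positivity)]
        have : 0 ≤ (u - p) ^ 2 := by positivity
        nlinarith
      calc M * ((u - p) ^ 2 / (p * (1 - p))) ≤ M * (2 * (4 * ((u - p) ^ 2 / (2 * u)))) := by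
            gcongr; linarith
        _ = 8 * (M * ((u - p) ^ 2 / (2 * u))) := by ring
        _ ≤ _ := by linarith
    · have h5 : M * u ≤ 16 * C := by
        have : u / 8 ≤ (u - p) ^ 2 / (2 * u) := by
          rw [div_le_div_iff₀ (by norm_num) (by positivity)]
          nlinarith
        have := mul_le_mul_of_nonneg_left this hM0.le
        linarith
      have h6 : (u - p) ^ 2 / p ≤ u ^ 2 / τ := by
        apply div_le_div₀ (by positivity) _ hτ hτp
        apply pow_le_pow_left₀ (by linarith); linarith
      calc M * ((u - p) ^ 2 / (p * (1 - p))) ≤ M * (2 * (u ^ 2 / τ)) := by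
            gcongr; linarith
        _ = 2 * (M * u) ^ 2 * (1 / (M * τ)) := by field_simp
        _ ≤ 2 * (16 * C) ^ 2 * (1 / (M * τ)) := by gcongr
        _ = 512 * C ^ 2 * (2 ^ ℓ / (n * τ)) := by rw [h3]; ring
        _ ≤ _ := by linarith

/-! ### All levels under the null hypothesis -/

lemma four_mul_two_pow_le {n ℓ : ℕ} (hn : 8 ≤ n) (hℓ : ℓ ≤ maxLevel n) : 4 * 2 ^ ℓ ≤ n := by
  have hn' : (8 : ℝ) ≤ n := by exact_mod_cast hn
  have h0 : 0 ≤ Real.logb 2 ((n : ℝ) / 8) :=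
    Real.logb_nonneg (by norm_num) (by rw [one_le_div (by norm_num)]; exact hn')
  have h1 : (ℓ : ℝ) < Real.logb 2 ((n : ℝ) / 8) + 1 :=
    lt_of_le_of_lt (by exact_mod_cast hℓ) (Nat.ceil_lt_add_one h0)
  have h2 : (2 : ℝ) ^ (ℓ : ℝ) < 2 ^ (Real.logb 2 ((n : ℝ) / 8) + 1) :=
    Real.rpow_lt_rpow_of_exponent_lt (by norm_num) h1
  rw [Real.rpow_add (by norm_num), Real.rpow_logb (by norm_num) (by norm_num) (by positivity),
    Real.rpow_natCast, Real.rpow_one] at h2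
  have h3 : (4 : ℝ) * 2 ^ ℓ ≤ n := by linarith
  exact_mod_cast h3

lemma logb_two_le {y : ℝ} (hy : 1 ≤ y) : Real.logb 2 y ≤ 2 * Real.log y := by
  have h2 := Real.log_two_gt_d9
  rw [Real.logb, div_le_iff₀ (by linarith)]
  have := Real.log_nonneg hy
  nlinarith

lemma maxLevel_add_one_le {n : ℕ} (hn : 8 ≤ n) : ((maxLevel n + 1 : ℕ) : ℝ) ≤ 2 * Real.log n := by
  have hn' : (8 : ℝ) ≤ n := by exact_mod_cast hn
  have h0 : 0 ≤ Real.logb 2 ((n : ℝ) / 8) :=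
    Real.logb_nonneg (by norm_num) (by rw [one_le_div (by norm_num)]; exact hn')
  have h1 := Nat.ceil_lt_add_one h0
  have h2 : Real.logb 2 ((n : ℝ) / 8) = Real.logb 2 n - 3 := by
    rw [Real.logb_div (by positivity) (by norm_num)]
    congr 1
    rw [show (8 : ℝ) = 2 ^ (3 : ℝ) by norm_num, Real.logb_rpow (by norm_num) (by norm_num)]
  have h3 := logb_two_le (show 1 ≤ (n : ℝ) by linarith)
  unfold maxLevel
  push_cast
  linarith

/-- With `g = log₂ (n / 2 ^ (ℓ - 1))`, the spacing is at least `2 ^ ℓ / (12 * √g)`, so there are at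
most `(12 * √g + 1) ^ 2 ≤ 169 * g` classes, and `g ≤ 3 * log n`. -/
lemma card_classLabels_le_log {n ℓ : ℕ} (hℓ : 4 * 2 ^ ℓ ≤ n) (hL : 1 ≤ Real.log n) :
    ((classLabels n ℓ).card : ℝ) ≤ 600 * Real.log n := by
  have hℓ' : (4 : ℝ) * 2 ^ ℓ ≤ n := by exact_mod_cast hℓ
  have hpow : (1 : ℝ) ≤ 2 ^ ℓ := one_le_pow₀ (by norm_num)
  have hn : (4 : ℝ) ≤ n := by linarith
  set g := Real.logb 2 ((n : ℝ) / ((2 : ℝ) ^ ℓ / 2)) with hg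
  have hg1 : 1 ≤ g := by
    rw [hg, Real.le_logb_iff_rpow_le (by norm_num) (by positivity), Real.rpow_one,
      le_div_iff₀ (by positivity)]
    linarith
  have hg2 : g ≤ 3 * Real.log n := by
    have h1 : g ≤ Real.logb 2 (2 * n) := by
      apply Real.logb_le_logb_of_le (by norm_num) (by positivity)
      rw [div_le_iff₀ (by positivity)]
      nlinarith
    have h2 : Real.logb 2 (2 * (n : ℝ)) = 1 + Real.logb 2 n := by
      rw [Real.logb_mul (by norm_num) (by positivity), Real.logb_self_eq_one (by norm_num)]
    have h3 := logb_two_le (show 1 ≤ (n : ℝ) by linarith)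
    linarith
  have hprec : precision n ℓ = 1 / (6 * √g) := rfl
  have hs : 1 ≤ √g := by rw [Real.one_le_sqrt]; exact hg1
  have hd : precision n ℓ * ((2 : ℝ) ^ ℓ / 2) ≤ gridStep n ℓ := Nat.le_ceil _
  rw [hprec] at hd
  have hd0 : (0 : ℝ) < gridStep n ℓ := lt_of_lt_of_le (by positivity) hd
  have hdiv : ((2 ^ ℓ / gridStep n ℓ : ℕ) : ℝ) ≤ 12 * √g := by
    refine Nat.cast_div_le.trans ?_
    push_cast
    rw [div_le_iff₀ hd0]
    calc (2 : ℝ) ^ ℓ = 12 * √g * (1 / (6 * √g) * (2 ^ ℓ / 2)) := by field_simp; norm_num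
      _ ≤ _ := by gcongr
  have hK : ((classLabels n ℓ).card : ℝ) ≤ (((2 ^ ℓ / gridStep n ℓ : ℕ) : ℝ) + 1) ^ 2 := by
    exact_mod_cast card_classLabels_le n ℓ
  calc ((classLabels n ℓ).card : ℝ) ≤ (12 * √g + √g) ^ 2 := by
        refine hK.trans (pow_le_pow_left₀ (by positivity) ?_ _)
        linarith
    _ = 169 * g := by
        have := Real.sq_sqrt (show 0 ≤ g by linarith)
        nlinarith
    _ ≤ _ := by linarith

lemma card_approxIntervals_le_sq (n ℓ : ℕ) : (approxIntervals n ℓ).card ≤ (n + 1) ^ 2 := by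
  refine (Finset.card_filter_le _ _).trans ?_
  rw [Finset.card_product, Finset.card_range, sq]

/-- The p-value threshold at level `ℓ`. -/
def levelThreshold (n ℓ : ℕ) : ℝ := 1 / (((approxIntervals n ℓ).card + 1) * Real.log n ^ 2)

/-- The event on which the null behaviour fails at some level. -/
def nullBad (n : ℕ) : Set (Fin n → ℝ) :=
  ⋃ ℓ ∈ Finset.range (maxLevel n + 1), levelBad n ℓ (levelThreshold n ℓ) (√(Real.log n) / 2)

lemma eight_le_of_log {n : ℕ} (hL : 400 ≤ Real.log n) : 8 ≤ n := by
  by_contra hcon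
  have h1 : (n : ℝ) ≤ 8 := by exact_mod_cast (not_le.1 hcon).le
  rcases Nat.eq_zero_or_pos n with rfl | h0
  · simp at hL; linarith
  have := Real.log_le_sub_one_of_pos (show (0 : ℝ) < n by exact_mod_cast h0)
  linarith

lemma nullLaw_nullBad_le {n : ℕ} (hL : 400 ≤ Real.log n) :
    nullLaw n (nullBad n) ≤ ENNReal.ofReal (2 * Real.log n *
      (1 / Real.log n ^ 2 + 600 * Real.log n * (15 * Real.log n *
        Real.exp (-(√(Real.log n) / 2 / 6))))) := by
  have hn := eight_le_of_log hL
  set L := Real.log n with hLdef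
  refine (measure_biUnion_finset_le _ _).trans ?_
  have hlevel : ∀ ℓ ∈ Finset.range (maxLevel n + 1),
      nullLaw n (levelBad n ℓ (levelThreshold n ℓ) (√L / 2)) ≤
      ENNReal.ofReal (1 / L ^ 2 + 600 * L * (15 * L * Real.exp (-(√L / 2 / 6)))) := by
    intro ℓ hℓ
    have h4 := four_mul_two_pow_le hn (Nat.lt_succ_iff.1 (Finset.mem_range.1 hℓ))
    have hτ0 : 0 ≤ levelThreshold n ℓ := by unfold levelThreshold; positivity
    -- The threshold is at least `n ^ (-5)`, so O(log n) dyadic blocks suffice.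
    have hB : (2 : ℝ)⁻¹ ^ (5 * (Nat.log 2 n + 1)) ≤ levelThreshold n ℓ := by
      unfold levelThreshold
      rw [inv_pow, ← one_div]
      apply one_div_le_one_div_of_le (by positivity)
      have h1 : (n : ℝ) ≤ 2 ^ (Nat.log 2 n + 1) := by
        exact_mod_cast (Nat.lt_pow_succ_log_self (by norm_num) n).le
      have h2 : L ≤ n := (Real.log_le_sub_one_of_pos (by positivity)).trans (by linarith)
      have h3 : ((approxIntervals n ℓ).card : ℝ) ≤ (n + 1) ^ 2 := by
        exact_mod_cast card_approxIntervals_le_sq n ℓ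
      have h8 : (8 : ℝ) ≤ n := by exact_mod_cast hn
      calc (((approxIntervals n ℓ).card : ℝ) + 1) * L ^ 2 ≤ ((n + 1) ^ 2 + 1) * (n : ℝ) ^ 2 := by
            gcongr
        _ ≤ (n : ℝ) ^ 3 * (n : ℝ) ^ 2 := by
            gcongr
            nlinarith [mul_self_nonneg (n : ℝ)]
        _ = (n : ℝ) ^ 5 := by ring
        _ ≤ (2 ^ (Nat.log 2 n + 1)) ^ 5 := by gcongr
        _ = _ := by rw [← pow_mul, mul_comm]
    refine (nullLaw_levelBad_le hτ0 (by positivity) _ hB).trans (ENNReal.ofReal_le_ofReal ?_)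
    refine add_le_add ?_ ?_
    · unfold levelThreshold
      rw [mul_one_div, ← hLdef, div_le_div_iff₀ (by positivity) (by positivity)]
      have : 0 ≤ L ^ 2 := by positivity
      nlinarith
    · have hK := card_classLabels_le_log h4 (by linarith)
      have hlog : ((5 * (Nat.log 2 n + 1) : ℕ) : ℝ) ≤ 15 * L := by
        have h1 : ((Nat.log 2 n : ℕ) : ℝ) ≤ Real.logb 2 n := by
          simpa using Real.natLog_le_logb n 2
        have h2 := logb_two_le (show 1 ≤ (n : ℝ) by exact_mod_cast (by omega : 1 ≤ n))
        push_cast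
        linarith
      gcongr
  refine (Finset.sum_le_card_nsmul _ _ _ hlevel).trans ?_
  rw [nsmul_eq_mul, Finset.card_range, ENNReal.ofReal_mul (p := 2 * L) (by positivity)]
  gcongr
  rw [← ENNReal.ofReal_natCast]
  exact ENNReal.ofReal_le_ofReal (maxLevel_add_one_le hn)

lemma tendsto_log_natCast : Tendsto (fun n : ℕ => Real.log n) atTop atTop :=
  Real.tendsto_log_atTop.comp tendsto_natCast_atTop_atTop

lemma tendsto_nullLaw_nullBad : Tendsto (fun n => (nullLaw n).real (nullBad n)) atTop (𝓝 0) := by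
  -- In the variable `s = √(log n)`, the factor `exp (-s / 12)` beats the polylogarithmic factor
  -- `18000 * s ^ 6`, where `18000 = 2 * 600 * 15`.
  have hf : Tendsto (fun s : ℝ => 2 * (1 / s ^ 2) +
      18000 * 12 ^ 6 * ((s / 12) ^ 6 * Real.exp (-(s / 12)))) atTop (𝓝 0) := by
    have h1 : Tendsto (fun s : ℝ => 1 / s ^ 2) atTop (𝓝 0) := by
      simp only [one_div]
      exact tendsto_inv_atTop_zero.comp (tendsto_pow_atTop (α := ℝ) (two_ne_zero))
    have h2 := (Real.tendsto_pow_mul_exp_neg_atTop_nhds_zero 6).comp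
      (tendsto_id.atTop_div_const (show (0 : ℝ) < 12 by norm_num))
    simpa using (h1.const_mul 2).add (h2.const_mul (18000 * 12 ^ 6))
  have hcomp := hf.comp (Real.tendsto_sqrt_atTop.comp tendsto_log_natCast)
  refine squeeze_zero' (Eventually.of_forall fun n => measureReal_nonneg) ?_ hcomp
  filter_upwards [tendsto_log_natCast.eventually_ge_atTop 400] with n hL
  have h := nullLaw_nullBad_le hL
  rw [measureReal_def]
  refine (ENNReal.toReal_le_of_le_ofReal (by positivity) h).trans (le_of_eq ?_)
  simp only [Function.comp_apply]
  have hs : √(Real.log n) ^ 2 = Real.log n := Real.sq_sqrt (by linarith)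
  have hs0 : √(Real.log n) ≠ 0 := (Real.sqrt_pos.2 (by linarith)).ne'
  set s := √(Real.log n)
  rw [← hs]
  have : s / 2 / 6 = s / 12 := by ring
  rw [this]
  field_simp
  ring

lemma structuredBJ_le_of_not_nullBad {n : ℕ} (hL : 400 ≤ Real.log n) {x : Fin n → ℝ}
    (hx : x ∉ nullBad n) : structuredBJ x ≤ √(Real.log n) := by
  have hn := eight_le_of_log hL
  simp only [nullBad, Set.mem_iUnion, not_exists] at hx
  refine Real.sSup_le ?_ (Real.sqrt_nonneg _)
  rintro _ ⟨ℓ, hℓ, rfl⟩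
  have h := scaled_berkJones_le (by positivity)
    (hx ℓ (Finset.mem_range.2 (Nat.lt_succ_of_le hℓ.2))) (four_mul_two_pow_le hn hℓ.2)
  simp only
  linarith

lemma structuredHC_le_of_not_nullBad {n : ℕ} (hL : 400 ≤ Real.log n) {x : Fin n → ℝ}
    (hx : x ∉ nullBad n) : structuredHC x ≤ Real.log n ^ 3 := by
  have hn := eight_le_of_log hL
  simp only [nullBad, Set.mem_iUnion, not_exists] at hx
  set L := Real.log n with hLdef
  refine Real.sSup_le ?_ (by positivity)
  rintro _ ⟨ℓ, hℓ, rfl⟩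
  have h4 := four_mul_two_pow_le hn hℓ.2
  have h4' : (4 : ℝ) * 2 ^ ℓ ≤ n := by exact_mod_cast h4
  have hn0 : (0 : ℝ) < n := by have : (8 : ℝ) ≤ n := by exact_mod_cast hn
                               linarith
  have hτ : 0 < levelThreshold n ℓ := by
    unfold levelThreshold; rw [← hLdef]; positivity
  refine scaled_higherCriticism_le hτ (hx ℓ (Finset.mem_range.2 (Nat.lt_succ_of_le hℓ.2))) h4
    (by positivity) ?_ (by positivity)
  have hs : √L ^ 2 = L := Real.sq_sqrt (by linarith)
  have hsL : √L ≤ L := by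
    rw [Real.sqrt_le_left (by linarith)]; nlinarith
  have hK := card_classLabels_le_log h4 (by linarith)
  have hcard : (2 : ℝ) ^ ℓ * (approxIntervals n ℓ).card ≤ (classLabels n ℓ).card * (2 * n) := by
    exact_mod_cast card_approxIntervals_le n ℓ
  have hτ2 : 2 ^ ℓ / (n * levelThreshold n ℓ) ≤ 1201 * L * L ^ 2 := by
    unfold levelThreshold
    rw [← hLdef]
    have e : (2 : ℝ) ^ ℓ / (n * (1 / (((approxIntervals n ℓ).card + 1) * L ^ 2))) =
        (2 ^ ℓ * (approxIntervals n ℓ).card + 2 ^ ℓ) / n * L ^ 2 := by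
      field_simp
    rw [e]
    gcongr
    rw [div_le_iff₀ hn0]
    have := mul_le_mul_of_nonneg_right hK (show 0 ≤ 2 * (n : ℝ) by positivity)
    nlinarith
  calc 16 * (√L / 2) + 512 * (√L / 2) ^ 2 * (2 ^ ℓ / (n * levelThreshold n ℓ))
      ≤ 8 * L + 128 * L * (1201 * L * L ^ 2) := by
        have e : 512 * (√L / 2) ^ 2 = 128 * L := by rw [div_pow, hs]; ring
        rw [e]
        have := mul_le_mul_of_nonneg_left hτ2 (show 0 ≤ 128 * L by positivity)
        linarith
    _ ≤ 160000 * L ^ 4 := by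
        have : L ≤ L ^ 4 := by
          have := pow_le_pow_right₀ (show 1 ≤ L by linarith) (show 1 ≤ 4 by norm_num)
          simpa using this
        nlinarith
    -- Here `160000 = 400 ^ 2 ≤ L ^ 2`, which is why `log n ≥ 400` is assumed.
    _ ≤ L ^ 2 * L ^ 4 := by gcongr; nlinarith
    _ = (L ^ 3) ^ 2 := by ring

/-! ### The mixture law -/

/-- Add the signal `μ` at the locations `S`. -/
def addSignal {n : ℕ} (S : Finset (Fin n)) (μ : ℝ) (z : Fin n → ℝ) : Fin n → ℝ :=
  fun i => (if i ∈ S then μ else 0) + z i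

lemma measurable_addSignal {n : ℕ} (S : Finset (Fin n)) (μ : ℝ) : Measurable (addSignal S μ) :=
  measurable_pi_lambda _ fun i => measurable_const.add (measurable_pi_apply i)

lemma mixtureLaw_apply {n m : ℕ} (μ : ℝ) (s : Set (Fin n → ℝ)) :
    mixtureLaw n m μ s = (n.choose m : ENNReal)⁻¹ *
      ∑ S ∈ (Finset.univ : Finset (Fin n)).powersetCard m, (nullLaw n).map (addSignal S μ) s := by
  unfold mixtureLaw
  rw [Measure.smul_apply, Measure.finsetSum_apply, smul_eq_mul]
  rfl

lemma mixtureLaw_le {n m : ℕ} (hm : m ≤ n) {μ : ℝ} {s : Set (Fin n → ℝ)} {δ : ENNReal}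
    (h : ∀ S ∈ (Finset.univ : Finset (Fin n)).powersetCard m,
      (nullLaw n).map (addSignal S μ) s ≤ δ) : mixtureLaw n m μ s ≤ δ := by
  rw [mixtureLaw_apply]
  have hc : (n.choose m : ENNReal) ≠ 0 := by exact_mod_cast (Nat.choose_pos hm).ne'
  calc _ ≤ (n.choose m : ENNReal)⁻¹ * (n.choose m * δ) := by
        gcongr
        refine (Finset.sum_le_card_nsmul _ _ _ h).trans ?_
        rw [Finset.card_powersetCard, Finset.card_univ, Fintype.card_fin, nsmul_eq_mul]
    _ = δ := by
        rw [← mul_assoc, ENNReal.inv_mul_cancel hc (ENNReal.natCast_ne_top _), one_mul]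

lemma isProbabilityMeasure_mixtureLaw {n m : ℕ} (hm : m ≤ n) (μ : ℝ) :
    IsProbabilityMeasure (mixtureLaw n m μ) where
  measure_univ := by
    rw [mixtureLaw_apply]
    have : ∀ S : Finset (Fin n), (nullLaw n).map (addSignal S μ) Set.univ = 1 := by
      intro S
      rw [Measure.map_apply (measurable_addSignal S μ) MeasurableSet.univ]
      simp
    have hc : (n.choose m : ENNReal) ≠ 0 := by exact_mod_cast (Nat.choose_pos hm).ne'
    simp only [this, Finset.sum_const, Finset.card_powersetCard, Finset.card_univ,
      Fintype.card_fin, nsmul_eq_mul, mul_one]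
    exact ENNReal.inv_mul_cancel hc (ENNReal.natCast_ne_top _)

/-- A bound uniform in the signal locations passes to the mixture. The measurable subset `E` makes
it unnecessary to prove that the rejection region `A n` is measurable; `m n ≤ n` makes the mixture a
probability measure. -/
lemma tendsto_power {m : ℕ → ℕ} {μ : ℕ → ℝ} {A : (n : ℕ) → Set (Fin n → ℝ)} {δ : ℕ → ℝ}
    (hδ : Tendsto δ atTop (𝓝 0))
    (h : ∀ᶠ n in atTop, m n ≤ n ∧ ∃ E : Set (Fin n → ℝ), MeasurableSet E ∧ E ⊆ A n ∧
      ∀ S : Finset (Fin n), S.card = m n →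
        nullLaw n {x | addSignal S (μ n) x ∉ E} ≤ ENNReal.ofReal (δ n)) :
    Tendsto (fun n => (mixtureLaw n (m n) (μ n)).real (A n)) atTop (𝓝 1) := by
  have h0 : Tendsto (fun n => 1 - max (δ n) 0) atTop (𝓝 1) := by
    simpa using (tendsto_const_nhds (x := (1 : ℝ))).sub (hδ.max (tendsto_const_nhds (x := (0 : ℝ))))
  refine tendsto_of_tendsto_of_tendsto_of_le_of_le' h0 tendsto_const_nhds ?_ ?_
  · filter_upwards [h] with n ⟨hm, E, hE, hEA, hS⟩
    have := isProbabilityMeasure_mixtureLaw hm (μ n)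
    have h1 : mixtureLaw n (m n) (μ n) Eᶜ ≤ ENNReal.ofReal (δ n) := by
      refine mixtureLaw_le hm fun S hS' => ?_
      rw [Measure.map_apply (measurable_addSignal S _) hE.compl]
      exact hS S (Finset.mem_powersetCard.1 hS').2
    have h2 : (mixtureLaw n (m n) (μ n)).real Eᶜ ≤ max (δ n) 0 := by
      rw [measureReal_def]
      refine ENNReal.toReal_le_of_le_ofReal (le_max_right _ _) (h1.trans ?_)
      exact ENNReal.ofReal_le_ofReal (le_max_left _ _)
    rw [probReal_compl_eq_one_sub hE] at h2
    have h3 : (mixtureLaw n (m n) (μ n)).real E ≤ (mixtureLaw n (m n) (μ n)).real (A n) :=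
      measureReal_mono hEA
    linarith
  · filter_upwards [h] with n ⟨hm, _⟩
    have := isProbabilityMeasure_mixtureLaw hm (μ n)
    exact measureReal_le_one

/-! ### The level of single observations -/

lemma gridStep_zero {n : ℕ} (hn : 1 ≤ n) : gridStep n 0 = 1 := by
  have hn' : (1 : ℝ) ≤ n := by exact_mod_cast hn
  unfold gridStep precision
  have h1 : 1 ≤ Real.logb 2 ((n : ℝ) / ((2 : ℝ) ^ 0 / 2)) := by
    rw [Real.le_logb_iff_rpow_le (by norm_num) (by positivity)]
    norm_num
    linarith
  have h2 : 1 ≤ √(Real.logb 2 ((n : ℝ) / ((2 : ℝ) ^ 0 / 2))) := by rwa [Real.one_le_sqrt]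
  rw [Nat.ceil_eq_iff one_ne_zero]
  constructor
  · simp only [tsub_self, Nat.cast_zero]; positivity
  · have : 1 / (6 * √(Real.logb 2 ((n : ℝ) / ((2 : ℝ) ^ 0 / 2)))) ≤ 1 := by
      rw [div_le_one (by positivity)]; linarith
    norm_num at this ⊢
    linarith

lemma approxIntervals_zero {n : ℕ} (hn : 1 ≤ n) :
    approxIntervals n 0 = (Finset.range n).image fun j => (j, j + 1) := by
  ext I
  rw [mem_approxIntervals, gridStep_zero hn]
  simp only [Finset.mem_image, Finset.mem_range, one_dvd, true_and, pow_zero]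
  constructor
  · rintro ⟨h1, h2, h3, h4⟩
    exact ⟨I.1, by omega, by ext <;> simp; omega⟩
  · rintro ⟨j, hj, rfl⟩
    simp only
    omega

lemma card_approxIntervals_zero {n : ℕ} (hn : 1 ≤ n) : (approxIntervals n 0).card = n := by
  rw [approxIntervals_zero hn, Finset.card_image_of_injective _ fun a b h => congrArg Prod.fst h,
    Finset.card_range]

lemma intervalStat_singleton {n : ℕ} (x : Fin n → ℝ) (j : Fin n) :
    intervalStat x (j, j + 1) = x j := by
  unfold intervalStat
  have : (Finset.univ.filter fun i : Fin n => (j : ℕ) < i.val + 1 ∧ i.val + 1 ≤ (j : ℕ) + 1) = {j} := by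
    ext i
    simp only [Finset.mem_filter, Finset.mem_univ, true_and, Finset.mem_singleton, Fin.ext_iff]
    omega
  simp only [this, Finset.sum_singleton]
  simp

lemma countP_levelPValues_zero {n : ℕ} (hn : 1 ≤ n) (x : Fin n → ℝ) (z : ℝ) :
    (levelPValues x 0).countP (· ≤ pValue z) = survivalCount x z := by
  rw [countP_levelPValues, approxIntervals_zero hn, Finset.filter_image,
    Finset.card_image_of_injective _ fun a b h => congrArg Prod.fst h, Finset.card_filter,
    Finset.sum_range, survivalCount, Finset.card_filter]
  simp only [intervalStat_singleton]

/-- Keeps only level 0, whose scaling factor is 1, and one index `i` in the maximum; the witness `p`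
is the `i`-th order statistic. -/
lemma exists_le_structured {n i : ℕ} (hn : 1 ≤ n) (hi : 1 ≤ i) (hi2 : i ≤ n / 2) {x : Fin n → ℝ}
    {z : ℝ} (hz : pValue z < i / n) (hx : i ≤ survivalCount x z) :
    ∃ p, 0 < p ∧ p ≤ pValue z ∧ n * binaryKL (i / n) p ≤ structuredBJ x ∧
      √n * (((i : ℝ) / n - p) / √(p * (1 - p))) ≤ structuredHC x := by
  have hcard : (levelPValues x 0).card = n := by
    rw [card_levelPValues, card_approxIntervals_zero hn]
  have hn0 : (n : ℝ) ≠ 0 := by exact_mod_cast (by omega : n ≠ 0)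
  have hle : orderStat (levelPValues x 0) i ≤ pValue z :=
    orderStat_le_of_le_countP hi (by rwa [countP_levelPValues_zero hn])
  have hpos : 0 < orderStat (levelPValues x 0) i := by
    obtain ⟨I, -, hI⟩ := Multiset.mem_map.1
      (orderStat_mem hi (show i ≤ (levelPValues x 0).card by omega))
    have h := pValue_pos (intervalStat x I)
    rw [hI] at h
    exact h
  refine ⟨_, hpos, hle, ?_, ?_⟩
  · have h1 : n * binaryKL (i / n) (orderStat (levelPValues x 0) i) ≤
        berkJones (levelPValues x 0) := by
      refine le_csSup ((Set.finite_Icc _ _).image _).bddAbove ⟨i, ?_, ?_⟩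
      · rw [hcard]; exact ⟨hi, hi2⟩
      · simp only [hcard]
        rw [if_pos (hle.trans_lt hz), berkJones_term (by omega)]
    refine h1.trans (le_csSup ((Set.finite_Icc _ _).image _).bddAbove ⟨0, ⟨le_rfl, zero_le⟩, ?_⟩)
    simp only [card_approxIntervals_zero hn, pow_zero, one_mul, div_self hn0]
  · have h1 : √n * (((i : ℝ) / n - orderStat (levelPValues x 0) i) /
        √(orderStat (levelPValues x 0) i * (1 - orderStat (levelPValues x 0) i))) ≤
        higherCriticism (levelPValues x 0) := by
      refine le_csSup ((Set.finite_Icc _ _).image _).bddAbove ⟨i, ?_, ?_⟩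
      · rw [hcard]; exact ⟨hi, hi2⟩
      · simp only [hcard]
    refine h1.trans (le_csSup ((Set.finite_Icc _ _).image _).bddAbove ⟨0, ⟨le_rfl, zero_le⟩, ?_⟩)
    simp only [card_approxIntervals_zero hn, pow_zero, one_mul, div_self hn0, Real.sqrt_one]

/-- Both statistics dominate the same quadratic excess, since the relative entropy lies between `(u
- p) ^ 2 / (2 * u)` and `(u - p) ^ 2 / (p * (1 - p))`. Replacing the order statistic by the larger
`pValue z` only decreases the excess. -/
lemma le_structured_of_survivalCount {n i : ℕ} (hn : 1 ≤ n) (hi : 1 ≤ i) (hi2 : i ≤ n / 2)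
    {x : Fin n → ℝ} {z : ℝ} (hz : n * pValue z < i) (hx : i ≤ survivalCount x z) :
    (i - n * pValue z) ^ 2 / (2 * i) ≤ structuredBJ x ∧
      √((i - n * pValue z) ^ 2 / (2 * i)) ≤ structuredHC x := by
  have hn0 : (0 : ℝ) < n := by exact_mod_cast hn
  have hi0 : (0 : ℝ) < i := by exact_mod_cast hi
  have hz' : pValue z < i / n := by rw [lt_div_iff₀ hn0]; linarith
  obtain ⟨p, hp, hpz, hBJ, hHC⟩ := exists_le_structured hn hi hi2 hz' hx
  set u := (i : ℝ) / n with hu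
  have hu2 : u ≤ 1 / 2 := by
    rw [hu, div_le_div_iff₀ hn0 two_pos]
    have : i * 2 ≤ 1 * n := by omega
    exact_mod_cast this
  have hu0 : 0 < u := by positivity
  have hpu : p < u := hpz.trans_lt hz'
  have h1 : (i - n * pValue z) ^ 2 / (2 * i) ≤ n * binaryKL u p := by
    have e : (i - n * pValue z) ^ 2 / (2 * i) = n * ((u - pValue z) ^ 2 / (2 * u)) := by
      rw [hu]; field_simp
    rw [e]
    refine mul_le_mul_of_nonneg_left ?_ hn0.le
    refine le_trans ?_ ((sq_div_le_poissonKL hp hpu.le).trans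
      (poissonKL_le_binaryKL hpu (by linarith)))
    gcongr
  refine ⟨h1.trans hBJ, le_trans ?_ hHC⟩
  have hq : 0 < p * (1 - p) := mul_pos hp (by linarith)
  apply Real.sqrt_le_iff.2
  refine ⟨mul_nonneg (Real.sqrt_nonneg _) (div_nonneg (by linarith) (Real.sqrt_nonneg _)), ?_⟩
  rw [mul_pow, div_pow, Real.sq_sqrt hn0.le, Real.sq_sqrt hq.le]
  exact h1.trans (mul_le_mul_of_nonneg_left (binaryKL_le_sq_div hp hpu (by linarith)) hn0.le)

/-! ### Concentration of the survival count under the alternative -/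

lemma survivalCount_addSignal_eq {n : ℕ} (S : Finset (Fin n)) (μ z : ℝ) (x : Fin n → ℝ) :
    (survivalCount (addSignal S μ x) z : ℝ) =
      ∑ i, (Set.Ici (z - if i ∈ S then μ else 0)).indicator (fun _ => (1 : ℝ)) (x i) := by
  rw [survivalCount, Finset.card_filter]
  push_cast
  refine Finset.sum_congr rfl fun i _ => ?_
  simp only [Set.indicator_apply, Set.mem_Ici, addSignal, sub_le_iff_le_add']
  congr

/-- Chebyshev's inequality: the count is a sum of independent indicators with mean `Q`, so its
variance is at most `Q`. -/
lemma nullLaw_survivalCount_addSignal_le {n : ℕ} (S : Finset (Fin n)) (μ z : ℝ) {Q h : ℝ}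
    (hQ : Q = S.card * pValue (z - μ) + (n - S.card) * pValue z) (hh : 0 < h) :
    nullLaw n {x | (survivalCount (addSignal S μ x) z : ℝ) ≤ Q - h} ≤
      ENNReal.ofReal (Q / h ^ 2) := by
  set w : Fin n → ℝ := fun i => z - if i ∈ S then μ else 0 with hw
  set Y : Fin n → ℝ → ℝ := fun i => (Set.Ici (w i)).indicator fun _ => (1 : ℝ) with hY
  have hYm : ∀ i, Measurable (Y i) := fun i => measurable_const.indicator measurableSet_Ici
  have hYbound : ∀ i y, Y i y ∈ Set.Icc (0 : ℝ) 1 := by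
    intro i y
    simp only [hY, Set.indicator_apply]
    split_ifs <;> simp
  have hYL : ∀ i, MemLp (Y i) 2 (gaussianReal 0 1) := fun i =>
    MemLp.of_bound (hYm i).aestronglyMeasurable 1 (Eventually.of_forall fun y => by
      rw [Real.norm_eq_abs, abs_of_nonneg (hYbound i y).1]; exact (hYbound i y).2)
  have hYint : ∀ i, ∫ y, Y i y ∂(gaussianReal 0 1) = pValue (w i) := by
    intro i
    simp only [hY]
    rw [integral_indicator measurableSet_Ici]
    simp [pValue]
  have hYvar : ∀ i, Var[Y i; gaussianReal 0 1] ≤ pValue (w i) := by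
    intro i
    refine (variance_le_expectation_sq (hYm i).aestronglyMeasurable).trans (le_of_eq ?_)
    rw [← hYint i]
    congr 1
    funext y
    simp only [hY, Pi.pow_apply, Set.indicator_apply]
    split_ifs <;> simp
  have hsum : ∑ i, pValue (w i) = Q := by
    have : ∀ i, pValue (w i) = pValue z + if i ∈ S then pValue (z - μ) - pValue z else 0 := by
      intro i; simp only [hw]; split_ifs <;> simp
    rw [Finset.sum_congr rfl fun i _ => this i, Finset.sum_add_distrib, Finset.sum_ite_mem, hQ]
    simp
    ring
  set Z : (Fin n → ℝ) → ℝ := fun x => ∑ i, Y i (x i) with hZ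
  have hZeq : Z = ∑ i, fun x : Fin n → ℝ => Y i (x i) := by
    funext x; simp [hZ]
  have hZvar : Var[Z; nullLaw n] ≤ Q := by
    rw [hZeq, nullLaw, variance_sum_pi hYL, ← hsum]
    exact Finset.sum_le_sum fun i _ => hYvar i
  have hcomp : ∀ i, MemLp (fun x : Fin n → ℝ => Y i (x i)) 2 (nullLaw n) := fun i =>
    (hYL i).comp_measurePreserving (measurePreserving_eval (fun _ : Fin n => gaussianReal 0 1) i)
  have hZint : ∫ x, Z x ∂(nullLaw n) = Q := by
    simp only [hZ]
    rw [integral_finsetSum _ fun i _ => (hcomp i).integrable (by norm_num), ← hsum]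
    refine Finset.sum_congr rfl fun i _ => ?_
    rw [← hYint i, nullLaw]
    exact integral_comp_eval (μ := fun _ : Fin n => gaussianReal 0 1) (hYm i).aestronglyMeasurable
  have hZL : MemLp Z 2 (nullLaw n) := memLp_finsetSum _ fun i _ => hcomp i
  refine le_trans (measure_mono fun x hx => ?_) ((meas_ge_le_variance_div_sq hZL hh).trans
    (ENNReal.ofReal_le_ofReal (div_le_div_of_nonneg_right hZvar (by positivity))))
  simp only [Set.mem_ofPred_eq] at hx ⊢
  rw [survivalCount_addSignal_eq] at hx
  rw [hZint, abs_sub_comm]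
  exact le_trans (by simp only [hZ, hY, hw]; linarith) (le_abs_self _)

/-! ### Power above the boundary -/

lemma pValue_mul_sqrt_le {a L : ℝ} (ha : 0 ≤ a) (hL : 0 ≤ L) :
    pValue (a * √(2 * L)) ≤ Real.exp (-(a ^ 2 * L)) := by
  refine (pValue_le_exp (by positivity)).trans (le_of_eq ?_)
  congr 1
  rw [mul_pow, Real.sq_sqrt (by positivity)]
  ring

/-- Shifting the argument by 1 in `exp_le_pValue` and the constant in front cost only O(√L) in the
exponent, which `δ * L` absorbs. -/
lemma eventually_exp_le_pValue {a δ : ℝ} (ha : 0 ≤ a) (hδ : 0 < δ) :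
    ∀ᶠ L : ℝ in atTop, Real.exp (-((a ^ 2 + δ) * L)) ≤ pValue (a * √(2 * L)) := by
  set c := 1 / 2 + Real.log (√(2 * Real.pi)) with hc
  have h1 := Real.tendsto_sqrt_atTop.eventually_ge_atTop ((a * √2 + |c|) / δ)
  filter_upwards [h1, eventually_ge_atTop 1] with L h1 h2
  refine le_trans ?_ (exp_le_pValue (by positivity))
  have hpi : 0 < √(2 * Real.pi) := by positivity
  have e : (√(2 * Real.pi))⁻¹ = Real.exp (-Real.log (√(2 * Real.pi))) := by
    rw [Real.exp_neg, Real.exp_log hpi]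
  rw [e, ← Real.exp_add, Real.exp_le_exp]
  have hs : √L ^ 2 = L := Real.sq_sqrt (by linarith)
  have hs1 : 1 ≤ √L := by rw [Real.one_le_sqrt]; exact h2
  rw [Real.sqrt_mul (show (0 : ℝ) ≤ 2 by norm_num) L]
  rw [div_le_iff₀ hδ] at h1
  have h3 : (a * √2 + |c|) * √L ≤ √L * δ * √L := by gcongr
  have h4 : c ≤ |c| * √L := (le_abs_self c).trans (le_mul_of_one_le_right (abs_nonneg c) hs1)
  have h5 : √2 ^ 2 = 2 := Real.sq_sqrt (by norm_num)
  have e2 : (a * (√2 * √L) + 1) ^ 2 = a ^ 2 * (2 * L) + 2 * (a * √2 * √L) + 1 := by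
    calc (a * (√2 * √L) + 1) ^ 2 = a ^ 2 * (√2 ^ 2 * √L ^ 2) + 2 * (a * √2 * √L) + 1 := by ring
      _ = _ := by rw [h5, hs]
  have e3 : √L * δ * √L = δ * L := by rw [← hs]; ring_nf; rw [Real.sqrt_sq (Real.sqrt_nonneg L)]
  rw [e2]
  rw [e3] at h3
  linarith

lemma eventually_card_bounds {β : ℝ} {m : ℕ → ℕ}
    (hm : Tendsto (fun n : ℕ => (m n : ℝ) / (n : ℝ) ^ (1 - β)) atTop (𝓝 1)) :
    ∀ᶠ n : ℕ in atTop, Real.exp ((1 - β) * Real.log n) / 2 ≤ m n ∧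
      (m n : ℝ) ≤ 2 * Real.exp ((1 - β) * Real.log n) := by
  filter_upwards [hm.eventually (lt_mem_nhds (show (1 / 2 : ℝ) < 1 by norm_num)),
    hm.eventually (gt_mem_nhds (show (1 : ℝ) < 2 by norm_num)), eventually_ge_atTop 1]
    with n h1 h2 hn
  have hn0 : (0 : ℝ) < n := by exact_mod_cast hn
  have e : (n : ℝ) ^ (1 - β) = Real.exp ((1 - β) * Real.log n) := by
    rw [Real.rpow_def_of_pos hn0, mul_comm]
  rw [e] at h1 h2
  rw [lt_div_iff₀ (Real.exp_pos _)] at h1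
  rw [div_lt_iff₀ (Real.exp_pos _)] at h2
  constructor <;> linarith

lemma eventually_pow_lt_exp {η : ℝ} (hη : 0 < η) :
    ∀ᶠ L : ℝ in atTop, 64 * L ^ 6 < Real.exp (η * L) := by
  have h := (isLittleO_pow_exp_pos_mul_atTop 6 hη).bound (show (0 : ℝ) < 1 / 128 by norm_num)
  filter_upwards [h, eventually_ge_atTop 1] with L h hL
  rw [Real.norm_of_nonneg (by positivity), Real.norm_of_nonneg (Real.exp_pos _).le] at h
  have := Real.exp_pos (η * L)
  linarith

/-- The index is `i = ⌊n * pValue z + s / 3⌋`. Since `s ≥ 12`, rounding leaves `i - n * pValue z ≥ s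
/ 3 - 1 ≥ s / 4`, hence the constant `32 = 2 * 4 ^ 2`. -/
lemma lt_structured_of_floor_le {n : ℕ} {z s K : ℝ} (hn : 1 ≤ n) (hs : 12 ≤ s)
    (hhalf : n * pValue z + s / 3 ≤ n / 2) (hK : 32 * K < s ^ 2 / (n * pValue z + s))
    {x : Fin n → ℝ} (hx : ⌊n * pValue z + s / 3⌋₊ ≤ survivalCount x z) :
    K < structuredBJ x ∧ √K < structuredHC x := by
  set t := pValue z with ht
  have hnt : 0 < n * t := mul_pos (by exact_mod_cast hn) (pValue_pos _)
  set i := ⌊n * t + s / 3⌋₊ with hi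
  have hi1 : (i : ℝ) ≤ n * t + s / 3 := Nat.floor_le (by linarith)
  have hi2 : n * t + s / 3 < i + 1 := Nat.lt_floor_add_one _
  have hige : 1 ≤ i := by
    rw [hi, Nat.one_le_floor_iff]; linarith
  have hihalf : i ≤ n / 2 := by
    rw [Nat.le_div_iff_mul_le two_pos]
    have : (i : ℝ) * 2 ≤ n := by linarith
    exact_mod_cast this
  have hlt : n * t < i := by linarith
  have hi0 : (0 : ℝ) < i := by exact_mod_cast hige
  obtain ⟨hBJ, hHC⟩ := le_structured_of_survivalCount hn hige hihalf hlt hx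
  have h1 : s ^ 2 / (n * t + s) / 32 ≤ (i - n * t) ^ 2 / (2 * i) := by
    rw [div_div, div_le_div_iff₀ (by linarith) (by linarith)]
    have h2 : (s / 4) ^ 2 ≤ (i - n * t) ^ 2 := by
      apply pow_le_pow_left₀ (by linarith); linarith
    calc s ^ 2 * (2 * i) ≤ s ^ 2 * (2 * (n * t + s)) := by gcongr; linarith
      _ = (s / 4) ^ 2 * ((n * t + s) * 32) := by ring
      _ ≤ _ := mul_le_mul_of_nonneg_right h2 (by linarith)
  have hbig : K < (i - n * t) ^ 2 / (2 * i) := by linarith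
  have hpos : 0 < (i - n * t) ^ 2 / (2 * i) := by
    have : 0 < i - n * t := by linarith
    positivity
  exact ⟨hbig.trans_le hBJ, (Real.sqrt_lt_sqrt_iff_of_pos hpos |>.2 hbig).trans_le hHC⟩

/-- As `3 * pValue z ≤ pValue (z - μ)`, the mean count is at least `n * pValue z + 2 * s / 3`, which
leaves a margin of `s / 3` for Chebyshev's inequality. -/
lemma nullLaw_survivalCount_lt_floor {n : ℕ} (S : Finset (Fin n)) (μ z : ℝ) {s : ℝ}
    (hs : s = S.card * pValue (z - μ)) (hs0 : 0 < s) (h3 : 3 * pValue z ≤ pValue (z - μ)) :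
    nullLaw n {x | addSignal S μ x ∉
      {x | (⌊n * pValue z + s / 3⌋₊ : ℝ) ≤ survivalCount x z}} ≤
      ENNReal.ofReal (9 / (s ^ 2 / (n * pValue z + s))) := by
  set t := pValue z with ht
  have ht0 : 0 < t := pValue_pos z
  have hm0 : 0 ≤ (S.card : ℝ) := Nat.cast_nonneg _
  set Q := (S.card : ℝ) * pValue (z - μ) + (n - S.card) * t with hQ
  have hQ' : Q = s + n * t - S.card * t := by rw [hQ, hs]; ring
  have hmt : 3 * (S.card * t) ≤ s := by
    rw [hs]; have := mul_le_mul_of_nonneg_left h3 hm0; linarith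
  have hmt0 : 0 ≤ S.card * t := by positivity
  have hnt0 : 0 ≤ n * t := by positivity
  have hh : s / 3 ≤ Q - (n * t + s / 3) := by rw [hQ']; linarith
  refine le_trans (measure_mono fun x hx => ?_)
    ((nullLaw_survivalCount_addSignal_le S μ z hQ
      (show 0 < Q - (n * t + s / 3) by linarith)).trans (ENNReal.ofReal_le_ofReal ?_))
  · simp only [Set.mem_ofPred_eq, not_le] at hx ⊢
    have := Nat.floor_le (show 0 ≤ n * t + s / 3 by linarith)
    linarith
  · calc Q / (Q - (n * t + s / 3)) ^ 2 ≤ (n * t + s) / (s / 3) ^ 2 := by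
          apply div_le_div₀ (by linarith) (by linarith) (by positivity)
          exact pow_le_pow_left₀ (by positivity) hh 2
      _ = 9 / (s ^ 2 / (n * t + s)) := by field_simp; norm_num

-- With the threshold `z = √q * √(2 * L)`, the noise count is at most `n ^ (1 - q)` and the signal
-- count `s` at least `n ^ (f - η)`. The conditions on `η` make both `s` and `s ^ 2 / (n * t)` at
-- least `n ^ η`. Then `s ^ 2 / (n * t + s) ≥ n ^ η / 2`, which exceeds every power of `log n` and
-- also controls the failure probability.
set_option maxHeartbeats 1000000 in
lemma eventually_excess_of_sparse {β r q η : ℝ} {m : ℕ → ℕ} (hβ : 1 / 2 < β) (hr : 0 < r)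
    (hrq : r ≤ q) (hη : 0 < η) (hηr : η ≤ r) (hη2 : η ≤ 1 / 2)
    (hη3 : 2 * η ≤ 1 - β - (√q - √r) ^ 2)
    (hη4 : 1 - q ≤ 2 * (1 - β - (√q - √r) ^ 2) - 4 * η)
    (hm : Tendsto (fun n : ℕ => (m n : ℝ) / (n : ℝ) ^ (1 - β)) atTop (𝓝 1)) :
    ∀ᶠ n : ℕ in atTop, m n ≤ n ∧ ∃ E : Set (Fin n → ℝ), MeasurableSet E ∧
      E ⊆ {x | √(Real.log n) < structuredBJ x ∧ Real.log n ^ 3 < structuredHC x} ∧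
      ∀ S : Finset (Fin n), S.card = m n →
        nullLaw n {x | addSignal S (√(2 * r * Real.log n)) x ∉ E} ≤
          ENNReal.ofReal (18 * Real.exp (-(η * Real.log n))) := by
  set f := 1 - β - (√q - √r) ^ 2 with hf
  have hq : 0 < q := hr.trans_le hrq
  have hw0 : 0 ≤ √q - √r := sub_nonneg.2 (Real.sqrt_le_sqrt hrq)
  have hηhalf : 0 < η / 2 := by positivity
  filter_upwards [eventually_card_bounds hm,
    tendsto_log_natCast.eventually (eventually_exp_le_pValue hw0 hηhalf),
    tendsto_log_natCast.eventually (eventually_pow_lt_exp hη),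
    tendsto_log_natCast.eventually_ge_atTop 1,
    tendsto_log_natCast.eventually ((Real.tendsto_exp_atTop.comp
      (tendsto_id.const_mul_atTop hηhalf)).eventually_ge_atTop 4), eventually_ge_atTop 1]
    with n ⟨hm1, hm2⟩ hP hpow hL h4 hn
  set L := Real.log n with hLdef
  simp only [Function.comp_apply, id] at h4
  have hn0 : (0 : ℝ) < n := by exact_mod_cast hn
  have hnL : (n : ℝ) = Real.exp L := (Real.exp_log hn0).symm
  set z := √q * √(2 * L) with hz
  set μ := √(2 * r * L) with hμ
  have hμ' : μ = √r * √(2 * L) := by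
    rw [hμ, ← Real.sqrt_mul hr.le]; congr 1; ring
  have hzμ : z - μ = (√q - √r) * √(2 * L) := by rw [hμ', hz]; ring
  set t := pValue z with ht
  set P := pValue (z - μ) with hPdef
  rw [← hzμ] at hP
  set s := (m n : ℝ) * P with hs
  have h16 : 16 ≤ Real.exp (η * L) := by
    have : Real.exp (η * L) = Real.exp (η / 2 * L) * Real.exp (η / 2 * L) := by
      rw [← Real.exp_add]; congr 1; ring
    rw [this]; nlinarith
  have ht1 : t ≤ Real.exp (-(q * L)) := by
    have := pValue_mul_sqrt_le (Real.sqrt_nonneg q) (show 0 ≤ L by linarith)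
    rwa [Real.sq_sqrt hq.le] at this
  have ht0 : 0 < t := pValue_pos _
  have hP0 : 0 < P := pValue_pos _
  have h3t : 3 * t ≤ P := by
    have e : Real.exp (-(((√q - √r) ^ 2 + η / 2) * L)) ≥ 4 * Real.exp (-(q * L)) := by
      calc 4 * Real.exp (-(q * L)) ≤ Real.exp (η / 2 * L) * Real.exp (-(q * L)) := by gcongr
        _ = Real.exp (η / 2 * L + -(q * L)) := by rw [Real.exp_add]
        _ ≤ _ := by
          rw [Real.exp_le_exp]
          have e1 : (√q - √r) ^ 2 = q + r - 2 * (√q * √r) := by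
            have := Real.sq_sqrt hq.le; have := Real.sq_sqrt hr.le
            ring_nf; nlinarith
          have e2 : r ≤ √q * √r := by
            calc r = √r * √r := (Real.mul_self_sqrt hr.le).symm
              _ ≤ _ := by gcongr
          have e3 : (√q - √r) ^ 2 + η / 2 ≤ q - η / 2 := by rw [e1]; linarith
          have := mul_le_mul_of_nonneg_right e3 (show 0 ≤ L by linarith)
          linarith
    linarith
  have hntexp : n * t ≤ Real.exp ((1 - q) * L) := by
    calc n * t ≤ Real.exp L * Real.exp (-(q * L)) := by rw [hnL]; gcongr
      _ = _ := by rw [← Real.exp_add]; congr 1; ring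
  have hnt : n * t ≤ n / 4 := by
    have : Real.exp (-(q * L)) ≤ 1 / 4 := by
      rw [Real.exp_neg, inv_le_comm₀ (Real.exp_pos _) (by norm_num)]
      calc (1 / 4 : ℝ)⁻¹ ≤ Real.exp (η * L) := by norm_num; linarith
        _ ≤ _ := by gcongr; linarith
    have := mul_le_mul_of_nonneg_left (ht1.trans this) hn0.le
    linarith
  have hmn : (m n : ℝ) ≤ n / 4 := by
    have h1 : 8 * Real.exp ((1 - β) * L) ≤ Real.exp L := by
      calc 8 * Real.exp ((1 - β) * L) ≤ Real.exp (η * L) * Real.exp ((1 - β) * L) := by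
            gcongr; linarith
        _ = Real.exp ((η + (1 - β)) * L) := by rw [← Real.exp_add]; congr 1; ring
        _ ≤ _ := by
          rw [Real.exp_le_exp]
          nlinarith
    rw [hnL]; linarith
  have hm0 : 0 ≤ (m n : ℝ) := Nat.cast_nonneg _
  have hmle : m n ≤ n := by
    have : (m n : ℝ) ≤ n := by linarith
    exact_mod_cast this
  have hs0 : Real.exp ((f - η) * L) ≤ s := by
    calc Real.exp ((f - η) * L)
        = Real.exp (-(η / 2 * L)) * (Real.exp ((1 - β) * L) *
            Real.exp (-(((√q - √r) ^ 2 + η / 2) * L))) := by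
          rw [← Real.exp_add, ← Real.exp_add]; congr 1; rw [hf]; ring
      _ ≤ (1 / 2) * (Real.exp ((1 - β) * L) * P) := by
          gcongr
          rw [Real.exp_neg, inv_le_comm₀ (Real.exp_pos _) (by norm_num)]
          norm_num; linarith
      _ ≤ s := by
          rw [hs]
          have := mul_le_mul_of_nonneg_right hm1 hP0.le
          linarith
  have hspos : 0 < s := (Real.exp_pos _).trans_le hs0
  have hnt0 : 0 < n * t := by positivity
  have hR : Real.exp (η * L) / 2 ≤ s ^ 2 / (n * t + s) := by
    rw [div_le_div_iff₀ two_pos (by positivity)]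
    have hsη : Real.exp (η * L) ≤ s := by
      refine le_trans ?_ hs0
      rw [Real.exp_le_exp]
      have := mul_le_mul_of_nonneg_right (show η ≤ f - η by linarith) (show 0 ≤ L by linarith)
      linarith
    have h1 : Real.exp (η * L) * (n * t) ≤ s ^ 2 := by
      calc Real.exp (η * L) * (n * t) ≤ Real.exp (η * L) * Real.exp ((1 - q) * L) := by gcongr
        _ = Real.exp ((η + (1 - q)) * L) := by rw [← Real.exp_add]; congr 1; ring
        _ ≤ Real.exp ((f - η) * L + (f - η) * L) := by
          rw [Real.exp_le_exp]
          have := mul_le_mul_of_nonneg_right (show η + (1 - q) ≤ 2 * (f - η) by linarith)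
            (show 0 ≤ L by linarith)
          linarith
        _ = Real.exp ((f - η) * L) ^ 2 := by rw [Real.exp_add, sq]
        _ ≤ s ^ 2 := by gcongr
    have h2 : Real.exp (η * L) * s ≤ s ^ 2 := by rw [sq]; gcongr
    rw [mul_add]; linarith
  have hRs : s ^ 2 / (n * t + s) ≤ s := by
    rw [div_le_iff₀ (by positivity)]; nlinarith
  have hpow1 : (1 : ℝ) ≤ L ^ 6 := one_le_pow₀ hL
  have hs12 : 12 ≤ s := by linarith
  have hsm : s ≤ m n := by
    rw [hs]; exact mul_le_of_le_one_right hm0 (pValue_lt_one _).le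
  have hhalf : n * t + s / 3 ≤ n / 2 := by linarith
  have h32 : 32 * L ^ 6 < s ^ 2 / (n * t + s) := by linarith
  refine ⟨hmle, {x | (⌊n * t + s / 3⌋₊ : ℝ) ≤ survivalCount x z},
    measurableSet_le measurable_const (measurable_survivalCount z), fun x hx => ?_, fun S hS => ?_⟩
  · obtain ⟨hBJ, hHC⟩ := lt_structured_of_floor_le hn hs12 hhalf h32 (x := x) (by exact_mod_cast hx)
    refine ⟨lt_of_le_of_lt ?_ hBJ, lt_of_le_of_lt ?_ hHC⟩
    · have h1 : √L ≤ L := by rw [Real.sqrt_le_left (by linarith)]; nlinarith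
      have h2 : L ≤ L ^ 6 := by
        simpa using pow_le_pow_right₀ hL (show 1 ≤ 6 by norm_num)
      exact h1.trans h2
    · exact Real.le_sqrt_of_sq_le (le_of_eq (by ring))
  · refine (nullLaw_survivalCount_lt_floor S μ z (s := s) (by rw [hS]) hspos h3t).trans
      (ENNReal.ofReal_le_ofReal ?_)
    calc 9 / (s ^ 2 / (n * t + s)) ≤ 9 / (Real.exp (η * L) / 2) := by gcongr
      _ = _ := by rw [Real.exp_neg]; field_simp; norm_num

/-- The choice is `q = 4 * r` while this stays below 1, then the largest noise level `q = 1`, and `q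
= r` for still stronger signals. The linear branch `β - 1 / 2` lies below the curve `(1 - √(1 - β))
^ 2` and touches it where `√(1 - β) = 1 / 2`, so either branch of the boundary can be used for the
needed comparison. -/
lemma exists_threshold {β r : ℝ} (hβ1 : β < 1) (hr : 0 < r)
    (h : detectionBoundary β < r) :
    ∃ q, r ≤ q ∧ 0 < 1 - β - (√q - √r) ^ 2 ∧ 1 - q < 2 * (1 - β - (√q - √r) ^ 2) := by
  have hs0 : 0 < √(1 - β) := Real.sqrt_pos.2 (by linarith)
  have hs2 : √(1 - β) ^ 2 = 1 - β := Real.sq_sqrt (by linarith)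
  set s := √(1 - β) with hs
  have hr2 : √r ^ 2 = r := Real.sq_sqrt hr.le
  have hr0 := Real.sqrt_nonneg r
  rcases lt_or_ge r (1 / 4) with h1 | h1
  · refine ⟨4 * r, by linarith, ?_⟩
    have e : √(4 * r) - √r = √r := by
      rw [Real.sqrt_mul (by norm_num), show (4 : ℝ) = 2 ^ 2 by norm_num,
        Real.sqrt_sq (by norm_num)]
      ring
    have hlow : β - 1 / 2 < r := by
      unfold detectionBoundary at h
      split_ifs at h with hb
      · exact h
      · have : β - 1 / 2 ≤ (1 - s) ^ 2 := by nlinarith [sq_nonneg (s - 1 / 2)]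
        linarith
    rw [e, hr2]
    constructor <;> linarith
  rcases lt_or_ge r 1 with h2 | h2
  · refine ⟨1, h2.le, ?_⟩
    rw [Real.sqrt_one]
    have hrlt : √r < 1 := by rw [Real.sqrt_lt' one_pos]; linarith
    have hkey : 1 - √r < s := by
      unfold detectionBoundary at h
      split_ifs at h with hb
      · rcases hb.lt_or_eq with hb | hb
        · have : 1 / 2 < s := by rw [hs, Real.lt_sqrt (by norm_num)]; linarith
          have : 1 / 2 ≤ √r := by rw [Real.le_sqrt' (by norm_num)]; linarith
          linarith
        -- At `β = 3 / 4` the strictness comes from `r > 1 / 4`; for smaller `β` it comes from `√(1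
        -- - β) > 1 / 2`.
        · have : 1 / 2 ≤ s := by rw [hs, Real.le_sqrt' (by norm_num)]; linarith
          have : 1 / 2 < √r := by rw [Real.lt_sqrt (by norm_num)]; linarith
          linarith
      · by_contra hcon
        have : s ≤ 1 := by nlinarith
        have : √r ^ 2 ≤ (1 - s) ^ 2 := by
          apply pow_le_pow_left₀ hr0; linarith
        linarith
    have : (1 - √r) ^ 2 < s ^ 2 := pow_lt_pow_left₀ hkey (by linarith) two_ne_zero
    constructor <;> linarith
  · refine ⟨r, le_rfl, ?_⟩
    rw [sub_self]
    constructor <;> norm_num <;> linarith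

/-- At `β = 1` the expected signal count is at most 1, so Chebyshev's inequality gives nothing.
Instead `q` lies strictly between 1 and `r`: the signal exceeds the threshold with probability
tending to 1, and there the smallest p-value satisfies `n * p ≤ n ^ (-(q - 1))`. Berk-Jones is then
only of order `log n` at least, which is why its critical value has to be of smaller order. -/
lemma eventually_excess_of_single {r : ℝ} {m : ℕ → ℕ} (hr : 1 < r)
    (hm : ∀ᶠ n in atTop, m n = 1) :
    ∃ δ : ℕ → ℝ, Tendsto δ atTop (𝓝 0) ∧
    ∀ᶠ n : ℕ in atTop, m n ≤ n ∧ ∃ E : Set (Fin n → ℝ), MeasurableSet E ∧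
      E ⊆ {x | √(Real.log n) < structuredBJ x ∧ Real.log n ^ 3 < structuredHC x} ∧
      ∀ S : Finset (Fin n), S.card = m n →
        nullLaw n {x | addSignal S (√(2 * r * Real.log n)) x ∉ E} ≤ ENNReal.ofReal (δ n) := by
  set q := (1 + r) / 2 with hqdef
  have hq1 : 1 < q := by rw [hqdef]; linarith
  have hqr : q < r := by rw [hqdef]; linarith
  have hgap : √q - √r < 0 := sub_neg.2 (Real.sqrt_lt_sqrt (by linarith) hqr)
  refine ⟨fun n => 1 - pValue ((√q - √r) * √(2 * Real.log n)), ?_, ?_⟩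
  · have h1 : Tendsto (fun n : ℕ => (√q - √r) * √(2 * Real.log n)) atTop atBot :=
      (Real.tendsto_sqrt_atTop.comp (tendsto_log_natCast.const_mul_atTop two_pos)).const_mul_atTop_of_neg
        hgap
    simpa using (tendsto_const_nhds (x := (1 : ℝ))).sub (tendsto_pValue_atBot.comp h1)
  have hη : 0 < q - 1 := by linarith
  have hsq : ∀ᶠ L : ℝ in atTop, √L + 1 < (q - 1) * L := by
    filter_upwards [Real.tendsto_sqrt_atTop.eventually_gt_atTop (2 / (q - 1)),
      eventually_ge_atTop 1] with L h1 h2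
    have hs : √L ^ 2 = L := Real.sq_sqrt (by linarith)
    have hs1 : 1 ≤ √L := by rw [Real.one_le_sqrt]; exact h2
    rw [div_lt_iff₀ hη] at h1
    nlinarith
  filter_upwards [hm, tendsto_log_natCast.eventually (eventually_pow_lt_exp hη),
    tendsto_log_natCast.eventually_ge_atTop 1, tendsto_log_natCast.eventually hsq,
    eventually_ge_atTop 2] with n hm hpow hL hsq hn
  set L := Real.log n with hLdef
  have hn0 : (0 : ℝ) < n := by positivity
  have hn1 : 1 ≤ n := by omega
  have hnL : (n : ℝ) = Real.exp L := (Real.exp_log hn0).symm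
  set z := √q * √(2 * L) with hz
  set μ := √(2 * r * L) with hμ
  have hμ' : μ = √r * √(2 * L) := by
    rw [hμ, ← Real.sqrt_mul (by linarith)]; congr 1; ring
  have hzμ : z - μ = (√q - √r) * √(2 * L) := by rw [hμ', hz]; ring
  have ht1 : pValue z ≤ Real.exp (-(q * L)) := by
    have := pValue_mul_sqrt_le (Real.sqrt_nonneg q) (show 0 ≤ L by linarith)
    rwa [Real.sq_sqrt (by linarith)] at this
  have hnt : n * pValue z ≤ Real.exp (-((q - 1) * L)) := by
    calc n * pValue z ≤ Real.exp L * Real.exp (-(q * L)) := by rw [hnL]; gcongr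
      _ = _ := by rw [← Real.exp_add]; congr 1; ring
  have hL6 : (1 : ℝ) ≤ L ^ 6 := one_le_pow₀ hL
  have hsmall : Real.exp (-((q - 1) * L)) ≤ 1 / 4 := by
    rw [Real.exp_neg, inv_le_comm₀ (Real.exp_pos _) (by norm_num)]
    norm_num; linarith
  refine ⟨by omega, {x | ((1 : ℕ) : ℝ) ≤ survivalCount x z},
    measurableSet_le measurable_const (measurable_survivalCount z), ?_, ?_⟩
  · intro x hx
    have hx' : 1 ≤ survivalCount x z := by exact_mod_cast hx
    have hzlt : pValue z < ((1 : ℕ) : ℝ) / n := by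
      rw [lt_div_iff₀ hn0]; push_cast; linarith
    obtain ⟨p, hp, hpz, hBJ, hHC⟩ := exists_le_structured hn1 le_rfl (by omega) hzlt hx'
    rw [Nat.cast_one] at hBJ hHC hzlt
    have hnp : n * p ≤ Real.exp (-((q - 1) * L)) :=
      (mul_le_mul_of_nonneg_left hpz hn0.le).trans hnt
    have hp1 : p < 1 / n := hpz.trans_lt hzlt
    have hn1' : 1 / (n : ℝ) ≤ 1 / 2 := by
      apply one_div_le_one_div_of_le two_pos; exact_mod_cast hn
    constructor
    · refine lt_of_lt_of_le ?_ hBJ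
      have h1 : n * poissonKL (1 / n) p ≤ n * binaryKL (1 / n) p :=
        mul_le_mul_of_nonneg_left (poissonKL_le_binaryKL hp1 (by linarith)) hn0.le
      refine lt_of_lt_of_le ?_ h1
      have e : n * poissonKL (1 / n) p = -Real.log (n * p) - 1 + n * p := by
        unfold poissonKL
        rw [div_div, one_div (n * p : ℝ), Real.log_inv]
        field_simp
        ring
      have h2 : Real.log (n * p) ≤ -((q - 1) * L) := by
        rw [Real.log_le_iff_le_exp (by positivity)]; exact hnp
      have h3 : 0 < n * p := by positivity
      rw [e]; linarith
    · refine lt_of_lt_of_le ?_ hHC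
      have hq0 : 0 < p * (1 - p) := mul_pos hp (by linarith)
      refine lt_of_pow_lt_pow_left₀ 2 (mul_nonneg (Real.sqrt_nonneg _)
        (div_nonneg (by linarith) (Real.sqrt_nonneg _))) ?_
      rw [mul_pow, div_pow, Real.sq_sqrt hn0.le, Real.sq_sqrt hq0.le]
      have h1 : 1 / (2 * n) ≤ 1 / n - p := by
        have : 2 * (n * p) ≤ 1 := by linarith
        rw [div_le_iff₀ (by positivity)]
        have e : (1 / n - p) * (2 * n) = 2 - 2 * (n * p) := by field_simp
        rw [e]; linarith
      calc (L ^ 3) ^ 2 = L ^ 6 := by ring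
        _ < 1 / 4 * Real.exp ((q - 1) * L) := by linarith
        _ ≤ 1 / 4 * (1 / (n * p)) := by
          gcongr
          rw [le_div_iff₀ (by positivity)]
          calc Real.exp ((q - 1) * L) * (n * p)
              ≤ Real.exp ((q - 1) * L) * Real.exp (-((q - 1) * L)) := by gcongr
            _ = 1 := by rw [← Real.exp_add]; simp
        _ = n * ((1 / (2 * n)) ^ 2 / p) := by field_simp; norm_num
        _ ≤ n * ((1 / n - p) ^ 2 / (p * (1 - p))) := by
          gcongr
          nlinarith
  · intro S hS
    rw [hm, Finset.card_eq_one] at hS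
    obtain ⟨k, rfl⟩ := hS
    have hsub : {x : Fin n → ℝ | addSignal {k} μ x ∉ {x | ((1 : ℕ) : ℝ) ≤ survivalCount x z}} ⊆
        (fun x => x k) ⁻¹' (Set.Ici (z - μ))ᶜ := by
      intro x hx hk
      apply hx
      have : 1 ≤ survivalCount (addSignal {k} μ x) z := by
        rw [survivalCount, Nat.one_le_iff_ne_zero, ← Nat.pos_iff_ne_zero, Finset.card_pos]
        refine ⟨k, Finset.mem_filter.2 ⟨Finset.mem_univ _, ?_⟩⟩
        have hk' : z - μ ≤ x k := hk
        simp only [addSignal, Finset.mem_singleton, if_true]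
        linarith
      exact_mod_cast this
    refine (measure_mono hsub).trans ?_
    rw [← Measure.map_apply (measurable_pi_apply k) measurableSet_Ici.compl, nullLaw_map_eval,
      prob_compl_eq_one_sub measurableSet_Ici, gaussianReal_Ici, hzμ,
      ENNReal.ofReal_sub _ (pValue_nonneg _), ENNReal.ofReal_one]

lemma eventually_eq_one {m : ℕ → ℕ}
    (hm : Tendsto (fun n : ℕ => (m n : ℝ) / (n : ℝ) ^ ((1 : ℝ) - 1)) atTop (𝓝 1)) :
    ∀ᶠ n in atTop, m n = 1 := by
  simp only [sub_self, Real.rpow_zero, div_one] at hm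
  filter_upwards [hm.eventually (lt_mem_nhds (show (0 : ℝ) < 1 by norm_num)),
    hm.eventually (gt_mem_nhds (show (1 : ℝ) < 2 by norm_num))] with n h1 h2
  have h1' : 0 < m n := by exact_mod_cast h1
  have h2' : m n < 2 := by exact_mod_cast h2
  omega

lemma exists_excess {β r : ℝ} {m : ℕ → ℕ} (hβ : 1 / 2 < β) (hβ1 : β ≤ 1) (hr : 0 < r)
    (hm : Tendsto (fun n : ℕ => (m n : ℝ) / (n : ℝ) ^ (1 - β)) atTop (𝓝 1))
    (h : detectionBoundary β < r) :
    ∃ δ : ℕ → ℝ, Tendsto δ atTop (𝓝 0) ∧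
    ∀ᶠ n : ℕ in atTop, m n ≤ n ∧ ∃ E : Set (Fin n → ℝ), MeasurableSet E ∧
      E ⊆ {x | √(Real.log n) < structuredBJ x ∧ Real.log n ^ 3 < structuredHC x} ∧
      ∀ S : Finset (Fin n), S.card = m n →
        nullLaw n {x | addSignal S (√(2 * r * Real.log n)) x ∉ E} ≤ ENNReal.ofReal (δ n) := by
  rcases hβ1.lt_or_eq with hlt | rfl
  · obtain ⟨q, hrq, h1, h2⟩ := exists_threshold hlt hr h
    set f := 1 - β - (√q - √r) ^ 2
    obtain ⟨η, hη, e1, e2, e3, e4⟩ : ∃ η, 0 < η ∧ η ≤ r ∧ η ≤ 1 / 2 ∧ 2 * η ≤ f ∧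
        1 - q ≤ 2 * f - 4 * η := by
      refine ⟨min (min r (1 / 2)) (min (f / 2) ((2 * f - (1 - q)) / 4)), ?_, ?_, ?_, ?_, ?_⟩
      · refine lt_min (lt_min hr (by norm_num)) (lt_min (by linarith) (by linarith))
      · exact (min_le_left _ _).trans (min_le_left _ _)
      · exact (min_le_left _ _).trans (min_le_right _ _)
      · have := (min_le_right (min r (1 / 2)) (min (f / 2) ((2 * f - (1 - q)) / 4))).trans
          (min_le_left _ _)
        linarith
      · have := (min_le_right (min r (1 / 2)) (min (f / 2) ((2 * f - (1 - q)) / 4))).trans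
          (min_le_right _ _)
        linarith
    refine ⟨fun n => 18 * Real.exp (-(η * Real.log n)), ?_,
      eventually_excess_of_sparse hβ hr hrq hη e1 e2 e3 e4 hm⟩
    have := (Real.tendsto_exp_neg_atTop_nhds_zero.comp
      (tendsto_log_natCast.const_mul_atTop hη)).const_mul 18
    simpa [Function.comp_def] using this
  · refine eventually_excess_of_single ?_ (eventually_eq_one hm)
    unfold detectionBoundary at h
    norm_num at h
    exact h

/-! ### The truncated second moment method -/

/-- The likelihood ratio of a normal law with mean `μ`. -/
def normalRatio (μ y : ℝ) : ℝ := Real.exp (μ * y - μ ^ 2 / 2)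

lemma normalRatio_nonneg (μ y : ℝ) : 0 ≤ normalRatio μ y := (Real.exp_pos _).le

lemma measurable_normalRatio (μ : ℝ) : Measurable (normalRatio μ) := by
  unfold normalRatio; fun_prop

lemma gaussianReal_eq_withDensity (μ : ℝ) : gaussianReal μ 1 =
    (gaussianReal 0 1).withDensity fun y => ENNReal.ofReal (normalRatio μ y) := by
  rw [gaussianReal_of_var_ne_zero μ one_ne_zero, gaussianReal_of_var_ne_zero 0 one_ne_zero,
    ← withDensity_mul _ (measurable_gaussianPDF 0 1) (measurable_normalRatio μ).ennreal_ofReal]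
  congr 1
  funext y
  rw [Pi.mul_apply, gaussianPDF_def, gaussianPDF_def,
    ← ENNReal.ofReal_mul (gaussianPDFReal_nonneg 0 1 y)]
  rw [gaussianPDFReal_def, gaussianPDFReal_def, normalRatio]
  simp only [NNReal.coe_one, mul_one]
  rw [mul_assoc, ← Real.exp_add]
  congr 2
  ring_nf

lemma pi_withDensity {n : ℕ} {μ : Measure ℝ} [IsProbabilityMeasure μ] {f : Fin n → ℝ → ENNReal}
    (hf : ∀ i, Measurable (f i)) [∀ i, SigmaFinite (μ.withDensity (f i))] :
    Measure.pi (fun i => μ.withDensity (f i)) =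
      (Measure.pi fun _ : Fin n => μ).withDensity fun x => ∏ i, f i (x i) := by
  refine Measure.pi_eq fun s hs => ?_
  rw [withDensity_apply _ (MeasurableSet.univ_pi hs), ← lintegral_indicator (MeasurableSet.univ_pi hs)]
  have h1 : ∀ x : Fin n → ℝ, (Set.univ.pi s).indicator (fun x => ∏ i, f i (x i)) x =
      ∏ i, (s i).indicator (f i) (x i) := by
    intro x
    by_cases hx : x ∈ Set.univ.pi s
    · rw [Set.indicator_of_mem hx]
      exact Finset.prod_congr rfl fun i _ => (Set.indicator_of_mem (hx i trivial) _).symm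
    · rw [Set.indicator_of_notMem hx]
      simp only [Set.mem_univ_pi, not_forall] at hx
      obtain ⟨i, hi⟩ := hx
      exact (Finset.prod_eq_zero (Finset.mem_univ i) (Set.indicator_of_notMem hi _)).symm
  simp only [h1]
  rw [lintegral_pi_prod fun i => (hf i).indicator (hs i)]
  refine Finset.prod_congr rfl fun i _ => ?_
  rw [lintegral_indicator (hs i), withDensity_apply _ (hs i)]

/-- The likelihood ratio for signal locations `S`. -/
def signalRatio {n : ℕ} (S : Finset (Fin n)) (μ : ℝ) (x : Fin n → ℝ) : ℝ :=
  ∏ i, normalRatio (if i ∈ S then μ else 0) (x i)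

lemma nullLaw_map_addSignal {n : ℕ} (S : Finset (Fin n)) (μ : ℝ) :
    (nullLaw n).map (addSignal S μ) =
      (nullLaw n).withDensity fun x => ENNReal.ofReal (signalRatio S μ x) := by
  have h1 : (nullLaw n).map (addSignal S μ) =
      Measure.pi fun i => gaussianReal (if i ∈ S then μ else 0) 1 := by
    unfold nullLaw addSignal
    rw [Measure.pi_map_pi (f := fun i y => (if i ∈ S then μ else 0) + y)
      fun i => (measurable_const.add measurable_id).aemeasurable]
    congr
    funext i
    rw [gaussianReal_map_const_add, zero_add]
  rw [h1]
  have h2 : (fun i : Fin n => gaussianReal (if i ∈ S then μ else 0) 1) = fun i =>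
      (gaussianReal 0 1).withDensity
        fun y => ENNReal.ofReal (normalRatio (if i ∈ S then μ else 0) y) := by
    funext i; exact gaussianReal_eq_withDensity _
  have : ∀ i : Fin n, SigmaFinite ((gaussianReal 0 1).withDensity
      fun y => ENNReal.ofReal (normalRatio (if i ∈ S then μ else 0) y)) := by
    intro i; rw [← gaussianReal_eq_withDensity]; infer_instance
  rw [h2, pi_withDensity fun i => (measurable_normalRatio _).ennreal_ofReal]
  unfold nullLaw signalRatio
  congr 1
  funext x
  rw [ENNReal.ofReal_prod_of_nonneg fun i _ => normalRatio_nonneg _ _]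

/-- The likelihood ratio, truncated at the observation `T`. -/
def truncRatio (μ T : ℝ) : ℝ → ℝ := (Set.Iio T).indicator (normalRatio μ)

lemma measurable_truncRatio (μ T : ℝ) : Measurable (truncRatio μ T) :=
  (measurable_normalRatio μ).indicator measurableSet_Iio

lemma truncRatio_nonneg (μ T y : ℝ) : 0 ≤ truncRatio μ T y :=
  Set.indicator_nonneg (fun _ _ => normalRatio_nonneg _ _) y

lemma truncRatio_le (μ T y : ℝ) : truncRatio μ T y ≤ normalRatio μ y :=
  Set.indicator_le_self' (fun _ _ => normalRatio_nonneg _ _) y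

lemma truncRatio_le_exp {μ T : ℝ} (hμ : 0 ≤ μ) (y : ℝ) :
    truncRatio μ T y ≤ Real.exp (μ * T) := by
  unfold truncRatio
  by_cases h : y ∈ Set.Iio T
  · rw [Set.indicator_of_mem h, normalRatio, Real.exp_le_exp]
    have := mul_le_mul_of_nonneg_left (Set.mem_Iio.1 h).le hμ
    nlinarith [sq_nonneg μ]
  · rw [Set.indicator_of_notMem h]; exact (Real.exp_pos _).le

lemma integral_truncRatio (μ T : ℝ) :
    ∫ y, truncRatio μ T y ∂(gaussianReal 0 1) = 1 - pValue (T - μ) := by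
  unfold truncRatio
  rw [integral_indicator measurableSet_Iio,
    integral_eq_lintegral_of_nonneg_ae (Eventually.of_forall fun _ => normalRatio_nonneg _ _)
      (measurable_normalRatio μ).aestronglyMeasurable,
    ← withDensity_apply _ measurableSet_Iio, ← gaussianReal_eq_withDensity]
  have h1 : gaussianReal μ 1 = (gaussianReal 0 1).map (fun x => μ + x) := by
    rw [gaussianReal_map_const_add, zero_add]
  have h2 : (fun x => μ + x) ⁻¹' Set.Iio T = (Set.Ici (T - μ))ᶜ := by
    ext x; simp [lt_sub_iff_add_lt']
  rw [h1, Measure.map_apply (by fun_prop) measurableSet_Iio, h2,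
    ← measureReal_def, probReal_compl_eq_one_sub measurableSet_Ici]
  rfl

/-- The indicator of `y < T` is at most `exp (lam * (T - y))`; what remains is a Gaussian
exponential moment. The parameter `lam` is left free for optimization. -/
lemma integral_truncRatio_sq_le {lam : ℝ} (μ T : ℝ) (hlam : 0 ≤ lam) :
    ∫ y, truncRatio μ T y ^ 2 ∂(gaussianReal 0 1) ≤
      Real.exp (-μ ^ 2 + lam * T + (2 * μ - lam) ^ 2 / 2) := by
  have h1 : Integrable (fun y => Real.exp (-μ ^ 2 + lam * T) * Real.exp ((2 * μ - lam) * y))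
      (gaussianReal 0 1) := (integrable_exp_mul_gaussianReal _).const_mul _
  have h2 : ∫ y, Real.exp (-μ ^ 2 + lam * T) * Real.exp ((2 * μ - lam) * y) ∂(gaussianReal 0 1) =
      Real.exp (-μ ^ 2 + lam * T + (2 * μ - lam) ^ 2 / 2) := by
    have h := congrFun (mgf_id_gaussianReal (μ := 0) (v := 1)) (2 * μ - lam)
    simp only [mgf, id] at h
    rw [integral_const_mul, h, ← Real.exp_add]
    congr 1
    simp
  rw [← h2]
  refine integral_mono_of_nonneg (Eventually.of_forall fun y => sq_nonneg _) h1
    (Eventually.of_forall fun y => ?_)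
  simp only
  rw [← Real.exp_add]
  unfold truncRatio
  by_cases h : y ∈ Set.Iio T
  · rw [Set.indicator_of_mem h, normalRatio, ← Real.exp_nat_mul, Real.exp_le_exp]
    have := mul_le_mul_of_nonneg_left (Set.mem_Iio.1 h).le hlam
    push_cast
    nlinarith
  · rw [Set.indicator_of_notMem h, zero_pow two_ne_zero]; positivity

/-- The truncated likelihood ratio for signal locations `S`. -/
def truncSignalRatio {n : ℕ} (S : Finset (Fin n)) (μ T : ℝ) (x : Fin n → ℝ) : ℝ :=
  ∏ i, if i ∈ S then truncRatio μ T (x i) else 1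

lemma measurable_truncSignalRatio {n : ℕ} (S : Finset (Fin n)) (μ T : ℝ) :
    Measurable (truncSignalRatio S μ T) := by
  refine Finset.measurable_prod _ fun i _ => ?_
  split_ifs
  · exact (measurable_truncRatio μ T).comp (measurable_pi_apply i)
  · exact measurable_const

lemma truncSignalRatio_nonneg {n : ℕ} (S : Finset (Fin n)) (μ T : ℝ) (x : Fin n → ℝ) :
    0 ≤ truncSignalRatio S μ T x := by
  refine Finset.prod_nonneg fun i _ => ?_
  split_ifs
  · exact truncRatio_nonneg _ _ _
  · exact zero_le_one

lemma truncSignalRatio_le {n : ℕ} (S : Finset (Fin n)) (μ T : ℝ) (x : Fin n → ℝ) :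
    truncSignalRatio S μ T x ≤ signalRatio S μ x := by
  refine Finset.prod_le_prod (fun i _ => ?_) fun i _ => ?_
  · split_ifs
    · exact truncRatio_nonneg _ _ _
    · exact zero_le_one
  · split_ifs
    · exact truncRatio_le _ _ _
    · simp [normalRatio]

lemma truncSignalRatio_le_exp {n : ℕ} (S : Finset (Fin n)) {μ T : ℝ} (hμ : 0 ≤ μ) (hT : 0 ≤ T)
    (x : Fin n → ℝ) : truncSignalRatio S μ T x ≤ Real.exp (μ * T) ^ n := by
  have h1 : (1 : ℝ) ≤ Real.exp (μ * T) := Real.one_le_exp (by positivity)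
  calc truncSignalRatio S μ T x ≤ ∏ _i : Fin n, Real.exp (μ * T) := by
        refine Finset.prod_le_prod (fun i _ => ?_) fun i _ => ?_
        · split_ifs
          · exact truncRatio_nonneg _ _ _
          · exact zero_le_one
        · split_ifs
          · exact truncRatio_le_exp hμ _
          · exact h1
    _ = _ := by simp

lemma integral_truncSignalRatio {n : ℕ} (S : Finset (Fin n)) (μ T : ℝ) :
    ∫ x, truncSignalRatio S μ T x ∂(nullLaw n) = (1 - pValue (T - μ)) ^ S.card := by
  unfold truncSignalRatio nullLaw
  rw [integral_fintype_prod_eq_prod (μ := fun _ : Fin n => gaussianReal 0 1)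
    (fun i y => if i ∈ S then truncRatio μ T y else 1)]
  have : ∀ i : Fin n, ∫ y, (if i ∈ S then truncRatio μ T y else 1) ∂(gaussianReal 0 1) =
      if i ∈ S then 1 - pValue (T - μ) else 1 := by
    intro i
    split_ifs
    · exact integral_truncRatio μ T
    · simp
  simp only [this, Finset.prod_ite_mem, Finset.univ_inter, Finset.prod_const]

/-- By independence only the common locations contribute a second moment; a location in exactly one
of the two sets contributes a mean, which is at most 1. -/
lemma integral_truncSignalRatio_mul_le {n : ℕ} (S S' : Finset (Fin n)) {μ T b : ℝ}
    (hb : ∫ y, truncRatio μ T y ^ 2 ∂(gaussianReal 0 1) ≤ b) :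
    ∫ x, truncSignalRatio S μ T x * truncSignalRatio S' μ T x ∂(nullLaw n) ≤
      b ^ (S ∩ S').card := by
  have hb0 : 0 ≤ b := (integral_nonneg fun y => sq_nonneg _).trans hb
  have hp0 : 0 ≤ 1 - pValue (T - μ) := by linarith [pValue_lt_one (T - μ)]
  have hp1 : 1 - pValue (T - μ) ≤ 1 := by linarith [pValue_nonneg (T - μ)]
  unfold truncSignalRatio nullLaw
  simp only [← Finset.prod_mul_distrib]
  rw [integral_fintype_prod_eq_prod (μ := fun _ : Fin n => gaussianReal 0 1)
    (fun i y => (if i ∈ S then truncRatio μ T y else 1) * if i ∈ S' then truncRatio μ T y else 1)]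
  have e : b ^ (S ∩ S').card = ∏ i : Fin n, if i ∈ S ∩ S' then b else 1 := by
    rw [Finset.prod_ite_mem, Finset.univ_inter, Finset.prod_const]
  rw [e]
  refine Finset.prod_le_prod (fun i _ => ?_) fun i _ => ?_
  · refine integral_nonneg fun y => mul_nonneg ?_ ?_ <;> split_ifs <;>
      first | exact truncRatio_nonneg _ _ _ | exact zero_le_one
  · by_cases h1 : i ∈ S <;> by_cases h2 : i ∈ S'
    · simp only [h1, h2, if_true, Finset.mem_inter, and_self, ← sq]
      exact hb
    · simp only [h1, h2, if_true, if_false, Finset.mem_inter, and_false, mul_one]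
      rw [integral_truncRatio]; exact hp1
    · simp only [h1, h2, if_true, if_false, Finset.mem_inter, false_and, one_mul]
      rw [integral_truncRatio]; exact hp1
    · simp [h1, h2]

/-! ### Overlap of two random signal sets. -/

lemma choose_sub_mul_pow_le {n m k : ℕ} (hmn : m ≤ n) (hk : k ≤ m) :
    (n - k).choose (m - k) * n ^ k ≤ n.choose m * m ^ k := by
  induction k with
  | zero => simp
  | succ k ih =>
    specialize ih (by omega)
    obtain ⟨a, ha⟩ : ∃ a, n - k = a + 1 := ⟨n - k - 1, by omega⟩
    obtain ⟨c, hc⟩ : ∃ c, m - k = c + 1 := ⟨m - k - 1, by omega⟩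
    have e1 : n - (k + 1) = a := by omega
    have e2 : m - (k + 1) = c := by omega
    rw [ha, hc] at ih
    rw [e1, e2]
    have h1 := Nat.add_one_mul_choose_eq a c
    -- This is `(m - k) / (n - k) ≤ m / n` with the denominators cleared.
    have h2 : (c + 1) * n ≤ m * (a + 1) := by
      have hn : n = a + 1 + k := by omega
      have hm : m = c + 1 + k := by omega
      rw [hn, hm]
      have : c ≤ a := by omega
      nlinarith
    refine Nat.le_of_mul_le_mul_left ?_ (Nat.succ_pos a)
    calc (a + 1) * (a.choose c * n ^ (k + 1)) = ((a + 1) * a.choose c) * n * n ^ k := by ring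
      _ = ((a + 1).choose (c + 1) * n ^ k) * ((c + 1) * n) := by
          rw [show (a + 1) * a.choose c = (a + 1).choose (c + 1) * (c + 1) from h1]; ring
      _ ≤ (n.choose m * m ^ k) * (m * (a + 1)) := Nat.mul_le_mul ih h2
      _ = (a + 1) * (n.choose m * m ^ (k + 1)) := by ring

lemma card_filter_superset_le {n m : ℕ} (A : Finset (Fin n)) :
    (((Finset.univ : Finset (Fin n)).powersetCard m).filter fun S => A ⊆ S).card ≤
      (n - A.card).choose (m - A.card) := by
  have h : (Aᶜ.powersetCard (m - A.card)).card = (n - A.card).choose (m - A.card) := by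
    rw [Finset.card_powersetCard, Finset.card_compl, Fintype.card_fin]
  rw [← h]
  refine Finset.card_le_card_of_injOn (fun S => S \ A) ?_ ?_
  · intro S hS
    simp only [Finset.coe_filter, Finset.mem_powersetCard, Set.mem_ofPred_eq] at hS
    rw [Finset.mem_coe, Finset.mem_powersetCard]
    refine ⟨fun i hi => ?_, ?_⟩
    · rw [Finset.mem_compl]; exact (Finset.mem_sdiff.1 hi).2
    · rw [Finset.card_sdiff_of_subset hS.2, hS.1.2]
  · intro S hS S' hS' heq
    simp only [Finset.coe_filter, Finset.mem_powersetCard, Set.mem_ofPred_eq] at hS hS'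
    have heq' : S \ A = S' \ A := heq
    rw [← Finset.sdiff_union_of_subset hS.2, ← Finset.sdiff_union_of_subset hS'.2, heq']

/-- Expand `(b + 1) ^ |S ∩ S'|` over the subsets `A` of the intersection. A random `S'` contains `A`
with probability at most `(m / n) ^ |A|`, as if its elements were drawn with replacement, and the
binomial theorem sums the result. -/
lemma sum_pow_card_inter_le {n m : ℕ} (hn : 1 ≤ n) (hmn : m ≤ n) {b : ℝ} (hb : 0 ≤ b)
    {S : Finset (Fin n)} (hS : S.card = m) :
    ∑ S' ∈ (Finset.univ : Finset (Fin n)).powersetCard m, b ^ (S ∩ S').card ≤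
      n.choose m * (1 + b * m / n) ^ m := by
  have hn0 : (0 : ℝ) < n := by exact_mod_cast hn
  have h1 : ∀ S' : Finset (Fin n), b ^ (S ∩ S').card ≤
      ∑ A ∈ S.powerset, if A ⊆ S' then b ^ A.card else 0 := by
    intro S'
    calc b ^ (S ∩ S').card ≤ (b + 1) ^ (S ∩ S').card := by gcongr; linarith
      _ = ∑ A ∈ (S ∩ S').powerset, b ^ A.card := by
        rw [← Finset.sum_pow_mul_eq_add_pow]; simp
      _ = _ := by
        rw [← Finset.sum_filter]
        refine Finset.sum_congr ?_ fun _ _ => rfl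
        ext A
        rw [Finset.mem_powerset, Finset.mem_filter, Finset.mem_powerset, Finset.subset_inter_iff]
  calc _ ≤ ∑ S' ∈ (Finset.univ : Finset (Fin n)).powersetCard m,
        ∑ A ∈ S.powerset, if A ⊆ S' then b ^ A.card else 0 := Finset.sum_le_sum fun S' _ => h1 S'
    _ = ∑ A ∈ S.powerset, (((Finset.univ : Finset (Fin n)).powersetCard m).filter
        fun S' => A ⊆ S').card * b ^ A.card := by
        rw [Finset.sum_comm]
        refine Finset.sum_congr rfl fun A _ => ?_
        rw [← Finset.sum_filter, Finset.sum_const, nsmul_eq_mul]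
    _ ≤ ∑ A ∈ S.powerset, n.choose m * (b * m / n) ^ A.card := by
        refine Finset.sum_le_sum fun A hA => ?_
        have hAm : A.card ≤ m := hS ▸ Finset.card_le_card (Finset.mem_powerset.1 hA)
        have h2 : ((((Finset.univ : Finset (Fin n)).powersetCard m).filter
            fun S' => A ⊆ S').card : ℝ) ≤ ((n - A.card).choose (m - A.card) : ℕ) := by
          exact_mod_cast card_filter_superset_le A
        have h3 : (((n - A.card).choose (m - A.card) : ℕ) : ℝ) * n ^ A.card ≤
            n.choose m * m ^ A.card := by
          exact_mod_cast choose_sub_mul_pow_le hmn hAm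
        rw [div_pow, mul_pow, mul_div_assoc', le_div_iff₀ (by positivity)]
        calc _ ≤ (((n - A.card).choose (m - A.card) : ℕ) : ℝ) * b ^ A.card * n ^ A.card := by
              gcongr
          _ = b ^ A.card * ((((n - A.card).choose (m - A.card) : ℕ) : ℝ) * n ^ A.card) := by ring
          _ ≤ b ^ A.card * (n.choose m * m ^ A.card) := by gcongr
          _ = _ := by ring
    _ = _ := by
        rw [← Finset.mul_sum]
        congr 1
        have := Finset.sum_pow_mul_eq_add_pow (b * m / n) 1 S
        simp only [one_pow, mul_one] at this
        rw [this, hS, add_comm]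

/-! ### Distance of the mixture from the null law. -/

/-- The truncated likelihood ratio of the mixture. -/
def truncMixtureRatio (n m : ℕ) (μ T : ℝ) (x : Fin n → ℝ) : ℝ :=
  (n.choose m : ℝ)⁻¹ *
    ∑ S ∈ (Finset.univ : Finset (Fin n)).powersetCard m, truncSignalRatio S μ T x

lemma integrable_of_measurable_bounded {n : ℕ} {f : (Fin n → ℝ) → ℝ} (hf : Measurable f) {c : ℝ}
    (h0 : ∀ x, 0 ≤ f x) (hc : ∀ x, f x ≤ c) : Integrable f (nullLaw n) :=
  Integrable.of_bound hf.aestronglyMeasurable c (Eventually.of_forall fun x => by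
    rw [Real.norm_of_nonneg (h0 x)]; exact hc x)

lemma integrable_truncSignalRatio_mul {n : ℕ} (S : Finset (Fin n)) {μ T : ℝ} (hμ : 0 ≤ μ)
    (hT : 0 ≤ T) {ψ : (Fin n → ℝ) → ℝ} (hψ : Measurable ψ) {c : ℝ} (h0 : ∀ x, 0 ≤ ψ x)
    (h1 : ∀ x, ψ x ≤ c) :
    Integrable (fun x => truncSignalRatio S μ T x * ψ x) (nullLaw n) :=
  integrable_of_measurable_bounded ((measurable_truncSignalRatio S μ T).mul hψ)
    (fun x => mul_nonneg (truncSignalRatio_nonneg S μ T x) (h0 x))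
    (fun x => mul_le_mul (truncSignalRatio_le_exp S hμ hT x) (h1 x) (h0 x) (by positivity))

/-- Truncation only removes mass, so the truncated ratio is a subdensity of the shifted law. -/
lemma integral_truncSignalRatio_mul_le_map {n : ℕ} (S : Finset (Fin n)) {μ T : ℝ} (hμ : 0 ≤ μ)
    (hT : 0 ≤ T) {ψ : (Fin n → ℝ) → ℝ} (hψ : Measurable ψ) (h0 : ∀ x, 0 ≤ ψ x)
    (h1 : ∀ x, ψ x ≤ 1) :
    ∫ x, truncSignalRatio S μ T x * ψ x ∂(nullLaw n) ≤
      ∫ x, ψ x ∂((nullLaw n).map (addSignal S μ)) := by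
  have hm : Measurable (signalRatio S μ) := Finset.measurable_prod _ fun i _ =>
    (measurable_normalRatio _).comp (measurable_pi_apply i)
  have hr0 : ∀ x, 0 ≤ signalRatio S μ x := fun x =>
    Finset.prod_nonneg fun i _ => normalRatio_nonneg _ _
  have hint : Integrable ψ ((nullLaw n).map (addSignal S μ)) := by
    have : IsProbabilityMeasure ((nullLaw n).map (addSignal S μ)) :=
      Measure.isProbabilityMeasure_map (measurable_addSignal S μ).aemeasurable
    exact Integrable.of_bound hψ.aestronglyMeasurable 1 (Eventually.of_forall fun x => by
      rw [Real.norm_of_nonneg (h0 x)]; exact h1 x)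
  rw [nullLaw_map_addSignal] at hint ⊢
  rw [integral_withDensity_eq_integral_toReal_smul hm.ennreal_ofReal
    (Eventually.of_forall fun _ => ENNReal.ofReal_lt_top)]
  rw [integrable_withDensity_iff_integrable_smul' hm.ennreal_ofReal
    (Eventually.of_forall fun _ => ENNReal.ofReal_lt_top)] at hint
  refine integral_mono (integrable_truncSignalRatio_mul S hμ hT hψ h0 h1) hint fun x => ?_
  simp only [smul_eq_mul, ENNReal.toReal_ofReal (hr0 x)]
  exact mul_le_mul_of_nonneg_right (truncSignalRatio_le S μ T x) (h0 x)

lemma integral_truncMixtureRatio_mul_le {n m : ℕ} {μ T : ℝ} (hμ : 0 ≤ μ)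
    (hT : 0 ≤ T) {ψ : (Fin n → ℝ) → ℝ} (hψ : Measurable ψ) (h0 : ∀ x, 0 ≤ ψ x)
    (h1 : ∀ x, ψ x ≤ 1) :
    ∫ x, truncMixtureRatio n m μ T x * ψ x ∂(nullLaw n) ≤ ∫ x, ψ x ∂(mixtureLaw n m μ) := by
  have hint : ∀ S ∈ (Finset.univ : Finset (Fin n)).powersetCard m,
      Integrable ψ ((nullLaw n).map (addSignal S μ)) := by
    intro S _
    have : IsProbabilityMeasure ((nullLaw n).map (addSignal S μ)) :=
      Measure.isProbabilityMeasure_map (measurable_addSignal S μ).aemeasurable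
    exact Integrable.of_bound hψ.aestronglyMeasurable 1 (Eventually.of_forall fun x => by
      rw [Real.norm_of_nonneg (h0 x)]; exact h1 x)
  have e1 : ∫ x, ψ x ∂(mixtureLaw n m μ) = (n.choose m : ℝ)⁻¹ *
      ∑ S ∈ (Finset.univ : Finset (Fin n)).powersetCard m,
        ∫ x, ψ x ∂((nullLaw n).map (addSignal S μ)) := by
    unfold mixtureLaw
    rw [integral_smul_measure, smul_eq_mul, ENNReal.toReal_inv, ENNReal.toReal_natCast]
    congr 1
    exact integral_finsetSum_measure hint
  have e2 : ∫ x, truncMixtureRatio n m μ T x * ψ x ∂(nullLaw n) = (n.choose m : ℝ)⁻¹ *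
      ∑ S ∈ (Finset.univ : Finset (Fin n)).powersetCard m,
        ∫ x, truncSignalRatio S μ T x * ψ x ∂(nullLaw n) := by
    unfold truncMixtureRatio
    simp only [mul_assoc, Finset.sum_mul]
    rw [integral_const_mul, integral_finsetSum _ fun S _ =>
      integrable_truncSignalRatio_mul S hμ hT hψ h0 h1]
  rw [e1, e2]
  gcongr with S hS
  exact integral_truncSignalRatio_mul_le_map S hμ hT hψ h0 h1

/-- Expand the square. The second moment is bounded through the overlap of two signal sets, and the
mean, which falls short of 1 by truncation, through Bernoulli's inequality. -/
lemma integral_truncMixtureRatio_sub_one_sq_le {n m : ℕ} (hn : 1 ≤ n) (hmn : m ≤ n) {μ T b : ℝ}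
    (hμ : 0 ≤ μ) (hT : 0 ≤ T) (hb : ∫ y, truncRatio μ T y ^ 2 ∂(gaussianReal 0 1) ≤ b) :
    ∫ x, (truncMixtureRatio n m μ T x - 1) ^ 2 ∂(nullLaw n) ≤
      Real.exp (b * m ^ 2 / n) - 1 + 2 * (m * pValue (T - μ)) := by
  have hb0 : 0 ≤ b := (integral_nonneg fun y => sq_nonneg _).trans hb
  have hc : (0 : ℝ) < n.choose m := by exact_mod_cast Nat.choose_pos hmn
  set K := (Finset.univ : Finset (Fin n)).powersetCard m with hK
  have hKc : (K.card : ℝ) = n.choose m := by simp [hK]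
  have hSc : ∀ S ∈ K, S.card = m := fun S hS => (Finset.mem_powersetCard.1 hS).2
  have hI1 : ∀ S, Integrable (fun x => truncSignalRatio S μ T x) (nullLaw n) := fun S =>
    integrable_of_measurable_bounded (measurable_truncSignalRatio S μ T)
      (truncSignalRatio_nonneg S μ T) (truncSignalRatio_le_exp S hμ hT)
  have hI2 : ∀ S S', Integrable (fun x => truncSignalRatio S μ T x * truncSignalRatio S' μ T x)
      (nullLaw n) := fun S S' =>
    integrable_truncSignalRatio_mul S hμ hT (measurable_truncSignalRatio S' μ T)
      (truncSignalRatio_nonneg S' μ T) (truncSignalRatio_le_exp S' hμ hT)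
  have e : ∀ x : Fin n → ℝ, (truncMixtureRatio n m μ T x - 1) ^ 2 =
      (n.choose m : ℝ)⁻¹ ^ 2 *
        (∑ S ∈ K, ∑ S' ∈ K, truncSignalRatio S μ T x * truncSignalRatio S' μ T x) -
      2 * (n.choose m : ℝ)⁻¹ * (∑ S ∈ K, truncSignalRatio S μ T x) + 1 := by
    intro x
    unfold truncMixtureRatio
    rw [← Finset.sum_mul_sum]
    ring
  simp only [e]
  rw [integral_add, integral_sub, integral_const_mul, integral_const_mul,
    integral_finsetSum _ fun S _ => hI1 S,
    integral_finsetSum _ fun S _ => integrable_finsetSum _ fun S' _ => hI2 S S']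
  rotate_left
  · exact (integrable_finsetSum _ fun S _ => integrable_finsetSum _ fun S' _ =>
      hI2 S S').const_mul _
  · exact (integrable_finsetSum _ fun S _ => hI1 S).const_mul _
  · exact ((integrable_finsetSum _ fun S _ => integrable_finsetSum _ fun S' _ =>
      hI2 S S').const_mul _).sub ((integrable_finsetSum _ fun S _ => hI1 S).const_mul _)
  · exact integrable_const _
  have h1 : ∑ S ∈ K, ∫ x, truncSignalRatio S μ T x ∂(nullLaw n) =
      n.choose m * (1 - pValue (T - μ)) ^ m := by
    rw [Finset.sum_congr rfl fun S hS => by rw [integral_truncSignalRatio, hSc S hS],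
      Finset.sum_const, nsmul_eq_mul, hKc]
  have h2 : ∑ S ∈ K, ∫ x, ∑ S' ∈ K, truncSignalRatio S μ T x * truncSignalRatio S' μ T x
      ∂(nullLaw n) ≤ n.choose m * (n.choose m * (1 + b * m / n) ^ m) := by
    rw [← hKc, ← nsmul_eq_mul]
    refine Finset.sum_le_card_nsmul _ _ _ fun S hS => ?_
    rw [integral_finsetSum _ fun S' _ => hI2 S S', hKc]
    refine le_trans (Finset.sum_le_sum fun S' _ => integral_truncSignalRatio_mul_le S S' hb) ?_
    exact sum_pow_card_inter_le hn hmn hb0 (hSc S hS)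
  have h3 : (1 + b * m / n) ^ m ≤ Real.exp (b * m ^ 2 / n) := by
    calc (1 + b * m / n) ^ m ≤ Real.exp (b * m / n) ^ m := by
          gcongr
          rw [add_comm]; exact Real.add_one_le_exp _
      _ = _ := by rw [← Real.exp_nat_mul]; congr 1; ring
  have h4 : 1 - m * pValue (T - μ) ≤ (1 - pValue (T - μ)) ^ m := by
    have := one_add_mul_le_pow (show -2 ≤ -pValue (T - μ) by linarith [pValue_lt_one (T - μ)]) m
    rw [← sub_eq_add_neg] at this
    linarith
  have h5 : (n.choose m : ℝ)⁻¹ ^ 2 * (∑ S ∈ K, ∫ x, ∑ S' ∈ K,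
      truncSignalRatio S μ T x * truncSignalRatio S' μ T x ∂(nullLaw n)) ≤
      Real.exp (b * m ^ 2 / n) := by
    calc _ ≤ (n.choose m : ℝ)⁻¹ ^ 2 * (n.choose m * (n.choose m * (1 + b * m / n) ^ m)) := by
          gcongr
      _ = (1 + b * m / n) ^ m := by field_simp
      _ ≤ _ := h3
  rw [h1]
  have h6 : 2 * (n.choose m : ℝ)⁻¹ * (n.choose m * (1 - pValue (T - μ)) ^ m) =
      2 * (1 - pValue (T - μ)) ^ m := by field_simp
  rw [h6]
  simp only [integral_const, probReal_univ, smul_eq_mul, mul_one]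
  linarith

/-- As the truncated ratio is a subdensity, `∫ ψ` under the mixture is at least its null value minus
the L¹ distance of the ratio from 1. Applying this to `φ` and to `1 - φ` gives the two sides. -/
lemma abs_errors_sub_one_le {n m : ℕ} (hn : 1 ≤ n) (hmn : m ≤ n) {μ T b : ℝ}
    (hμ : 0 ≤ μ) (hT : 0 ≤ T) (hb : ∫ y, truncRatio μ T y ^ 2 ∂(gaussianReal 0 1) ≤ b)
    {φ : (Fin n → ℝ) → ℝ} (hφ : Measurable φ) (hφ01 : ∀ x, 0 ≤ φ x ∧ φ x ≤ 1) :
    |(∫ x, φ x ∂(nullLaw n)) + (∫ x, (1 - φ x) ∂(mixtureLaw n m μ)) - 1| ≤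
      √(Real.exp (b * m ^ 2 / n) - 1 + 2 * (m * pValue (T - μ))) := by
  have := isProbabilityMeasure_mixtureLaw hmn μ
  set H := truncMixtureRatio n m μ T with hH
  have hHm : Measurable H :=
    (Finset.measurable_sum _ fun S _ => measurable_truncSignalRatio S μ T).const_mul _
  have hHL : MemLp (fun x => H x - 1) 2 (nullLaw n) := by
    have h1 : ∀ x, 0 ≤ H x := fun x =>
      mul_nonneg (by positivity) (Finset.sum_nonneg fun S _ => truncSignalRatio_nonneg S μ T x)
    obtain ⟨c, h2⟩ : ∃ c, ∀ x, H x ≤ c := by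
      refine ⟨(n.choose m : ℝ)⁻¹ *
        ∑ _S ∈ (Finset.univ : Finset (Fin n)).powersetCard m, Real.exp (μ * T) ^ n, fun x => ?_⟩
      rw [hH, truncMixtureRatio]
      gcongr with S hS
      exact truncSignalRatio_le_exp S hμ hT x
    refine MemLp.sub ?_ (memLp_const 1)
    refine MemLp.of_bound hHm.aestronglyMeasurable c (Eventually.of_forall fun x => ?_)
    rw [Real.norm_of_nonneg (h1 x)]
    exact h2 x
  have hHint : Integrable (fun x => H x - 1) (nullLaw n) := hHL.integrable (by norm_num)
  have hHint' : Integrable H (nullLaw n) := by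
    have := hHint.add (integrable_const (1 : ℝ))
    refine this.congr (Eventually.of_forall fun x => ?_)
    simp
  have habs : ∫ x, |H x - 1| ∂(nullLaw n) ≤
      √(Real.exp (b * m ^ 2 / n) - 1 + 2 * (m * pValue (T - μ))) := by
    refine Real.le_sqrt_of_sq_le (le_trans ?_
      (integral_truncMixtureRatio_sub_one_sq_le hn hmn hμ hT hb))
    -- The Cauchy-Schwarz inequality, read off from a nonnegative variance.
    have hv := variance_nonneg (fun x => |H x - 1|) (nullLaw n)
    have habsL : MemLp (fun x => |H x - 1|) 2 (nullLaw n) := hHL.abs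
    rw [variance_eq_sub habsL] at hv
    simp only [Pi.pow_apply, sq_abs] at hv
    linarith
  have hkey : ∀ ψ : (Fin n → ℝ) → ℝ, Measurable ψ → (∀ x, 0 ≤ ψ x) → (∀ x, ψ x ≤ 1) →
      ∫ x, ψ x ∂(nullLaw n) - ∫ x, |H x - 1| ∂(nullLaw n) ≤ ∫ x, ψ x ∂(mixtureLaw n m μ) := by
    intro ψ hψ h0 h1
    refine le_trans ?_ (integral_truncMixtureRatio_mul_le hμ hT hψ h0 h1)
    have hψint := integrable_of_measurable_bounded hψ h0 h1
    rw [← integral_sub hψint hHint.abs]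
    refine integral_mono (hψint.sub hHint.abs) ?_ fun x => ?_
    · exact hHint'.mul_bdd (c := 1) hψ.aestronglyMeasurable (Eventually.of_forall fun x => by
        rw [Real.norm_of_nonneg (h0 x)]; exact h1 x)
    · simp only
      have h3 : -|H x - 1| ≤ H x - 1 := neg_abs_le _
      have h4 : -|H x - 1| ≤ (H x - 1) * ψ x := by
        have := mul_le_mul_of_nonneg_right h3 (h0 x)
        have h5 : |H x - 1| * ψ x ≤ |H x - 1| := mul_le_of_le_one_right (abs_nonneg _) (h1 x)
        linarith
      rw [← hH]
      linarith
  have hφint0 := integrable_of_measurable_bounded hφ (fun x => (hφ01 x).1) (fun x => (hφ01 x).2)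
  have hφint1 : Integrable φ (mixtureLaw n m μ) :=
    Integrable.of_bound hφ.aestronglyMeasurable 1 (Eventually.of_forall fun x => by
      rw [Real.norm_of_nonneg (hφ01 x).1]; exact (hφ01 x).2)
  have k1 := hkey φ hφ (fun x => (hφ01 x).1) (fun x => (hφ01 x).2)
  have k2 := hkey (fun x => 1 - φ x) (measurable_const.sub hφ)
    (fun x => by linarith [(hφ01 x).2]) (fun x => by linarith [(hφ01 x).1])
  have e1 : ∫ x, (1 - φ x) ∂(nullLaw n) = 1 - ∫ x, φ x ∂(nullLaw n) := by
    rw [integral_sub (integrable_const _) hφint0]; simp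
  have e2 : ∫ x, (1 - φ x) ∂(mixtureLaw n m μ) = 1 - ∫ x, φ x ∂(mixtureLaw n m μ) := by
    rw [integral_sub (integrable_const _) hφint1]; simp
  rw [e1] at k2
  rw [abs_le]
  constructor <;> linarith

/-! ### Powerlessness below the boundary -/

/-- The last expression is the exponent of `n` in the bound for `b * m ^ 2 / n` when the tilt is `c
* √(2 log n)`. The second claim makes it unlikely that any signal observation reaches the truncation
level. -/
lemma exists_tilt {β r : ℝ} (hβ : 1 / 2 < β) (hβ1 : β ≤ 1) (hr : 0 < r)
    (h : r < detectionBoundary β) :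
    √r < 1 ∧ 1 - β < (1 - √r) ^ 2 ∧
      ∃ c, 0 ≤ c ∧ -2 * r + 2 * c + (2 * √r - c) ^ 2 + 1 - 2 * β < 0 := by
  have hs0 : 0 ≤ √(1 - β) := Real.sqrt_nonneg _
  have hs2 : √(1 - β) ^ 2 = 1 - β := Real.sq_sqrt (by linarith)
  set s := √(1 - β) with hs
  have hr2 : √r ^ 2 = r := Real.sq_sqrt hr.le
  have hr0 := Real.sqrt_nonneg r
  have hs1 : s < 1 := by nlinarith
  have hrs : r < (1 - s) ^ 2 := by
    unfold detectionBoundary at h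
    split_ifs at h with hb
    · nlinarith [sq_nonneg (s - 1 / 2)]
    · exact h
  have hlt : √r < 1 - s := by rw [Real.sqrt_lt' (by linarith)]; exact hrs
  have hsq : 1 - β < (1 - √r) ^ 2 := by
    rw [← hs2]; exact pow_lt_pow_left₀ (by linarith) hs0 two_ne_zero
  refine ⟨by linarith, hsq, ?_⟩
  rcases le_or_gt (√r) (1 / 2) with hh | hh
  · refine ⟨0, le_rfl, ?_⟩
    have : r < β - 1 / 2 := by
      unfold detectionBoundary at h
      split_ifs at h with hb
      · exact h
      · have : r ≤ 1 / 4 := by nlinarith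
        linarith
    have e : (2 * √r - 0) ^ 2 = 4 * r := by rw [sub_zero, mul_pow, hr2]; norm_num
    rw [e]; linarith
  -- This `c` minimizes the quadratic and turns it into `2 * (1 - β) - 2 * (1 - √r) ^ 2`. For `√r ≤
  -- 1 / 2` the minimizer would not be positive, so `c = 0` was taken there.
  · refine ⟨2 * √r - 1, by linarith, ?_⟩
    nlinarith

lemma tendsto_errors_of_lt {β r : ℝ} {m : ℕ → ℕ} (hβ : 1 / 2 < β) (hβ1 : β ≤ 1) (hr : 0 < r)
    (hm : Tendsto (fun n : ℕ => (m n : ℝ) / (n : ℝ) ^ (1 - β)) atTop (𝓝 1))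
    (h : r < detectionBoundary β) {φ : (n : ℕ) → (Fin n → ℝ) → ℝ}
    (hφ : ∀ n, Measurable (φ n)) (hφ01 : ∀ n x, 0 ≤ φ n x ∧ φ n x ≤ 1) :
    Tendsto (fun n : ℕ => (∫ x, φ n x ∂(nullLaw n)) +
      ∫ x, (1 - φ n x) ∂(mixtureLaw n (m n) √(2 * r * Real.log n))) atTop (𝓝 1) := by
  obtain ⟨hr1, hβr, c, hc, hc2⟩ := exists_tilt hβ hβ1 hr h
  set κ := -(-2 * r + 2 * c + (2 * √r - c) ^ 2 + 1 - 2 * β) with hκ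
  have hκ0 : 0 < κ := by rw [hκ]; linarith
  set κ' := (1 - √r) ^ 2 - (1 - β) with hκ'
  have hκ'0 : 0 < κ' := by rw [hκ']; linarith
  have hlim : Tendsto (fun L : ℝ =>
      √(Real.exp (4 * Real.exp (-(κ * L))) - 1 + 4 * Real.exp (-(κ' * L)))) atTop (𝓝 0) := by
    have h1 : ∀ k : ℝ, 0 < k → Tendsto (fun L : ℝ => Real.exp (-(k * L))) atTop (𝓝 0) :=
      fun k hk => Real.tendsto_exp_neg_atTop_nhds_zero.comp (tendsto_id.const_mul_atTop hk)
    have h2 := ((Real.continuous_exp.tendsto _).comp ((h1 κ hκ0).const_mul 4)).sub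
      (tendsto_const_nhds (x := (1 : ℝ)))
    have h3 := (Real.continuous_sqrt.tendsto _).comp (h2.add ((h1 κ' hκ'0).const_mul 4))
    simpa [Function.comp_def] using h3
  rw [tendsto_iff_norm_sub_tendsto_zero]
  refine squeeze_zero' (Eventually.of_forall fun n => norm_nonneg _) ?_
    (hlim.comp tendsto_log_natCast)
  filter_upwards [eventually_card_bounds hm, tendsto_log_natCast.eventually_ge_atTop 2,
    eventually_ge_atTop 1] with n ⟨_, hm2⟩ hL hn
  simp only [Function.comp_apply]
  set L := Real.log n with hLdef
  have hn0 : (0 : ℝ) < n := by exact_mod_cast hn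
  have hnL : (n : ℝ) = Real.exp L := (Real.exp_log hn0).symm
  have hmn : m n ≤ n := by
    have h2 : (2 : ℝ) ≤ Real.exp (β * L) := by
      have := Real.add_one_le_exp (β * L)
      nlinarith
    have : (m n : ℝ) ≤ n := by
      calc (m n : ℝ) ≤ 2 * Real.exp ((1 - β) * L) := hm2
        _ ≤ Real.exp (β * L) * Real.exp ((1 - β) * L) := by gcongr
        _ = n := by rw [← Real.exp_add, hnL]; congr 1; ring
    exact_mod_cast this
  have hμ : √(2 * r * L) = √r * √(2 * L) := by
    rw [← Real.sqrt_mul hr.le]; congr 1; ring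
  have hsq : √(2 * L) ^ 2 = 2 * L := Real.sq_sqrt (by linarith)
  have hr2 : √r ^ 2 = r := Real.sq_sqrt hr.le
  -- The truncation level is `√(2 * L)`, to first order the maximum of the noise.
  have hb := integral_truncRatio_sq_le (lam := c * √(2 * L)) (√r * √(2 * L)) (√(2 * L))
    (by positivity)
  have hexp : -(√r * √(2 * L)) ^ 2 + c * √(2 * L) * √(2 * L) +
      (2 * (√r * √(2 * L)) - c * √(2 * L)) ^ 2 / 2 = (2 * β - 1 - κ) * L := by
    have : -(√r * √(2 * L)) ^ 2 + c * √(2 * L) * √(2 * L) +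
        (2 * (√r * √(2 * L)) - c * √(2 * L)) ^ 2 / 2 =
        (-√r ^ 2 + c + (2 * √r - c) ^ 2 / 2) * √(2 * L) ^ 2 := by ring
    rw [this, hsq, hr2, hκ]; ring
  rw [hexp] at hb
  rw [hμ, Real.norm_eq_abs]
  refine (abs_errors_sub_one_le hn hmn (by positivity) (Real.sqrt_nonneg _) hb (hφ n)
    (hφ01 n)).trans (Real.sqrt_le_sqrt ?_)
  have h1 : Real.exp ((2 * β - 1 - κ) * L) * (m n : ℝ) ^ 2 / n ≤ 4 * Real.exp (-(κ * L)) := by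
    rw [div_le_iff₀ hn0]
    calc Real.exp ((2 * β - 1 - κ) * L) * (m n : ℝ) ^ 2
        ≤ Real.exp ((2 * β - 1 - κ) * L) * (2 * Real.exp ((1 - β) * L)) ^ 2 := by gcongr
      _ = 4 * (Real.exp ((2 * β - 1 - κ) * L) * Real.exp ((1 - β) * L) *
            Real.exp ((1 - β) * L)) := by ring
      _ = 4 * Real.exp (-(κ * L)) * n := by
          rw [← Real.exp_add, ← Real.exp_add, hnL, mul_assoc, ← Real.exp_add]
          congr 2; ring
  have h2 : (m n : ℝ) * pValue (√(2 * L) - √r * √(2 * L)) ≤ 2 * Real.exp (-(κ' * L)) := by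
    have e : √(2 * L) - √r * √(2 * L) = (1 - √r) * √(2 * L) := by ring
    rw [e]
    calc _ ≤ 2 * Real.exp ((1 - β) * L) * Real.exp (-((1 - √r) ^ 2 * L)) := by
          gcongr
          · exact pValue_nonneg _
          · exact pValue_mul_sqrt_le (by linarith) (by linarith)
      _ = _ := by rw [mul_assoc, ← Real.exp_add]; congr 2; rw [hκ']; ring
  have h3 := Real.exp_le_exp.2 h1
  linarith

end BlockDetection

end

theorem corollary5 :
    -- critical values that depend on `n` only
    ∃ cHC cBJ : ℕ → ℝ,
      -- the Type I errors vanish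
      Tendsto (fun n : ℕ => (BlockDetection.nullLaw n).real
        {x | cHC n < BlockDetection.structuredHC x}) atTop (𝓝 0) ∧
      Tendsto (fun n : ℕ => (BlockDetection.nullLaw n).real
        {x | cBJ n < BlockDetection.structuredBJ x}) atTop (𝓝 0) ∧
      ∀ (β r : ℝ) (m : ℕ → ℕ), 1 / 2 < β → β ≤ 1 → 0 < r →
        Tendsto (fun n : ℕ => (m n : ℝ) / (n : ℝ) ^ (1 - β)) atTop (𝓝 1) →
        -- above the boundary the powers tend to one
        (BlockDetection.detectionBoundary β < r →
          Tendsto (fun n : ℕ =>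
            (BlockDetection.mixtureLaw n (m n) √(2 * r * Real.log n)).real
              {x | cHC n < BlockDetection.structuredHC x}) atTop (𝓝 1) ∧
          Tendsto (fun n : ℕ =>
            (BlockDetection.mixtureLaw n (m n) √(2 * r * Real.log n)).real
              {x | cBJ n < BlockDetection.structuredBJ x}) atTop (𝓝 1)) ∧
        -- below the boundary every (randomized) test is asymptotically powerless
        (r < BlockDetection.detectionBoundary β →
          ∀ φ : (n : ℕ) → (Fin n → ℝ) → ℝ,
            (∀ n, Measurable (φ n)) → (∀ n x, 0 ≤ φ n x ∧ φ n x ≤ 1) →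
            Tendsto (fun n : ℕ =>
              (∫ x, φ n x ∂(BlockDetection.nullLaw n)) +
                ∫ x, (1 - φ n x) ∂(BlockDetection.mixtureLaw n (m n) √(2 * r * Real.log n)))
              atTop (𝓝 1)) := by
  -- Both values dominate the null bounds, and each is of smaller order than the excess under every
  -- alternative above the boundary, so they need not depend on `β` or `r`.
  refine ⟨fun n => Real.log n ^ 3, fun n => √(Real.log n), ?_, ?_, ?_⟩
  · refine squeeze_zero' (Eventually.of_forall fun n => measureReal_nonneg) ?_
      BlockDetection.tendsto_nullLaw_nullBad
    filter_upwards [BlockDetection.tendsto_log_natCast.eventually_ge_atTop 400] with n hL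
    refine measureReal_mono fun x hx => ?_
    by_contra hcon
    exact absurd hx (not_lt.2 (BlockDetection.structuredHC_le_of_not_nullBad hL hcon))
  · refine squeeze_zero' (Eventually.of_forall fun n => measureReal_nonneg) ?_
      BlockDetection.tendsto_nullLaw_nullBad
    filter_upwards [BlockDetection.tendsto_log_natCast.eventually_ge_atTop 400] with n hL
    refine measureReal_mono fun x hx => ?_
    by_contra hcon
    exact absurd hx (not_lt.2 (BlockDetection.structuredBJ_le_of_not_nullBad hL hcon))
  · intro β r m hβ hβ1 hr hm
    refine ⟨fun h => ?_, fun h φ hφ hφ01 =>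
      BlockDetection.tendsto_errors_of_lt hβ hβ1 hr hm h hφ hφ01⟩
    obtain ⟨δ, hδ, hE⟩ := BlockDetection.exists_excess hβ hβ1 hr hm h
    constructor
    · refine BlockDetection.tendsto_power hδ (hE.mono ?_)
      rintro n ⟨hmn, E, hEm, hEs, hS⟩
      exact ⟨hmn, E, hEm, fun x hx => (hEs hx).2, hS⟩
    · refine BlockDetection.tendsto_power hδ (hE.mono ?_)
      rintro n ⟨hmn, E, hEm, hEs, hS⟩
      exact ⟨hmn, E, hEm, fun x hx => (hEs hx).1, hS⟩
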